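/- Write $\mathbb R_+=(0,\infty)$. For $m>1$ let $X_m=L_1(\mathbb R_+,(1+x^m)\,dx)$ (real-valued) with norm $\|\cdot\|_m$; for $k\ge 0$ let $X_k^*$ be the space of measurable functions $g$ on $\mathbb R_+$ with $\|g\|_k^*=\operatorname{ess\,sup}_{x>0}\frac{|g(x)|}{1+x^k}<\infty$, and put $\langle g,f\rangle=\int_0^\infty g(x)f(x)\,dx$. Derivatives $\partial_x$ are taken in the sense of distributions on $\mathbb R_+$. Assumptions. (i) $r$ is continuous on $\mathbb R_+$, $0<r(x)\le r_0(1+x)$ for all $x>0$, and $\int_0^\delta \frac{ds}{r(s)}<\infty$ for some $\delta>0$. (ii) $a$ is measurable and $0\le a(x)\le a_0(1+x^p)$ for all $x>0$, where $p>0$. (iii) $b\ge 0$ is measurable, $b(x,y)=0$ for $x>y$, and, with $n_s(y)=\int_0^y x^s b(x,y)\,dx$, one has $n_1(y)=y$ and $n_0(y)\le b_0(1+y^l)$ for all $y>0$, where $l\ge 0$. Moreover $\liminf_{y\to\infty}\frac{y^{m_0}-n_{m_0}(y)}{y^{m_0}}>0$ for some $m_0>1$. (iv) $m>1$ if $l+p\le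 1$, and $m\ge l+p$ if $l+p>1$. (v) $0\le\beta\in X_k^*$ for some $k\ge 0$ with $k+p\le m$, and $\partial_x\beta\in X_{m-1}^*$. Let $K_{\beta,m}$ be the operator in $X_m$ given by $$[K_{\beta,m}u](x)=-\partial_x\bigl(r(x)u(x)\bigr)-a(x)u(x)+\int_x^\infty a(y)b(x,y)u(y)\,dy$$ with domain consisting of all $u\in X_m$ such that $\partial_x(ru)\in X_m$, $au\in X_m$ and $\lim_{x\to0^+}r(x)u(x)=\langle\beta,u\rangle$ (where the continuous representative of $ru$ is used), and let $K_{0,m}$ be the same operator with $\beta$ replaced by $0$. Put $R(x)=\int_0^x\frac{ds}{r(s)}$, $Q(x)=\int_0^x\frac{a(s)}{r(s)}\,ds$ and, for $\lambda>2mr_0+\|\beta\|_m^*$, $$e_\lambda(x)=\frac{e^{-\lambda R(x)-Q(x)}}{r(x)},\qquad E_\lambda f=\frac{\langle\beta,f\rangle}{1-\langle\beta,e_\lambda\rangle}\,e_\lambda .$$ **Theorem.** Under these assumptions $K_{0,m}$ and $K_{\beta,m}$ generate $C_0$-semigroups $(S_{K_{0,m}}(t))_{t\ge0}$ and $(S_{K_{\beta,m}}(t))_{t\ge0}$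 on $X_m$, and the latter is similar to a compact perturbation of the former: for every $\lambda>2mr_0+\|\beta\|_m^*$ one has $e_\lambda\in X_m$ and $\langle\beta,e_\lambda\rangle<1$, so that $E_\lambda$ is a well-defined bounded operator on $X_m$, the operator $I+E_\lambda$ is invertible, and $$(I+E_\lambda)^{-1}S_{K_{\beta,m}}(t)(I+E_\lambda)-S_{K_{0,m}}(t)\quad\text{is compact on }X_m\text{ for every }t\ge0 .$$ -/

import Mathlib

open MeasureTheory Set Filter Topology
open scoped ENNReal NNReal ContDiff

noncomputable section

namespace GrowthFrag

/-- Lebesgue measure on `(0, ∞)`. -/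
def lebPos : Measure ℝ := volume.restrict (Ioi 0)

/-- The measure `(1 + x^m) dx` on `(0, ∞)`. -/
def weightedMeasure (m : ℝ) : Measure ℝ :=
  lebPos.withDensity (fun x => ENNReal.ofReal (1 + x ^ m))

/-- The space `X_m = L_1((0, ∞), (1 + x^m) dx)` with its norm. -/
abbrev X (m : ℝ) := Lp ℝ 1 (weightedMeasure m)

/-- `β ∈ X_k^*`: `β` is measurable and `|β(x)| / (1 + x^k)` is essentially bounded on `(0, ∞)`. -/
def MemDual (k : ℝ) (β : ℝ → ℝ) : Prop :=
  MemLp (fun x => β x / (1 + x ^ k)) ∞ lebPos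

/-- The dual norm `ess sup_{x > 0} |β(x)| / (1 + x^m)`. -/
def dualNorm (m : ℝ) (β : ℝ → ℝ) : ℝ :=
  (eLpNorm (fun x => β x / (1 + x ^ m)) ∞ lebPos).toReal

/-- The duality pairing `⟨g, f⟩ = ∫_0^∞ g(x) f(x) dx`. -/
def pairing (g f : ℝ → ℝ) : ℝ := ∫ x, g x * f x ∂lebPos

/-- `∂_x f = g` in the sense of distributions on `(0, ∞)`. -/
structure HasDistribDeriv (f g : ℝ → ℝ) : Prop where
  locInt : LocallyIntegrableOn f (Ioi 0)
  locInt_deriv : LocallyIntegrableOn g (Ioi 0)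
  integral_eq : ∀ φ : ℝ → ℝ, ContDiff ℝ ∞ φ → HasCompactSupport φ → tsupport φ ⊆ Ioi 0 →
    ∫ x, f x * deriv φ x ∂lebPos = -∫ x, g x * φ x ∂lebPos

/-- The moment `n_s(y) = ∫_0^y x^s b(x, y) dx`, as an extended nonnegative number. -/
def moment (b : ℝ → ℝ → ℝ) (s y : ℝ) : ℝ≥0∞ :=
  ∫⁻ x in Ioo 0 y, ENNReal.ofReal (x ^ s * b x y)

/-- `N_s(y) = y^s - n_s(y)`. -/
def momentDefect (b : ℝ → ℝ → ℝ) (s y : ℝ) : ℝ := y ^ s - (moment b s y).toReal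

/-- The gain operator `(𝓑 u)(x) = ∫_x^∞ a(y) b(x, y) u(y) dy`. -/
def gain (a : ℝ → ℝ) (b : ℝ → ℝ → ℝ) (u : ℝ → ℝ) (x : ℝ) : ℝ :=
  ∫ y in Ioi x, a y * b x y * u y

/-- `u ∈ D(Z_{β,m})`, with `∂_x (r u) = g`: both `∂_x (r u)` and `a u` belong to `X_m`, and the
continuous representative of `r u` on `(0, ∞)` tends to `∫_0^∞ β u` at `0`. -/
structure MemDomZ (r a β : ℝ → ℝ) (m : ℝ) (u g : X m) : Prop where
  hasDeriv : HasDistribDeriv (fun x => r x * u x) g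
  integrable_mul : Integrable (fun x => a x * u x) (weightedMeasure m)
  boundary : ∃ w : ℝ → ℝ, ContinuousOn w (Ioi 0) ∧ w =ᵐ[lebPos] (fun x => r x * u x) ∧
    Tendsto w (𝓝[>] 0) (𝓝 (pairing β u))

/-- The graph of `K_{β,m} = Z_{β,m} + B_m` with domain `D(Z_{β,m})`: `u ∈ D(Z_{β,m})` and
`v = -∂_x (r u) - a u + 𝓑 u`. -/
def GraphK (r a : ℝ → ℝ) (b : ℝ → ℝ → ℝ) (β : ℝ → ℝ) (m : ℝ) (u v : X m) : Prop :=
  ∃ g : X m, MemDomZ r a β m u g ∧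
    v =ᵐ[lebPos] (fun x => -g x - a x * u x + gain a b u x)

/-- Strongly continuous one-parameter semigroups of bounded operators on a Banach space. -/
structure IsC0Semigroup {E : Type*} [NormedAddCommGroup E] [NormedSpace ℝ E]
    (S : ℝ≥0 → E →L[ℝ] E) : Prop where
  map_zero : S 0 = 1
  map_add : ∀ s t, S (s + t) = S s * S t
  strongly_continuous : ∀ f, Continuous (fun t => S t f)

/-- `S` is a `C_0`-semigroup whose generator is exactly the operator with graph `G`. -/
structure IsGeneratedBy {E : Type*} [NormedAddCommGroup E] [NormedSpace ℝ E]
    (S : ℝ≥0 → E →L[ℝ] E) (G : E → E → Prop) : Prop where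
  semigroup : IsC0Semigroup S
  generator : ∀ u v, G u v ↔
    Tendsto (fun t : ℝ≥0 => (t : ℝ)⁻¹ • (S t u - u)) (𝓝[>] 0) (𝓝 v)

/-- `R(x) = ∫_0^x ds / r(s)`. -/
def bigR (r : ℝ → ℝ) (x : ℝ) : ℝ := ∫ s in Ioo 0 x, 1 / r s

/-- `Q(x) = ∫_0^x a(s) / r(s) ds`. -/
def bigQ (r a : ℝ → ℝ) (x : ℝ) : ℝ := ∫ s in Ioo 0 x, a s / r s

/-- `e_μ(x) = exp(-μ R(x) - Q(x)) / r(x)`. -/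
def eFun (r a : ℝ → ℝ) (μ x : ℝ) : ℝ := Real.exp (-μ * bigR r x - bigQ r a x) / r x

/-- `E` is the rank-one operator `f ↦ e_μ ⟨β, f⟩ / (1 - ⟨β, e_μ⟩)` on `X_m`, where `e_μ ∈ X_m` and
`⟨β, e_μ⟩ < 1`. -/
structure IsEOp (r a β : ℝ → ℝ) (m μ : ℝ) (E : X m →L[ℝ] X m) : Prop where
  integrable_eFun : Integrable (eFun r a μ) (weightedMeasure m)
  pairing_lt_one : pairing β (eFun r a μ) < 1
  apply_eq : ∀ f : X m, E f =ᵐ[lebPos]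
    (fun x => eFun r a μ x * (pairing β f / (1 - pairing β (eFun r a μ))))

end GrowthFrag

end

noncomputable section

namespace GrowthFrag

section

/-! ### Primitives on `[0, ∞)` -/

/-! Conjugation. Write `ψ = ⟨β, ·⟩`, `e = e_λ` and `T = I - e ⊗ ψ`. Because `r e = exp (-λR - Q)`
equals `1` at `0`, subtracting `ψ(u) e` removes the boundary value of `r u`: `T` maps the domain of
`K_β` into that of `K_0`, and `K_0 T u = K_β u - ψ(u) h` with `h = λ e + 𝓑(a e)`, since `-∂(r e) - a
e = λ e`. The bound `‖e‖ ≤ 1 / (λ - 2 m r₀)` gives `ψ(e) < 1`, so `T` is invertible with inverse `I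
+ E_λ`. It remains to see that `T S_β(t) - S_0(t) T` is compact.

Compactness. The curve `s ↦ S_0(t - s) T S_β(s) u` joins `S_0(t) T u` to `T S_β(t) u` and has right
derivative `S_0(t - s) (ψ(u_s) h - ψ(K_β u_s) e)`, where `u_s = S_β(s) u`. Its values lie in the
span of the compact orbits of `h` and `e`, so it is enough to bound `|ψ(u_s)| + |ψ(K_β u_s)|` in
`L¹(0, t)` by `‖u‖`. Integration by parts makes the transport part of `ψ(K_β u)` bounded in `u`,
because `β' r` is again dominated by the weight; what is left is of order `‖a u‖`. For `u ≥ 0` the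
mass balance `d/ds ‖u_s‖ ≤ ω ‖u_s‖ - c ‖a u_s‖` bounds the time integral of `‖a u_s‖`. The unit ball
is thus sent into differences of elements of a closed convex hull of a compact set. A Hahn–Banach
separation replaces vector-valued integration by a scalar differential inequality (`dual_curve_le`,
`IsRankOneConjugate.isCompactOperator`, `exists_control`).

Generation. The transport resolvent is explicit: an integrating factor solves the equation with zero
boundary value, and a rank-one correction by `e` handles `β`. The hypothesis on the `m₀`-th moment
is interpolated to the `m`-th, so that for large `y` the gain is at most `1 - c` times the loss.
Then `𝓑 a R(ν, Z_β)` has norm at most `1 - c`, a Neumann series gives a positive resolvent of `K_β`,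
and the same mass balance gives the bound `1 / (ν - ω)`. A Hille–Yosida theorem for this bound,
which keeps track of an invariant closed cone, yields positive semigroups. -/

theorem _root_.AbsolutelyContinuousOnInterval.of_dist_le {F G : ℝ → ℝ} {x y K : ℝ}
    (hG : AbsolutelyContinuousOnInterval G x y) (hK : 0 ≤ K)
    (h : ∀ s ∈ uIcc x y, ∀ t ∈ uIcc x y, dist (F s) (F t) ≤ K * dist (G s) (G t)) :
    AbsolutelyContinuousOnInterval F x y := by
  rw [absolutelyContinuousOnInterval_iff] at hG ⊢
  intro ε hε
  -- Dividing by `K + 1` instead of `K` covers `K = 0` and leaves room for the strict inequality.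
  obtain ⟨δ, hδ, H⟩ := hG (ε / (K + 1)) (by positivity)
  refine ⟨δ, hδ, fun E hE hlt => ?_⟩
  have h1 := H E hE hlt
  calc ∑ i ∈ Finset.range E.1, dist (F (E.2 i).1) (F (E.2 i).2)
      ≤ ∑ i ∈ Finset.range E.1, K * dist (G (E.2 i).1) (G (E.2 i).2) :=
        Finset.sum_le_sum fun i hi => h _ (hE.1 i hi).1 _ (hE.1 i hi).2
    _ = K * ∑ i ∈ Finset.range E.1, dist (G (E.2 i).1) (G (E.2 i).2) := by rw [Finset.mul_sum]
    _ ≤ K * (ε / (K + 1)) := by gcongr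
    _ < ε := by
        rw [mul_div_assoc', div_lt_iff₀ (by positivity)]
        nlinarith

/-- `F` is absolutely continuous on `[0, ∞)` with derivative `f`. -/
structure IsPrimitive (F f : ℝ → ℝ) : Prop where
  intervalIntegrable : ∀ x, 0 ≤ x → IntervalIntegrable f volume 0 x
  eq_integral : ∀ x, 0 ≤ x → F x = F 0 + ∫ t in (0 : ℝ)..x, f t

namespace IsPrimitive

variable {F G f g : ℝ → ℝ}

theorem absolutelyContinuous (h : IsPrimitive F f) {x : ℝ} (hx : 0 ≤ x) :
    AbsolutelyContinuousOnInterval F 0 x := by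
  refine ((h.intervalIntegrable x hx).absolutelyContinuousOnInterval_intervalIntegral
    (left_mem_uIcc)).of_dist_le zero_le_one fun s hs t ht => ?_
  rw [uIcc_of_le hx] at hs ht
  simp [h.eq_integral s hs.1, h.eq_integral t ht.1]

theorem continuousOn (h : IsPrimitive F f) : ContinuousOn F (Ici 0) := by
  intro x hx
  have h1 := (h.absolutelyContinuous (x := x + 1) (by have : (0:ℝ) ≤ x := hx; linarith)).continuousOn
  have hx0 : (0:ℝ) ≤ x := hx
  rw [uIcc_of_le (by linarith)] at h1
  refine (h1 x ⟨hx0, by linarith⟩).mono_of_mem_nhdsWithin ?_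
  rw [← Ici_inter_Iic]
  exact inter_mem_nhdsWithin _ (Iic_mem_nhds (by linarith))

theorem ae_hasDerivAt (h : IsPrimitive F f) : ∀ᵐ x : ℝ, 0 < x → HasDerivAt F (f x) x := by
  have H : ∀ n : ℕ, ∀ᵐ x : ℝ, x ∈ uIcc (0 : ℝ) n →
      ∀ c ∈ uIcc (0 : ℝ) n, HasDerivAt (fun x => ∫ t in c..x, f t) (f x) x := fun n =>
    (h.intervalIntegrable n n.cast_nonneg).ae_hasDerivAt_integral
  filter_upwards [ae_all_iff.2 H] with x hx hx0
  obtain ⟨n, hn⟩ := exists_nat_ge x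
  have h1 := hx n (by rw [uIcc_of_le n.cast_nonneg]; exact ⟨hx0.le, hn⟩) 0 left_mem_uIcc
  refine (h1.const_add (F 0)).congr_of_eventuallyEq ?_
  filter_upwards [Ioi_mem_nhds hx0] with y hy using h.eq_integral y (le_of_lt hy)

/-- Fundamental theorem of calculus for absolutely continuous functions. The rate `a` is only
measurable, so products and exponentials can be differentiated only almost everywhere. -/
theorem of_ae_hasDerivAt (hF : ∀ x, 0 ≤ x → AbsolutelyContinuousOnInterval F 0 x)
    (h : ∀ᵐ x : ℝ, 0 < x → HasDerivAt F (f x) x) : IsPrimitive F f := by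
  have key : ∀ x, 0 ≤ x → deriv F =ᵐ[volume.restrict (uIoc 0 x)] f := by
    intro x hx
    rw [EventuallyEq, ae_restrict_iff' measurableSet_uIoc]
    filter_upwards [h] with y hy hyx
    rw [uIoc_of_le hx] at hyx
    exact (hy hyx.1).deriv
  refine ⟨fun x hx => (hF x hx).intervalIntegrable_deriv.congr_ae (key x hx), fun x hx => ?_⟩
  have := (hF x hx).integral_deriv_eq_sub
  rw [← intervalIntegral.integral_congr_ae_restrict (key x hx), this]
  ring

theorem mul (hF : IsPrimitive F f) (hG : IsPrimitive G g) :
    IsPrimitive (fun x => F x * G x) (fun x => f x * G x + F x * g x) :=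
  of_ae_hasDerivAt
    (fun _ hx => (hF.absolutelyContinuous hx).fun_mul (hG.absolutelyContinuous hx)) <| by
      filter_upwards [hF.ae_hasDerivAt, hG.ae_hasDerivAt] with x h1 h2 hx using (h1 hx).mul (h2 hx)

theorem exp (hF : IsPrimitive F f) :
    IsPrimitive (fun x => Real.exp (F x)) (fun x => Real.exp (F x) * f x) := by
  refine of_ae_hasDerivAt (fun x hx => ?_) ?_
  · have hac := hF.absolutelyContinuous hx
    obtain ⟨C, hC⟩ := hac.exists_bound
    -- On the bounded range `[-C, C]` of `F` the exponential is Lipschitz with constant `exp C`.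
    refine hac.of_dist_le (K := Real.exp C) (Real.exp_pos _).le fun s hs t ht => ?_
    have hb : ∀ z ∈ Icc (-C) C, ‖deriv Real.exp z‖ ≤ Real.exp C := by
      intro z hz
      rw [Real.deriv_exp, Real.norm_eq_abs, abs_of_pos (Real.exp_pos _)]
      exact Real.exp_le_exp.2 hz.2
    rw [dist_comm, dist_comm (F s)]
    simpa [dist_eq_norm] using (convex_Icc (-C) C).norm_image_sub_le_of_norm_deriv_le
      (fun z _ => Real.differentiableAt_exp) hb (abs_le.1 (hC s hs)) (abs_le.1 (hC t ht))
  · filter_upwards [hF.ae_hasDerivAt] with x h1 hx using (h1 hx).exp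

theorem of_hasDerivAt (h : ∀ x, 0 ≤ x → HasDerivAt F (f x) x) (hf : ContinuousOn f (Ici 0)) :
    IsPrimitive F f := by
  have hi : ∀ x, 0 ≤ x → IntervalIntegrable f volume 0 x := fun x hx =>
    (hf.mono (by rw [uIcc_of_le hx]; exact Icc_subset_Ici_self)).intervalIntegrable
  refine ⟨hi, fun x hx => ?_⟩
  rw [intervalIntegral.integral_eq_sub_of_hasDerivAt (fun y hy => h y ?_) (hi x hx)]
  · ring
  · rw [uIcc_of_le hx] at hy
    exact hy.1

theorem sub_eq (h : IsPrimitive F f) {x y : ℝ} (hx : 0 ≤ x) (hy : 0 ≤ y) :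
    F y - F x = ∫ t in x..y, f t := by
  rw [h.eq_integral x hx, h.eq_integral y hy,
    ← intervalIntegral.integral_interval_sub_left (h.intervalIntegrable y hy)
      (h.intervalIntegrable x hx)]
  ring

theorem of_integral {c : ℝ} (hf : ∀ x, 0 ≤ x → IntervalIntegrable f volume 0 x) :
    IsPrimitive (fun x => c + ∫ t in (0 : ℝ)..x, f t) f :=
  ⟨hf, fun x _ => by simp⟩

theorem congr_ae (h : IsPrimitive F f) (hfg : f =ᵐ[lebPos] g) : IsPrimitive F g := by
  have key : ∀ x, 0 ≤ x → f =ᵐ[volume.restrict (uIoc 0 x)] g := fun x hx =>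
    ae_restrict_of_ae_restrict_of_subset (by rw [uIoc_of_le hx]; exact Ioc_subset_Ioi_self) hfg
  refine ⟨fun x hx => (h.intervalIntegrable x hx).congr_ae (key x hx), fun x hx => ?_⟩
  rw [h.eq_integral x hx, intervalIntegral.integral_congr_ae_restrict (key x hx)]

end IsPrimitive

end

section

/-! ### Distributional derivatives -/

theorem exists_tsupport_subset_Icc {φ : ℝ → ℝ} (hc : HasCompactSupport φ)
    (hs : tsupport φ ⊆ Ioi 0) : ∃ α N : ℝ, 0 < α ∧ α ≤ N ∧ tsupport φ ⊆ Icc α N := by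
  rcases (tsupport φ).eq_empty_or_nonempty with h | h
  · exact ⟨1, 1, one_pos, le_rfl, by simp [h]⟩
  · obtain ⟨p, hp, hp'⟩ := hc.isCompact.exists_isLeast h
    obtain ⟨q, hq, hq'⟩ := hc.isCompact.exists_isGreatest h
    exact ⟨p, q, hs hp, hp' hq, fun x hx => ⟨hp' hx, hq' hx⟩⟩

theorem integral_lebPos_eq_intervalIntegral {φ : ℝ → ℝ} {N : ℝ} (hN : 0 ≤ N)
    (h : ∀ x, 0 < x → N < x → φ x = 0) : ∫ x, φ x ∂lebPos = ∫ x in (0 : ℝ)..N, φ x := by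
  rw [intervalIntegral.integral_of_le hN, lebPos]
  refine setIntegral_eq_of_subset_of_forall_sdiff_eq_zero measurableSet_Ioi
    Ioc_subset_Ioi_self fun x hx => h x hx.1 ?_
  by_contra hlt
  exact hx.2 ⟨hx.1, not_lt.1 hlt⟩

theorem IsPrimitive.locallyIntegrableOn {F f : ℝ → ℝ} (h : IsPrimitive F f) :
    LocallyIntegrableOn f (Ioi 0) := by
  intro x hx
  refine ⟨Ioc 0 (x + 1), mem_nhdsWithin_of_mem_nhds (Ioc_mem_nhds hx (by linarith)), ?_⟩
  have hx0 : (0 : ℝ) < x := hx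
  exact (intervalIntegrable_iff_integrableOn_Ioc_of_le (by linarith)).1
    (h.intervalIntegrable (x + 1) (by linarith))

theorem IsPrimitive.integral_mul_deriv {F f φ : ℝ → ℝ} (h : IsPrimitive F f)
    (hφ : ContDiff ℝ ∞ φ) (hc : HasCompactSupport φ) (hs : tsupport φ ⊆ Ioi 0) :
    ∫ x, F x * deriv φ x ∂lebPos = -∫ x, f x * φ x ∂lebPos := by
  obtain ⟨α, N, hα, hαN, hsub⟩ := exists_tsupport_subset_Icc hc hs
  have hφ0 : ∀ x, x ∉ Icc α N → φ x = 0 := fun x hx => image_eq_zero_of_notMem_tsupport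
    fun hx' => hx (hsub hx')
  have hφ1 : ∀ x, x ∉ Icc α N → deriv φ x = 0 := fun x hx => image_eq_zero_of_notMem_tsupport
    fun hx' => hx (hsub (tsupport_deriv_subset (𝕜 := ℝ) hx'))
  -- The endpoint `N` may still lie in the support, so the product is evaluated at `N + 1`.
  have hN : 0 ≤ N + 1 := by linarith
  have hprim : IsPrimitive φ (deriv φ) := IsPrimitive.of_hasDerivAt
    (fun x _ => ((hφ.differentiable (by simp)) x).hasDerivAt)
    (hφ.continuous_deriv (by simp)).continuousOn
  have hm := (h.mul hprim).eq_integral (N + 1) hN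
  have i1 : IntervalIntegrable (fun x => f x * φ x) volume 0 (N + 1) :=
    (h.intervalIntegrable _ hN).mul_continuousOn hφ.continuous.continuousOn
  have i2 : IntervalIntegrable (fun x => F x * deriv φ x) volume 0 (N + 1) :=
    ((hprim.intervalIntegrable _ hN)).continuousOn_mul
      (h.continuousOn.mono (by rw [uIcc_of_le hN]; exact Icc_subset_Ici_self))
  rw [intervalIntegral.integral_add i1 i2, hφ0 (N + 1) (fun hx => by linarith [hx.2]),
    hφ0 0 (fun hx => by linarith [hx.1])] at hm
  rw [integral_lebPos_eq_intervalIntegral hN fun x _ hx => by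
      rw [hφ1 x fun h' => by linarith [h'.2], mul_zero],
    integral_lebPos_eq_intervalIntegral hN fun x _ hx => by
      rw [hφ0 x fun h' => by linarith [h'.2], mul_zero]]
  linarith

theorem IsPrimitive.hasDistribDeriv {F f : ℝ → ℝ} (h : IsPrimitive F f) :
    HasDistribDeriv F f where
  locInt := (h.continuousOn.mono Ioi_subset_Ici_self).locallyIntegrableOn measurableSet_Ioi
  locInt_deriv := h.locallyIntegrableOn
  integral_eq _ hφ hc hs := h.integral_mul_deriv hφ hc hs

theorem LocallyIntegrableOn_congr_lebPos {f g : ℝ → ℝ} (h : LocallyIntegrableOn f (Ioi 0))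
    (hfg : f =ᵐ[lebPos] g) : LocallyIntegrableOn g (Ioi 0) := by
  intro x hx
  obtain ⟨s, hs, hi⟩ := h x hx
  refine ⟨s ∩ Ioi 0, inter_mem hs self_mem_nhdsWithin, ?_⟩
  exact (hi.mono_set inter_subset_left).congr
    (ae_restrict_of_ae_restrict_of_subset inter_subset_right hfg)

theorem HasDistribDeriv.congr {F G f g : ℝ → ℝ} (h : HasDistribDeriv F f)
    (hF : F =ᵐ[lebPos] G) (hf : f =ᵐ[lebPos] g) : HasDistribDeriv G g where
  locInt := LocallyIntegrableOn_congr_lebPos h.locInt hF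
  locInt_deriv := LocallyIntegrableOn_congr_lebPos h.locInt_deriv hf
  integral_eq φ hφ hc hs := by
    have h1 : ∫ x, G x * deriv φ x ∂lebPos = ∫ x, F x * deriv φ x ∂lebPos :=
      integral_congr_ae (hF.mono fun x hx => by simp only [hx])
    have h2 : ∫ x, g x * φ x ∂lebPos = ∫ x, f x * φ x ∂lebPos :=
      integral_congr_ae (hf.mono fun x hx => by simp only [hx])
    rw [h1, h2]
    exact h.integral_eq φ hφ hc hs

theorem integrable_mul_of_tsupport {F φ : ℝ → ℝ} (hF : LocallyIntegrableOn F (Ioi 0))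
    (hφ : Continuous φ) (hc : HasCompactSupport φ) (hs : tsupport φ ⊆ Ioi 0) :
    Integrable (fun x => F x * φ x) lebPos := by
  have h1 : IntegrableOn F (tsupport φ) := hF.integrableOn_compact_subset hs hc.isCompact
  have h2 : IntegrableOn (fun x => F x * φ x) (tsupport φ) :=
    h1.mul_continuousOn hφ.continuousOn hc.isCompact
  have h3 : Integrable (fun x => F x * φ x) volume := by
    refine (integrableOn_iff_integrable_of_support_subset ?_).1 h2
    intro x hx
    exact subset_tsupport _ (right_ne_zero_of_mul hx)
  exact h3.restrict

/-- An antiderivative of a test function of mean zero is again a test function. -/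
theorem exists_testFunction_deriv_eq {φ : ℝ → ℝ} (hφ : ContDiff ℝ ∞ φ) (hc : HasCompactSupport φ)
    (hs : tsupport φ ⊆ Ioi 0) (h0 : ∫ x, φ x ∂lebPos = 0) :
    ∃ ψ : ℝ → ℝ, ContDiff ℝ ∞ ψ ∧ HasCompactSupport ψ ∧ tsupport ψ ⊆ Ioi 0 ∧ deriv ψ = φ := by
  obtain ⟨α, N, hα, hαN, hsub⟩ := exists_tsupport_subset_Icc hc hs
  have hφ0 : ∀ x, x ∉ Icc α N → φ x = 0 := fun x hx => image_eq_zero_of_notMem_tsupport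
    fun hx' => hx (hsub hx')
  have hder : ∀ x, HasDerivAt (fun x => ∫ t in (0 : ℝ)..x, φ t) (φ x) x := fun x =>
    intervalIntegral.integral_hasDerivAt_right (hφ.continuous.intervalIntegrable _ _)
      (hφ.continuous.stronglyMeasurableAtFilter _ _) hφ.continuous.continuousAt
  have hd : deriv (fun x => ∫ t in (0 : ℝ)..x, φ t) = φ := funext fun x => (hder x).deriv
  have hzero : ∀ x, x ∉ Icc α N → ∫ t in (0 : ℝ)..x, φ t = 0 := by
    intro x hx
    rcases lt_or_ge x α with h | h
    · refine intervalIntegral.integral_zero_ae (Eventually.of_forall fun t ht => hφ0 t fun h' => ?_)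
      have := (uIoc_subset_uIcc ht)
      rw [mem_uIcc] at this
      rcases this with h1 | h1 <;> linarith [h'.1, h1.2]
    · have hN : N < x := by
        by_contra hn
        exact hx ⟨h, not_lt.1 hn⟩
      rw [← integral_lebPos_eq_intervalIntegral (by linarith) fun y _ hy =>
        hφ0 y fun h' => by linarith [h'.2], h0]
  have hsub' : tsupport (fun x => ∫ t in (0 : ℝ)..x, φ t) ⊆ Icc α N :=
    closure_minimal (fun x hx => by_contra fun h => hx (hzero x h)) isClosed_Icc
  refine ⟨_, ?_, ?_, hsub'.trans fun x hx => lt_of_lt_of_le hα hx.1, hd⟩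
  · rw [contDiff_infty_iff_deriv]
    exact ⟨fun x => (hder x).differentiableAt, by rw [hd]; exact hφ⟩
  · exact HasCompactSupport.of_support_subset_isCompact isCompact_Icc
      ((subset_tsupport _).trans hsub')

theorem exists_testFunction_integral_eq_one :
    ∃ η : ℝ → ℝ, ContDiff ℝ ∞ η ∧ HasCompactSupport η ∧ tsupport η ⊆ Ioi 0 ∧
      ∫ x, η x ∂lebPos = 1 := by
  let φ : ContDiffBump (2 : ℝ) := ⟨1 / 2, 1, by norm_num, by norm_num⟩
  have hs : tsupport (φ.normed volume) ⊆ Ioi 0 := by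
    rw [φ.tsupport_normed_eq]
    intro x hx
    have : |x - 2| ≤ 1 := by simpa [Real.dist_eq] using hx
    have := (abs_le.1 this).1
    show (0:ℝ) < x
    linarith
  refine ⟨φ.normed volume, φ.contDiff_normed, φ.hasCompactSupport_normed, hs, ?_⟩
  rw [lebPos, setIntegral_eq_integral_of_forall_compl_eq_zero]
  · exact φ.integral_normed
  · intro x hx
    exact image_eq_zero_of_notMem_tsupport fun h => hx (hs h)

/-- **du Bois-Reymond lemma** on `(0, ∞)`. -/
theorem exists_ae_eq_const_of_integral_mul_deriv_eq_zero {H : ℝ → ℝ}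
    (hH : LocallyIntegrableOn H (Ioi 0))
    (h : ∀ φ : ℝ → ℝ, ContDiff ℝ ∞ φ → HasCompactSupport φ → tsupport φ ⊆ Ioi 0 →
      ∫ x, H x * deriv φ x ∂lebPos = 0) : ∃ c : ℝ, H =ᵐ[lebPos] fun _ => c := by
  obtain ⟨η, hη, hηc, hηs, hη1⟩ := exists_testFunction_integral_eq_one
  have hint : ∀ φ : ℝ → ℝ, ContDiff ℝ ∞ φ → HasCompactSupport φ → Integrable φ lebPos :=
    fun φ hφ hφc => (hφ.continuous.integrable_of_hasCompactSupport hφc).restrict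
  set c := ∫ x, H x * η x ∂lebPos with hcdef
  refine ⟨c, ?_⟩
  have hHc : LocallyIntegrableOn (fun x => H x - c) (Ioi 0) :=
    hH.sub (locallyIntegrableOn_const c)
  have := isOpen_Ioi.ae_eq_zero_of_integral_contDiff_smul_eq_zero hHc fun φ hφ hφc hφs => by
    -- `φ - I η` has mean zero, hence is the derivative of a test function. Testing `H` against it
    -- gives `∫ φ (H - c) = 0`.
    set I := ∫ x, φ x ∂lebPos with hI
    have hts : tsupport (fun x => φ x - I * η x) ⊆ Ioi 0 := by
      refine (tsupport_sub φ (fun x => I * η x)).trans (union_subset hφs ?_)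
      exact (tsupport_mul_subset_right (f := fun _ => I)).trans hηs
    have hcs : HasCompactSupport (fun x => φ x - I * η x) :=
      hφc.sub (hηc.mul_left (f := fun _ => I))
    have hcd : ContDiff ℝ ∞ (fun x => φ x - I * η x) := hφ.sub (contDiff_const.mul hη)
    obtain ⟨ψ, hψ, hψc, hψs, hψd⟩ := exists_testFunction_deriv_eq hcd hcs hts (by
      rw [integral_sub (hint φ hφ hφc) ((hint η hη hηc).const_mul I), integral_const_mul, hη1,
        mul_one, sub_self])
    have h0 := h ψ hψ hψc hψs
    have hHφ := integrable_mul_of_tsupport hH hφ.continuous hφc hφs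
    have hHη := integrable_mul_of_tsupport hH hη.continuous hηc hηs
    have e1 : ∫ x, H x * deriv ψ x ∂lebPos = (∫ x, H x * φ x ∂lebPos) - I * c := by
      rw [hcdef, ← integral_const_mul, ← integral_sub hHφ (hHη.const_mul I), hψd]
      exact integral_congr_ae (Eventually.of_forall fun x => by simp only; ring)
    have e2 : ∫ x, φ x • (H x - c) ∂lebPos = (∫ x, H x * φ x ∂lebPos) - I * c := by
      rw [hI, ← integral_mul_const, ← integral_sub hHφ ((hint φ hφ hφc).mul_const c)]
      exact integral_congr_ae (Eventually.of_forall fun x => by simp only [smul_eq_mul]; ring)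
    have e3 : ∫ x, φ x • (H x - c) ∂lebPos = ∫ x, φ x • (H x - c) := by
      rw [lebPos, setIntegral_eq_integral_of_forall_compl_eq_zero]
      intro x hx
      rw [image_eq_zero_of_notMem_tsupport fun h => hx (hφs h), zero_smul]
    rw [← e3, e2, ← e1, h0]
  rw [lebPos, EventuallyEq, ae_restrict_iff' measurableSet_Ioi]
  filter_upwards [this] with x hx hx0 using sub_eq_zero.1 (hx hx0)

/-- A distribution whose derivative is integrable near `0` is a primitive. -/
theorem HasDistribDeriv.exists_isPrimitive {F f : ℝ → ℝ} (h : HasDistribDeriv F f)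
    (hf : ∀ x, 0 ≤ x → IntervalIntegrable f volume 0 x) :
    ∃ G : ℝ → ℝ, IsPrimitive G f ∧ F =ᵐ[lebPos] G := by
  have hp : IsPrimitive _ f := IsPrimitive.of_integral (c := 0) hf
  have hd := hp.hasDistribDeriv
  obtain ⟨c, hc⟩ := exists_ae_eq_const_of_integral_mul_deriv_eq_zero (h.locInt.sub hd.locInt)
    fun φ hφ hφc hφs => by
      have h1 := h.integral_eq φ hφ hφc hφs
      have h2 := hd.integral_eq φ hφ hφc hφs
      have hφ' : Continuous (deriv φ) := hφ.continuous_deriv (by simp)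
      have hts : tsupport (deriv φ) ⊆ Ioi 0 := (tsupport_deriv_subset (𝕜 := ℝ)).trans hφs
      have hcs : HasCompactSupport (deriv φ) := hφc.deriv
      simp only [Pi.sub_apply, sub_mul]
      rw [integral_sub (integrable_mul_of_tsupport h.locInt hφ' hcs hts)
        (integrable_mul_of_tsupport hd.locInt hφ' hcs hts), h1, h2, sub_self]
  refine ⟨fun x => c + ∫ t in (0 : ℝ)..x, f t, IsPrimitive.of_integral hf, ?_⟩
  filter_upwards [hc] with x hx
  simp only [Pi.sub_apply] at hx
  linarith

end

section

/-! ### The Hille–Yosida theorem -/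

section Exponential

variable {𝔸 : Type*} [NormedRing 𝔸] [NormedAlgebra ℝ 𝔸] [CompleteSpace 𝔸]

theorem exp_add_smul (A : 𝔸) (s t : ℝ) :
    NormedSpace.exp ((s + t) • A) = NormedSpace.exp (s • A) * NormedSpace.exp (t • A) := by
  let _ : NormedAlgebra ℚ 𝔸 := NormedAlgebra.restrictScalars ℚ ℝ 𝔸
  rw [add_smul]
  exact NormedSpace.exp_add_of_commute (((Commute.refl A).smul_left s).smul_right t)

theorem exp_sub_smul_one (A : 𝔸) (s : ℝ) :
    NormedSpace.exp (A - s • (1 : 𝔸)) = Real.exp (-s) • NormedSpace.exp A := by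
  let _ : NormedAlgebra ℚ 𝔸 := NormedAlgebra.restrictScalars ℚ ℝ 𝔸
  have hc : Commute ((-s) • (1 : 𝔸)) A := (Commute.one_left A).smul_left _
  have h1 : NormedSpace.exp ((-s) • (1 : 𝔸)) = Real.exp (-s) • (1 : 𝔸) := by
    have := NormedSpace.algebraMap_exp_comm (𝕂 := ℝ) (𝔸 := 𝔸) (-s)
    rw [Algebra.algebraMap_eq_smul_one, Algebra.algebraMap_eq_smul_one] at this
    rw [← this, Real.exp_eq_exp_ℝ]
  rw [show A - s • (1 : 𝔸) = (-s) • (1 : 𝔸) + A by rw [neg_smul]; abel,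
    NormedSpace.exp_add_of_commute hc, h1, smul_mul_assoc, one_mul]

/-- Only `‖1‖ ≤ 1` is required, so that operators on a trivial space, where `‖1‖ = 0`, are included.
-/
theorem norm_exp_le_of_norm_one_le (h1 : ‖(1 : 𝔸)‖ ≤ 1) (A : 𝔸) :
    ‖NormedSpace.exp A‖ ≤ Real.exp ‖A‖ := by
  have hs := NormedSpace.exp_series_hasSum_exp' (𝕂 := ℝ) A
  have hr := NormedSpace.exp_series_hasSum_exp' (𝕂 := ℝ) ‖A‖
  rw [← Real.exp_eq_exp_ℝ] at hr
  have hb : ∀ n : ℕ, ‖((n.factorial : ℝ)⁻¹) • A ^ n‖ ≤ ((n.factorial : ℝ)⁻¹) • ‖A‖ ^ n := by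
    intro n
    rw [norm_smul, Real.norm_of_nonneg (by positivity), smul_eq_mul]
    gcongr
    rcases Nat.eq_zero_or_pos n with rfl | hn
    · simpa using h1
    · exact norm_pow_le' A hn
  rw [← hs.tsum_eq, ← hr.tsum_eq]
  exact tsum_of_norm_bounded hr.summable.hasSum hb

end Exponential

variable {E : Type*} [NormedAddCommGroup E] [NormedSpace ℝ E]

/-- `J ν` is the resolvent at `ν > ν₀` of the densely defined operator with graph `G`, with the
bound of a quasi-contractive generator. -/
structure IsResolvent (G : E → E → Prop) (J : ℝ → E →L[ℝ] E) (ν₀ κ : ℝ) : Prop where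
  nonneg : 0 ≤ κ
  lt : 2 * κ < ν₀
  graph_iff : ∀ ν, ν₀ < ν → ∀ u v, G u v ↔ u = J ν (ν • u - v)
  norm_le : ∀ ν, ν₀ < ν → ‖J ν‖ ≤ (ν - κ)⁻¹
  dense : Dense {u | ∃ v, G u v}

/-- The Yosida approximation of the operator with resolvent `J`. -/
def yosida (J : ℝ → E →L[ℝ] E) (ν : ℝ) : E →L[ℝ] E := ν • (ν • J ν - 1)

/-- The group generated by the Yosida approximation. -/
def yosidaExp (J : ℝ → E →L[ℝ] E) (ν t : ℝ) : E →L[ℝ] E := NormedSpace.exp (t • yosida J ν)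

namespace IsResolvent

variable {G : E → E → Prop} {J : ℝ → E →L[ℝ] E} {ν₀ κ : ℝ}

theorem pos (h : IsResolvent G J ν₀ κ) {ν : ℝ} (hν : ν₀ < ν) : 0 < ν := by
  linarith [h.nonneg, h.lt]

theorem graph_apply (h : IsResolvent G J ν₀ κ) {ν : ℝ} (hν : ν₀ < ν) (f : E) :
    G (J ν f) (ν • J ν f - f) := by
  rw [h.graph_iff ν hν, sub_sub_cancel]

/-- The resolvent identity; exchanging `ν` and `μ` in it yields commutation. -/
theorem apply_sub (h : IsResolvent G J ν₀ κ) {ν μ : ℝ} (hν : ν₀ < ν) (hμ : ν₀ < μ) (f : E) :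
    J μ f - J ν f = (ν - μ) • J ν (J μ f) := by
  have := (h.graph_iff ν hν _ _).1 (h.graph_apply hμ f)
  simp only [map_sub, map_smul] at this
  conv_lhs => rw [this]
  rw [sub_smul]
  abel

theorem commute (h : IsResolvent G J ν₀ κ) {ν μ : ℝ} (hν : ν₀ < ν) (hμ : ν₀ < μ) :
    Commute (J ν) (J μ) := by
  rcases eq_or_ne ν μ with rfl | hne
  · exact Commute.refl _
  · ext f
    have h1 := h.apply_sub hν hμ f
    have h2 := h.apply_sub hμ hν f
    have h3 : (ν - μ) • J ν (J μ f) = (ν - μ) • J μ (J ν f) := by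
      rw [← h1, ← neg_sub, h2, ← neg_smul, neg_sub]
    simpa using smul_right_injective E (sub_ne_zero.2 hne) h3

theorem norm_smul_le (h : IsResolvent G J ν₀ κ) {ν : ℝ} (hν : ν₀ < ν) : ‖ν • J ν‖ ≤ 2 := by
  have h0 := h.pos hν
  have h1 := h.lt
  have h2 := h.nonneg
  have : 0 < ν - κ := by linarith
  rw [norm_smul, Real.norm_of_nonneg h0.le]
  calc ν * ‖J ν‖ ≤ ν * (ν - κ)⁻¹ := by gcongr; exact h.norm_le ν hν
    _ ≤ 2 := by
      rw [← div_eq_mul_inv, div_le_iff₀ this]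
      linarith

theorem tendsto_norm_zero (h : IsResolvent G J ν₀ κ) : Tendsto (fun ν => ‖J ν‖) atTop (𝓝 0) := by
  have h1 : Tendsto (fun ν : ℝ => (ν - κ)⁻¹) atTop (𝓝 0) :=
    tendsto_inv_atTop_zero.comp (tendsto_atTop_add_const_right _ _ tendsto_id)
  refine tendsto_of_tendsto_of_tendsto_of_le_of_le' tendsto_const_nhds h1
    (Eventually.of_forall fun ν => norm_nonneg _) ?_
  filter_upwards [eventually_gt_atTop ν₀] with ν hν using h.norm_le ν hν

/-- On the domain, `ν J ν u - u` is of order `‖J ν‖`, which is why `ν J ν` tends strongly to the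
identity. -/
theorem smul_apply_sub (h : IsResolvent G J ν₀ κ) {ν : ℝ} (hν : ν₀ < ν) {u v : E} (huv : G u v) :
    ν • J ν u - u = J ν v := by
  have := (h.graph_iff ν hν u v).1 huv
  rw [map_sub, map_smul] at this
  nth_rewrite 2 [this]
  abel

/-- Uniformly bounded operators converging on a dense set converge everywhere. -/
theorem _root_.Dense.tendsto_clm {F : Type*} [NormedAddCommGroup F] [NormedSpace ℝ F]
    {ι : Type*} {l : Filter ι} {T : ι → E →L[ℝ] F} {S : E →L[ℝ] F} {C : ℝ}
    {D : Set E} (hD : Dense D) (hC : ∀ᶠ i in l, ‖T i‖ ≤ C)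
    (h : ∀ u ∈ D, Tendsto (fun i => T i u) l (𝓝 (S u))) (f : E) :
    Tendsto (fun i => T i f) l (𝓝 (S f)) := by
  rw [Metric.tendsto_nhds]
  intro ε hε
  set K := max C 0 + ‖S‖ + 1 with hK
  have hKpos : 0 < K := by positivity
  obtain ⟨u, hu, hfu⟩ := hD.exists_dist_lt f (show 0 < ε / (2 * K) by positivity)
  filter_upwards [hC, (Metric.tendsto_nhds.1 (h u hu)) (ε / 2) (by positivity)] with i hi hiu
  rw [dist_eq_norm] at *
  have e : T i f - S f = (T i (f - u) - S (f - u)) + (T i u - S u) := by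
    simp only [map_sub]; abel
  have h1 : ‖T i (f - u) - S (f - u)‖ ≤ K * ‖f - u‖ := by
    calc _ ≤ ‖T i (f - u)‖ + ‖S (f - u)‖ := norm_sub_le _ _
      _ ≤ ‖T i‖ * ‖f - u‖ + ‖S‖ * ‖f - u‖ := add_le_add ((T i).le_opNorm _) (S.le_opNorm _)
      _ ≤ max C 0 * ‖f - u‖ + ‖S‖ * ‖f - u‖ := by
        gcongr
        exact hi.trans (le_max_left _ _)
      _ ≤ K * ‖f - u‖ := by rw [hK]; nlinarith [norm_nonneg (f - u)]
  have h2 : K * ‖f - u‖ < ε / 2 := by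
    calc K * ‖f - u‖ < K * (ε / (2 * K)) := by gcongr
      _ = ε / 2 := by field_simp
  rw [e]
  linarith [norm_add_le (T i (f - u) - S (f - u)) (T i u - S u)]

theorem tendsto_smul_apply (h : IsResolvent G J ν₀ κ) (f : E) :
    Tendsto (fun ν : ℝ => ν • J ν f) atTop (𝓝 f) := by
  refine h.dense.tendsto_clm (T := fun ν => ν • J ν) (S := 1) (C := 2) ?_ ?_ f
  · filter_upwards [eventually_gt_atTop ν₀] with ν hν using h.norm_smul_le hν
  · rintro u ⟨v, huv⟩
    rw [tendsto_iff_norm_sub_tendsto_zero]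
    have h0 : Tendsto (fun ν => ‖J ν‖ * ‖v‖) atTop (𝓝 0) := by
      simpa using h.tendsto_norm_zero.mul_const ‖v‖
    refine tendsto_of_tendsto_of_tendsto_of_le_of_le' tendsto_const_nhds h0
      (Eventually.of_forall fun ν => norm_nonneg _) ?_
    filter_upwards [eventually_gt_atTop ν₀] with ν hν
    have : (ν • J ν) u - (1 : E →L[ℝ] E) u = J ν v := h.smul_apply_sub hν huv
    rw [this]
    exact (J ν).le_opNorm v

theorem yosida_apply (h : IsResolvent G J ν₀ κ) {ν : ℝ} (hν : ν₀ < ν) {u v : E} (huv : G u v) :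
    yosida J ν u = ν • J ν v := by
  rw [← h.smul_apply_sub hν huv]
  rfl

theorem tendsto_yosida (h : IsResolvent G J ν₀ κ) {u v : E} (huv : G u v) :
    Tendsto (fun ν => yosida J ν u) atTop (𝓝 v) := by
  refine (h.tendsto_smul_apply v).congr' ?_
  filter_upwards [eventually_gt_atTop ν₀] with ν hν using (h.yosida_apply hν huv).symm

theorem commute_yosida (h : IsResolvent G J ν₀ κ) {ν μ : ℝ} (hν : ν₀ < ν) (hμ : ν₀ < μ) :
    Commute (J ν) (yosida J μ) :=
  (((h.commute hν hμ).smul_right μ).sub_right (Commute.one_right _)).smul_right μ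

theorem commute_yosida_yosida (h : IsResolvent G J ν₀ κ) {ν μ : ℝ} (hν : ν₀ < ν) (hμ : ν₀ < μ) :
    Commute (yosida J ν) (yosida J μ) :=
  (((h.commute_yosida hν hμ).smul_left ν).sub_left (Commute.one_left _)).smul_left ν

@[simp] theorem yosidaExp_zero (ν : ℝ) : yosidaExp J ν 0 = 1 := by
  simp [yosidaExp]

theorem commute_yosidaExp_yosida (h : IsResolvent G J ν₀ κ) {ν μ : ℝ} (hν : ν₀ < ν)
    (hμ : ν₀ < μ) (t : ℝ) : Commute (yosida J μ) (yosidaExp J ν t) :=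
  ((h.commute_yosida_yosida hμ hν).smul_right t).exp_right

theorem commute_apply_yosidaExp (h : IsResolvent G J ν₀ κ) {ν μ : ℝ} (hν : ν₀ < ν)
    (hμ : ν₀ < μ) (t : ℝ) : Commute (J μ) (yosidaExp J ν t) :=
  ((h.commute_yosida hμ hν).smul_right t).exp_right

variable [CompleteSpace E]

/-- Splitting off the scalar part leaves a power series in `J ν` with nonnegative coefficients for
`t ≥ 0`. Both the growth bound and the invariance of cones come from this form. -/
theorem yosidaExp_eq (ν t : ℝ) :
    yosidaExp J ν t = Real.exp (-(t * ν)) • NormedSpace.exp ((t * ν * ν) • J ν) := by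
  rw [yosidaExp, ← exp_sub_smul_one]
  congr 1
  simp only [yosida, smul_sub, smul_smul]
  ring_nf

theorem norm_yosidaExp_le (h : IsResolvent G J ν₀ κ) {ν t : ℝ} (hν : ν₀ < ν) (ht : 0 ≤ t) :
    ‖yosidaExp J ν t‖ ≤ Real.exp (2 * κ * t) := by
  have h0 := h.pos hν
  have h1 := h.lt
  have h2 := h.nonneg
  have h3 : 0 < ν - κ := by linarith
  rw [yosidaExp_eq, norm_smul, Real.norm_of_nonneg (Real.exp_pos _).le]
  calc _ ≤ Real.exp (-(t * ν)) * Real.exp ‖(t * ν * ν) • J ν‖ := by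
        gcongr
        exact norm_exp_le_of_norm_one_le ContinuousLinearMap.norm_id_le _
    _ ≤ Real.exp (2 * κ * t) := by
        rw [← Real.exp_add, Real.exp_le_exp, norm_smul, Real.norm_of_nonneg (by positivity)]
        have h4 : t * ν * ν * ‖J ν‖ ≤ t * ν * ν * (ν - κ)⁻¹ := by
          gcongr
          exact h.norm_le ν hν
        -- This is where `ν ≥ 2κ` is needed: the exponent `-tν + tν² / (ν - κ)` is then at most
        -- `2κt`.
        have h5 : ν * ν * (ν - κ)⁻¹ ≤ ν + 2 * κ := by
          rw [← div_eq_mul_inv, div_le_iff₀ h3]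
          nlinarith
        nlinarith

theorem hasDerivAt_yosidaExp (ν t : ℝ) (f : E) :
    HasDerivAt (fun t => yosidaExp J ν t f) (yosidaExp J ν t (yosida J ν f)) t := by
  have := (hasDerivAt_exp_smul_const (𝕂 := ℝ) (yosida J ν) t).clm_apply (hasDerivAt_const t f)
  simpa [yosidaExp] using this

theorem yosidaExp_add (ν s t : ℝ) : yosidaExp J ν (s + t) = yosidaExp J ν s * yosidaExp J ν t := by
  unfold yosidaExp
  exact exp_add_smul (𝔸 := E →L[ℝ] E) _ _ _

theorem norm_yosidaExp_sub_le (h : IsResolvent G J ν₀ κ) {ν t : ℝ} (hν : ν₀ < ν) (ht : 0 ≤ t)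
    (f : E) : ‖yosidaExp J ν t f - f‖ ≤ Real.exp (2 * κ * t) * ‖yosida J ν f‖ * t := by
  have := norm_image_sub_le_of_norm_deriv_le_segment' (f := fun t => yosidaExp J ν t f)
    (a := 0) (b := t) (C := Real.exp (2 * κ * t) * ‖yosida J ν f‖)
    (fun s _ => (hasDerivAt_yosidaExp ν s f).hasDerivWithinAt) (fun s hs => ?_) t ⟨ht, le_rfl⟩
  · simpa using this
  · refine (ContinuousLinearMap.le_opNorm _ _).trans ?_
    gcongr
    refine (h.norm_yosidaExp_le hν hs.1).trans (Real.exp_le_exp.2 ?_)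
    have := h.nonneg
    gcongr
    exact hs.2.le

/-- The product `exp((t - s) A_ν) exp(s A_μ) f` interpolates between the two groups. By commutation
its derivative in `s` is the same product applied to `A_μ f - A_ν f`. -/
theorem norm_yosidaExp_sub_yosidaExp_le (h : IsResolvent G J ν₀ κ) {ν μ t : ℝ} (hν : ν₀ < ν)
    (hμ : ν₀ < μ) (ht : 0 ≤ t) (f : E) :
    ‖yosidaExp J μ t f - yosidaExp J ν t f‖ ≤
      Real.exp (2 * κ * t) * ‖yosida J μ f - yosida J ν f‖ * t := by
  have hd : ∀ s, HasDerivAt (fun s => yosidaExp J ν (t - s) (yosidaExp J μ s f))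
      (yosidaExp J ν (t - s) (yosidaExp J μ s (yosida J μ f - yosida J ν f))) s := by
    intro s
    have h1 : HasDerivAt (fun s => yosidaExp J ν (t - s))
        (-(yosidaExp J ν (t - s) * yosida J ν)) s := by
      have := (hasDerivAt_exp_smul_const (𝕂 := ℝ) (yosida J ν) (t - s)).scomp s
        ((hasDerivAt_id s).const_sub t)
      simpa [yosidaExp, Function.comp_def] using this
    have h2 := h1.clm_apply (hasDerivAt_yosidaExp (J := J) μ s f)
    refine h2.congr_deriv ?_
    have hc : yosida J ν (yosidaExp J μ s f) = yosidaExp J μ s (yosida J ν f) :=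
      congrArg (fun T : E →L[ℝ] E => T f) (h.commute_yosidaExp_yosida hμ hν s).eq
    show -(yosidaExp J ν (t - s) (yosida J ν (yosidaExp J μ s f))) + _ = _
    rw [hc, map_sub, map_sub]
    abel
  have := norm_image_sub_le_of_norm_deriv_le_segment'
    (f := fun s => yosidaExp J ν (t - s) (yosidaExp J μ s f))
    (a := 0) (b := t) (C := Real.exp (2 * κ * t) * ‖yosida J μ f - yosida J ν f‖)
    (fun s _ => (hd s).hasDerivWithinAt) (fun s hs => ?_) t ⟨ht, le_rfl⟩
  · simpa using this
  · refine (ContinuousLinearMap.le_opNorm _ _).trans ?_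
    refine (mul_le_mul (h.norm_yosidaExp_le hν (sub_nonneg.2 hs.2.le))
      (ContinuousLinearMap.le_opNorm _ _) (norm_nonneg _) (Real.exp_pos _).le).trans ?_
    rw [← mul_assoc]
    gcongr
    calc Real.exp (2 * κ * (t - s)) * ‖yosidaExp J μ s‖
        ≤ Real.exp (2 * κ * (t - s)) * Real.exp (2 * κ * s) := by
          gcongr
          exact h.norm_yosidaExp_le hμ hs.1
      _ = Real.exp (2 * κ * t) := by rw [← Real.exp_add]; ring_nf

end IsResolvent

end

/-! ### The limit semigroup and its generator -/

section

variable {E : Type*} [NormedAddCommGroup E] [NormedSpace ℝ E]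

namespace IsResolvent

variable {G : E → E → Prop} {J : ℝ → E →L[ℝ] E} {ν₀ κ : ℝ} {S : ℝ≥0 → E →L[ℝ] E}

theorem limit_commute (h : IsResolvent G J ν₀ κ)
    (hS : ∀ (t : ℝ≥0) f, Tendsto (fun ν => yosidaExp J ν t f) atTop (𝓝 (S t f))) {μ : ℝ}
    (hμ : ν₀ < μ) (t : ℝ≥0) (f : E) : S t (J μ f) = J μ (S t f) := by
  refine tendsto_nhds_unique (hS t (J μ f)) ?_
  refine (((J μ).continuous.tendsto _).comp (hS t f)).congr' ?_
  filter_upwards [eventually_gt_atTop ν₀] with ν hν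
  exact congrArg (fun T : E →L[ℝ] E => T f) (h.commute_apply_yosidaExp hν hμ t).eq

theorem limit_zero (hS : ∀ (t : ℝ≥0) f, Tendsto (fun ν => yosidaExp J ν t f) atTop (𝓝 (S t f))) :
    S 0 = 1 := by
  ext f
  refine tendsto_nhds_unique (hS 0 f) ?_
  simp

theorem graph_limit (h : IsResolvent G J ν₀ κ)
    (hS : ∀ (t : ℝ≥0) f, Tendsto (fun ν => yosidaExp J ν t f) atTop (𝓝 (S t f)))
    (t : ℝ≥0) {u v : E} (huv : G u v) : G (S t u) (S t v) := by
  have hν : ν₀ < ν₀ + 1 := by linarith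
  rw [h.graph_iff _ hν] at huv ⊢
  nth_rewrite 1 [huv]
  rw [h.limit_commute hS hν, map_sub, map_smul]

variable [CompleteSpace E]

/-- On the domain the Yosida approximations converge, so the difference estimate gives the Cauchy
property. The uniform bound on the groups extends it to all of `E` by density. -/
theorem exists_tendsto_yosidaExp (h : IsResolvent G J ν₀ κ) {t : ℝ} (ht : 0 ≤ t) (f : E) :
    ∃ g, Tendsto (fun ν => yosidaExp J ν t f) atTop (𝓝 g) := by
  rw [← cauchy_map_iff_exists_tendsto, Metric.cauchy_iff]
  refine ⟨map_neBot, fun ε hε => ?_⟩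
  set M := Real.exp (2 * κ * t) with hM
  have hMpos : 0 < M := Real.exp_pos _
  obtain ⟨u, ⟨v, huv⟩, hfu⟩ := h.dense.exists_dist_lt f (show 0 < ε / (4 * M) by positivity)
  have hev := (Metric.tendsto_nhds.1 (h.tendsto_yosida huv)) (ε / (4 * M * (t + 1)))
    (by positivity)
  refine ⟨_, image_mem_map (inter_mem hev (Ioi_mem_atTop ν₀)), ?_⟩
  rintro _ ⟨ν, ⟨hν1, hν2⟩, rfl⟩ _ ⟨μ, ⟨hμ1, hμ2⟩, rfl⟩
  rw [dist_comm, dist_eq_norm]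
  have hν1' : ‖yosida J ν u - v‖ < ε / (4 * M * (t + 1)) := by rw [← dist_eq_norm]; exact hν1
  have hμ1' : ‖yosida J μ u - v‖ < ε / (4 * M * (t + 1)) := by rw [← dist_eq_norm]; exact hμ1
  have hd : ‖yosida J μ u - yosida J ν u‖ ≤ ε / (2 * M * (t + 1)) := by
    have : yosida J μ u - yosida J ν u = (yosida J μ u - v) - (yosida J ν u - v) := by abel
    rw [this]
    refine (norm_sub_le _ _).trans ((add_le_add hμ1'.le hν1'.le).trans (le_of_eq ?_))
    field_simp
    norm_num
  have h1 := h.norm_yosidaExp_sub_yosidaExp_le hν2 hμ2 ht u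
  have h2 : ‖yosidaExp J μ t u - yosidaExp J ν t u‖ ≤ ε / 2 := by
    refine h1.trans ?_
    calc M * ‖yosida J μ u - yosida J ν u‖ * t ≤ M * (ε / (2 * M * (t + 1))) * (t + 1) := by
          gcongr
          linarith
      _ = ε / 2 := by field_simp
  have hb : ∀ σ, ν₀ < σ → ‖yosidaExp J σ t (f - u)‖ < ε / 4 := by
    intro σ hσ
    calc ‖yosidaExp J σ t (f - u)‖ ≤ ‖yosidaExp J σ t‖ * ‖f - u‖ := ContinuousLinearMap.le_opNorm _ _
      _ ≤ M * ‖f - u‖ := by gcongr; exact h.norm_yosidaExp_le hσ ht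
      _ < M * (ε / (4 * M)) := by gcongr; rwa [← dist_eq_norm]
      _ = ε / 4 := by field_simp
  have e : yosidaExp J μ t f - yosidaExp J ν t f = yosidaExp J μ t (f - u) +
      (yosidaExp J μ t u - yosidaExp J ν t u) - yosidaExp J ν t (f - u) := by
    simp only [map_sub]; abel
  rw [e]
  have := norm_sub_le (yosidaExp J μ t (f - u) + (yosidaExp J μ t u - yosidaExp J ν t u))
    (yosidaExp J ν t (f - u))
  have := norm_add_le (yosidaExp J μ t (f - u)) (yosidaExp J μ t u - yosidaExp J ν t u)
  linarith [hb ν hν2, hb μ hμ2]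

theorem exists_limit (h : IsResolvent G J ν₀ κ) : ∃ S : ℝ≥0 → E →L[ℝ] E,
    ∀ (t : ℝ≥0) f, Tendsto (fun ν => yosidaExp J ν t f) atTop (𝓝 (S t f)) := by
  choose F hF using fun (t : ℝ≥0) f => h.exists_tendsto_yosidaExp t.2 f
  exact ⟨fun t => continuousLinearMapOfTendsto (fun ν => yosidaExp J ν t)
    (tendsto_pi_nhds.2 (hF t)), fun t f => hF t f⟩

theorem norm_limit_le (h : IsResolvent G J ν₀ κ)
    (hS : ∀ (t : ℝ≥0) f, Tendsto (fun ν => yosidaExp J ν t f) atTop (𝓝 (S t f))) (t : ℝ≥0) :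
    ‖S t‖ ≤ Real.exp (2 * κ * t) := by
  refine ContinuousLinearMap.opNorm_le_bound _ (Real.exp_pos _).le fun f => ?_
  refine le_of_tendsto (hS t f).norm ?_
  filter_upwards [eventually_gt_atTop ν₀] with ν hν
  refine (ContinuousLinearMap.le_opNorm _ _).trans ?_
  gcongr
  exact h.norm_yosidaExp_le hν t.2

theorem limit_add (h : IsResolvent G J ν₀ κ)
    (hS : ∀ (t : ℝ≥0) f, Tendsto (fun ν => yosidaExp J ν t f) atTop (𝓝 (S t f))) (s t : ℝ≥0) :
    S (s + t) = S s * S t := by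
  ext f
  refine tendsto_nhds_unique (hS (s + t) f) ?_
  have h1 : Tendsto (fun ν => yosidaExp J ν s (yosidaExp J ν t f - S t f)) atTop (𝓝 0) := by
    have h2 : Tendsto (fun ν => Real.exp (2 * κ * s) * ‖yosidaExp J ν t f - S t f‖) atTop (𝓝 0) := by
      have := (tendsto_iff_norm_sub_tendsto_zero.1 (hS t f)).const_mul (Real.exp (2 * κ * s))
      simpa using this
    refine squeeze_zero_norm' ?_ h2
    filter_upwards [eventually_gt_atTop ν₀] with ν hν
    refine (ContinuousLinearMap.le_opNorm _ _).trans ?_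
    gcongr
    exact h.norm_yosidaExp_le hν s.2
  have h3 := h1.add (hS s (S t f))
  rw [zero_add] at h3
  refine h3.congr fun ν => ?_
  rw [NNReal.coe_add, yosidaExp_add, map_sub]
  show _ = yosidaExp J ν s (yosidaExp J ν t f)
  abel

theorem norm_limit_sub_le (h : IsResolvent G J ν₀ κ)
    (hS : ∀ (t : ℝ≥0) f, Tendsto (fun ν => yosidaExp J ν t f) atTop (𝓝 (S t f)))
    (t : ℝ≥0) {u v : E} (huv : G u v) : ‖S t u - u‖ ≤ Real.exp (2 * κ * t) * ‖v‖ * t := by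
  refine le_of_tendsto_of_tendsto ((hS t u).sub_const u).norm
    (((h.tendsto_yosida huv).norm.const_mul _).mul_const _) ?_
  filter_upwards [eventually_gt_atTop ν₀] with ν hν using h.norm_yosidaExp_sub_le hν t.2 u

theorem continuous_limit (h : IsResolvent G J ν₀ κ)
    (hS : ∀ (t : ℝ≥0) f, Tendsto (fun ν => yosidaExp J ν t f) atTop (𝓝 (S t f))) (f : E) :
    Continuous (fun t => S t f) := by
  rw [continuous_iff_continuousAt]
  intro t₀
  have hb : ∀ t ≤ t₀ + 1, ‖S t‖ ≤ Real.exp (2 * κ * (t₀ + 1)) := fun t ht =>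
    (h.norm_limit_le hS t).trans <| Real.exp_le_exp.2 <| by
      have := h.nonneg
      gcongr
      exact_mod_cast ht
  have hnhds : Iio (t₀ + 1) ∈ 𝓝 t₀ := Iio_mem_nhds (by simp)
  refine h.dense.tendsto_clm (T := fun t => S t) (S := S t₀) (C := Real.exp (2 * κ * (t₀ + 1)))
    ?_ ?_ f
  · filter_upwards [hnhds] with t ht using hb t (le_of_lt ht)
  · rintro u ⟨v, huv⟩
    have key : ∀ s t : ℝ≥0, s ≤ t → t ≤ t₀ + 1 →
        ‖S t u - S s u‖ ≤ Real.exp (2 * κ * (t₀ + 1)) * (Real.exp (2 * κ * (t₀ + 1)) * ‖v‖ * dist t s) := by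
      intro s t hst ht
      obtain ⟨d, rfl⟩ := exists_add_of_le hst
      have hd : d ≤ t₀ + 1 := le_trans (by simp) ht
      have e : S (s + d) u - S s u = S s (S d u - u) := by
        rw [h.limit_add hS, map_sub]; rfl
      rw [e]
      refine (ContinuousLinearMap.le_opNorm _ _).trans ?_
      refine mul_le_mul (hb s (hst.trans ht)) ((h.norm_limit_sub_le hS d huv).trans ?_)
        (norm_nonneg _) (Real.exp_pos _).le
      have : dist (s + d) s = d := by simp [NNReal.dist_eq]
      rw [this]
      have := h.nonneg
      gcongr
      exact_mod_cast hd
    rw [tendsto_iff_norm_sub_tendsto_zero]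
    have h0 : Tendsto (fun t => Real.exp (2 * κ * (t₀ + 1)) *
        (Real.exp (2 * κ * (t₀ + 1)) * ‖v‖ * dist t t₀)) (𝓝 t₀) (𝓝 0) := by
      have h1 : Tendsto (fun t => dist t t₀) (𝓝 t₀) (𝓝 0) :=
        tendsto_iff_dist_tendsto_zero.1 tendsto_id
      simpa using (h1.const_mul (Real.exp (2 * κ * (t₀ + 1)) * ‖v‖)).const_mul
        (Real.exp (2 * κ * (t₀ + 1)))
    refine tendsto_of_tendsto_of_tendsto_of_le_of_le' tendsto_const_nhds h0
      (Eventually.of_forall fun ν => norm_nonneg _) ?_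
    filter_upwards [hnhds] with t ht
    rcases le_total t₀ t with h' | h'
    · exact key t₀ t h' (le_of_lt ht)
    · rw [norm_sub_rev, dist_comm]
      exact key t t₀ h' (by simp)

/-- A second-order Taylor bound on the domain of the squared generator. It is proved for the
approximating groups, with `‖A_ν² u‖ ≤ 2 ‖A_ν v‖`, and passed to the limit. -/
theorem norm_limit_sub_sub_le (h : IsResolvent G J ν₀ κ)
    (hS : ∀ (t : ℝ≥0) f, Tendsto (fun ν => yosidaExp J ν t f) atTop (𝓝 (S t f)))
    (t : ℝ≥0) {u v w : E} (huv : G u v) (hvw : G v w) :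
    ‖S t u - u - (t : ℝ) • v‖ ≤ Real.exp (2 * κ * t) * (2 * ‖w‖) * t * t := by
  have hlim : Tendsto (fun ν => yosidaExp J ν t u - u - (t : ℝ) • yosida J ν u) atTop
      (𝓝 (S t u - u - (t : ℝ) • v)) :=
    ((hS t u).sub_const u).sub ((h.tendsto_yosida huv).const_smul _)
  refine le_of_tendsto_of_tendsto hlim.norm
    (((((h.tendsto_yosida hvw).norm.const_mul 2).const_mul _).mul_const _).mul_const _) ?_
  filter_upwards [eventually_gt_atTop ν₀] with ν hν
  have hd : ∀ s, HasDerivAt (fun s => yosidaExp J ν s u - s • yosida J ν u)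
      (yosidaExp J ν s (yosida J ν u) - yosida J ν u) s := fun s => by
    have := (hasDerivAt_yosidaExp (J := J) ν s u).sub ((hasDerivAt_id s).smul_const (yosida J ν u))
    simpa [Pi.sub_def] using this
  have hA : ‖yosida J ν (yosida J ν u)‖ ≤ 2 * ‖yosida J ν v‖ := by
    have e : yosida J ν (yosida J ν u) = (ν • J ν) (yosida J ν v) := by
      rw [h.yosida_apply hν huv, map_smul]
      have : yosida J ν (J ν v) = J ν (yosida J ν v) :=
        congrArg (fun T : E →L[ℝ] E => T v) (h.commute_yosida hν hν).eq.symm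
      rw [this]
      rfl
    rw [e]
    refine (ContinuousLinearMap.le_opNorm _ _).trans ?_
    gcongr
    exact h.norm_smul_le hν
  have := norm_image_sub_le_of_norm_deriv_le_segment'
    (f := fun s => yosidaExp J ν s u - s • yosida J ν u)
    (a := 0) (b := t) (C := Real.exp (2 * κ * t) * (2 * ‖yosida J ν v‖) * t)
    (fun s _ => (hd s).hasDerivWithinAt) (fun s hs => ?_) t ⟨t.2, le_rfl⟩
  · have e : yosidaExp J ν t u - (t : ℝ) • yosida J ν u - (yosidaExp J ν 0 u - (0 : ℝ) • yosida J ν u)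
        = yosidaExp J ν t u - u - (t : ℝ) • yosida J ν u := by
      simp only [yosidaExp_zero, zero_smul, sub_zero, one_apply_eq_self]
      abel
    rw [e, sub_zero] at this
    exact this
  · have hκ := h.nonneg
    have hs0 : 0 ≤ s := hs.1
    have hst : s ≤ t := hs.2.le
    refine (h.norm_yosidaExp_sub_le hν hs.1 _).trans ?_
    gcongr

/-- The Taylor bound gives differentiability only on the domain of the square. Writing `u = J μ (μ u
- v)` turns the difference quotients into the operators `t⁻¹ (S t - 1) J μ`, which are uniformly
bounded for `t ≤ 1` and converge on the domain, hence everywhere. -/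
theorem tendsto_slope (h : IsResolvent G J ν₀ κ)
    (hS : ∀ (t : ℝ≥0) f, Tendsto (fun ν => yosidaExp J ν t f) atTop (𝓝 (S t f)))
    {u v : E} (huv : G u v) :
    Tendsto (fun t : ℝ≥0 => (t : ℝ)⁻¹ • (S t u - u)) (𝓝[>] 0) (𝓝 v) := by
  have hμ : ν₀ < ν₀ + 1 := by linarith
  set μ := ν₀ + 1
  have hev : ∀ᶠ t : ℝ≥0 in 𝓝[>] 0, 0 < t ∧ t ≤ 1 := by
    filter_upwards [self_mem_nhdsWithin, nhdsWithin_le_nhds (Iic_mem_nhds (zero_lt_one (α := ℝ≥0)))]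
      with t h1 h2 using ⟨h1, h2⟩
  have hκ := h.nonneg
  have hexp : ∀ t : ℝ≥0, t ≤ 1 → Real.exp (2 * κ * t) ≤ Real.exp (2 * κ) := fun t ht => by
    apply Real.exp_le_exp.2
    have : (t : ℝ) ≤ 1 := by exact_mod_cast ht
    nlinarith
  have key := h.dense.tendsto_clm (l := 𝓝[>] (0 : ℝ≥0))
    (T := fun t : ℝ≥0 => (t : ℝ)⁻¹ • ((S t - 1) ∘L J μ)) (S := μ • J μ - 1)
    (C := Real.exp (2 * κ) * ‖μ • J μ - 1‖) ?_ ?_ (μ • u - v)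
  · have e1 : J μ (μ • u - v) = u := ((h.graph_iff μ hμ u v).1 huv).symm
    have e2 : (μ • J μ - 1) (μ • u - v) = v := by
      show μ • J μ (μ • u - v) - (μ • u - v) = v
      rw [e1]; abel
    rw [e2] at key
    refine key.congr fun t => ?_
    show (t : ℝ)⁻¹ • (S t (J μ (μ • u - v)) - J μ (μ • u - v)) = _
    rw [e1]
  · filter_upwards [hev] with t ht
    refine ContinuousLinearMap.opNorm_le_bound _ (by positivity) fun f => ?_
    have h1 := h.norm_limit_sub_le hS t (h.graph_apply hμ f)
    have htp : (0 : ℝ) < t := by exact_mod_cast ht.1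
    show ‖(t : ℝ)⁻¹ • (S t (J μ f) - J μ f)‖ ≤ _
    rw [norm_smul, norm_inv, Real.norm_of_nonneg htp.le, inv_mul_le_iff₀ htp]
    refine h1.trans ?_
    have h2 : ‖μ • J μ f - f‖ ≤ ‖μ • J μ - 1‖ * ‖f‖ := (μ • J μ - 1 : E →L[ℝ] E).le_opNorm f
    calc Real.exp (2 * κ * t) * ‖μ • J μ f - f‖ * t
        ≤ Real.exp (2 * κ) * (‖μ • J μ - 1‖ * ‖f‖) * t := by
          have := hexp t ht.2
          gcongr
      _ = _ := by ring
  · rintro f ⟨g, hfg⟩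
    have huv' := h.graph_apply hμ f
    have hvw : ∃ w, G (μ • J μ f - f) w := by
      refine ⟨μ • J μ g - g, ?_⟩
      rw [h.smul_apply_sub hμ hfg]
      exact h.graph_apply hμ g
    obtain ⟨w, hw⟩ := hvw
    rw [tendsto_iff_norm_sub_tendsto_zero]
    have h0 : Tendsto (fun t : ℝ≥0 => Real.exp (2 * κ) * (2 * ‖w‖) * (t : ℝ)) (𝓝[>] 0) (𝓝 0) := by
      have : Tendsto (fun t : ℝ≥0 => (t : ℝ)) (𝓝[>] 0) (𝓝 0) :=
        (NNReal.continuous_coe.tendsto' 0 0 rfl).mono_left nhdsWithin_le_nhds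
      simpa using this.const_mul (Real.exp (2 * κ) * (2 * ‖w‖))
    refine tendsto_of_tendsto_of_tendsto_of_le_of_le' tendsto_const_nhds h0
      (Eventually.of_forall fun ν => norm_nonneg _) ?_
    filter_upwards [hev] with t ht
    have htp : (0 : ℝ) < t := by exact_mod_cast ht.1
    show ‖(t : ℝ)⁻¹ • (S t (J μ f) - J μ f) - (μ • J μ f - f)‖ ≤ _
    have e : (t : ℝ)⁻¹ • (S t (J μ f) - J μ f) - (μ • J μ f - f) =
        (t : ℝ)⁻¹ • (S t (J μ f) - J μ f - (t : ℝ) • (μ • J μ f - f)) := by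
      rw [smul_sub (t : ℝ)⁻¹ (S t (J μ f) - J μ f), inv_smul_smul₀ htp.ne']
    rw [e, norm_smul, norm_inv, Real.norm_of_nonneg htp.le, inv_mul_le_iff₀ htp]
    refine (h.norm_limit_sub_sub_le hS t huv' hw).trans ?_
    calc Real.exp (2 * κ * t) * (2 * ‖w‖) * t * t ≤ Real.exp (2 * κ) * (2 * ‖w‖) * t * t := by
          have := hexp t ht.2
          gcongr
      _ = _ := by ring

theorem isGeneratedBy_limit (h : IsResolvent G J ν₀ κ)
    (hS : ∀ (t : ℝ≥0) f, Tendsto (fun ν => yosidaExp J ν t f) atTop (𝓝 (S t f))) :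
    IsGeneratedBy S G where
  semigroup := ⟨limit_zero hS, h.limit_add hS, h.continuous_limit hS⟩
  generator u v := by
    refine ⟨h.tendsto_slope hS, fun hlim => ?_⟩
    have hμ : ν₀ < ν₀ + 1 := by linarith
    set μ := ν₀ + 1
    -- Applying `J μ` to the convergent quotient and comparing with the known derivative of `S t (J
    -- μ u)` forces `J μ v = μ J μ u - u`, which is the graph relation.
    have h1 := ((J μ).continuous.tendsto v).comp hlim
    have h2 := h.tendsto_slope hS (h.graph_apply hμ u)
    have h3 : J μ v = μ • J μ u - u := by
      refine tendsto_nhds_unique h1 (h2.congr fun t => ?_)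
      simp only [Function.comp_apply, map_smul, map_sub, h.limit_commute hS hμ]
    rw [h.graph_iff μ hμ, map_sub, map_smul, h3]
    abel

/-- Partial sums of the exponential series in `J ν` have nonnegative coefficients, so a closed
convex cone invariant under the resolvents is invariant under the limit. It is applied to the
nonnegative functions. -/
theorem limit_mem (h : IsResolvent G J ν₀ κ)
    (hS : ∀ (t : ℝ≥0) f, Tendsto (fun ν => yosidaExp J ν t f) atTop (𝓝 (S t f))) {P : Set E}
    (hcl : IsClosed P) (hadd : ∀ x ∈ P, ∀ y ∈ P, x + y ∈ P)
    (hsmul : ∀ c : ℝ, 0 ≤ c → ∀ x ∈ P, c • x ∈ P)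
    (hJ : ∀ ν, ν₀ < ν → ∀ x ∈ P, J ν x ∈ P) (t : ℝ≥0) {f : E} (hf : f ∈ P) : S t f ∈ P := by
  refine hcl.mem_of_tendsto (hS t f) ?_
  filter_upwards [eventually_gt_atTop ν₀] with ν hν
  have hν0 := h.pos hν
  have hs := NormedSpace.exp_series_hasSum_exp' (𝕂 := ℝ) (((t : ℝ) * ν * ν) • J ν)
  have hs' := (hs.mapL (ContinuousLinearMap.apply ℝ E f)).tendsto_sum_nat
  rw [yosidaExp_eq]
  refine hsmul _ (Real.exp_pos _).le _ (hcl.mem_of_tendsto hs' (Eventually.of_forall fun n => ?_))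
  induction n with
  | zero =>
    have := hsmul 0 le_rfl f hf
    simpa using this
  | succ n ih =>
    rw [Finset.sum_range_succ]
    refine hadd _ ih _ ?_
    have hpow : ∀ k : ℕ, (J ν ^ k) f ∈ P := by
      intro k
      induction k with
      | zero => simpa using hf
      | succ k ihk =>
        rw [pow_succ']
        exact hJ ν hν _ ihk
    rw [smul_pow]
    exact hsmul _ (by positivity) _ (hsmul _ (by positivity) _ (hpow n))

/-- **Hille–Yosida theorem** for quasi-contractive semigroups. -/
theorem exists_isGeneratedBy (h : IsResolvent G J ν₀ κ) {P : Set E}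
    (hcl : IsClosed P) (hadd : ∀ x ∈ P, ∀ y ∈ P, x + y ∈ P)
    (hsmul : ∀ c : ℝ, 0 ≤ c → ∀ x ∈ P, c • x ∈ P)
    (hJ : ∀ ν, ν₀ < ν → ∀ x ∈ P, J ν x ∈ P) :
    ∃ S : ℝ≥0 → E →L[ℝ] E, IsGeneratedBy S G ∧ (∀ t, ‖S t‖ ≤ Real.exp (2 * κ * t)) ∧
      (∀ t u v, G u v → G (S t u) (S t v)) ∧ ∀ t, ∀ f ∈ P, S t f ∈ P := by
  obtain ⟨S, hS⟩ := h.exists_limit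
  exact ⟨S, h.isGeneratedBy_limit hS, h.norm_limit_le hS, fun t u v => h.graph_limit hS t,
    fun t f => h.limit_mem hS hcl hadd hsmul hJ t⟩

end IsResolvent

end

section

/-! ### Compactness of rank-one boundary perturbations -/

variable {E : Type*} [NormedAddCommGroup E] [NormedSpace ℝ E]

/-- The operator `u ↦ u - ψ u • e`. -/
def subRankOne (ψ : E →L[ℝ] ℝ) (e : E) : E →L[ℝ] E := 1 - ψ.smulRight e

@[simp] theorem subRankOne_apply (ψ : E →L[ℝ] ℝ) (e u : E) : subRankOne ψ e u = u - ψ u • e := rfl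

namespace IsC0Semigroup

variable {S : ℝ≥0 → E →L[ℝ] E}

/-- Joint continuity in time and vector: strong continuity together with boundedness of the norms on
compact time intervals. -/
theorem tendsto_apply {ι : Type*} {l : Filter ι} (hS : IsC0Semigroup S) {c : ℝ} (hc : 0 ≤ c)
    (hb : ∀ t, ‖S t‖ ≤ Real.exp (c * t)) {τ : ι → ℝ≥0} {τ₀ : ℝ≥0} (hτ : Tendsto τ l (𝓝 τ₀))
    {x : ι → E} {x₀ : E} (hx : Tendsto x l (𝓝 x₀)) :
    Tendsto (fun i => S (τ i) (x i)) l (𝓝 (S τ₀ x₀)) := by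
  have h1 : Tendsto (fun i => S (τ i) x₀) l (𝓝 (S τ₀ x₀)) :=
    ((hS.strongly_continuous x₀).tendsto τ₀).comp hτ
  have h2 : Tendsto (fun i => S (τ i) (x i - x₀)) l (𝓝 0) := by
    have h3 : Tendsto (fun i => Real.exp (c * (τ₀ + 1)) * ‖x i - x₀‖) l (𝓝 0) := by
      simpa using (tendsto_iff_norm_sub_tendsto_zero.1 hx).const_mul (Real.exp (c * (τ₀ + 1)))
    refine squeeze_zero_norm' ?_ h3
    filter_upwards [hτ (Iio_mem_nhds (show τ₀ < τ₀ + 1 by simp))] with i hi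
    refine (ContinuousLinearMap.le_opNorm _ _).trans ?_
    gcongr
    refine (hb _).trans (Real.exp_le_exp.2 ?_)
    gcongr
    have : τ i < τ₀ + 1 := hi
    exact_mod_cast this.le
  have h4 := h1.add h2
  rw [add_zero] at h4
  exact h4.congr fun i => by rw [map_sub]; abel

theorem add_apply (hS : IsC0Semigroup S) (s t : ℝ≥0) (f : E) : S (s + t) f = S s (S t f) := by
  rw [hS.map_add]; rfl

end IsC0Semigroup

/-- Two semigroups whose generators are conjugate, up to a rank-one perturbation of the domain and
an error term which is controlled along positive orbits. -/
structure IsRankOneConjugate (S₀ S₁ : ℝ≥0 → E →L[ℝ] E) (G₀ G₁ : E → E → Prop) (P : Set E)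
    (ψ W : E →L[ℝ] ℝ) (e h : E) (c A B : ℝ) : Prop where
  nonneg : 0 ≤ c ∧ 0 ≤ A ∧ 0 ≤ B
  gen₀ : IsGeneratedBy S₀ G₀
  gen₁ : IsGeneratedBy S₁ G₁
  bound₀ : ∀ t, ‖S₀ t‖ ≤ Real.exp (c * t)
  bound₁ : ∀ t, ‖S₁ t‖ ≤ Real.exp (c * t)
  graph₁ : ∀ t u v, G₁ u v → G₁ (S₁ t u) (S₁ t v)
  pos₁ : ∀ t, ∀ f ∈ P, S₁ t f ∈ P
  conj : ∀ u v, G₁ u v → G₀ (u - ψ u • e) (v - ψ u • h)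
  W_nonneg : ∀ u ∈ P, 0 ≤ W u
  control : ∀ u v, G₁ u v → u ∈ P → |ψ u| + |ψ v| ≤ A * (B * W u - W v)
  approx : P ⊆ closure {u | u ∈ P ∧ ∃ v, G₁ u v}
  decomp : ∀ f, ∃ f₁ ∈ P, ∃ f₂ ∈ P, f = f₁ - f₂ ∧ ‖f₁‖ ≤ ‖f‖ ∧ ‖f₂‖ ≤ ‖f‖

namespace IsRankOneConjugate

variable {S₀ S₁ : ℝ≥0 → E →L[ℝ] E} {G₀ G₁ : E → E → Prop} {P : Set E}
  {ψ W : E →L[ℝ] ℝ} {e h : E} {c A B : ℝ}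

/-- The curve `s ↦ S₀ (t - s) (I - e ⊗ ψ) S₁ s u`. -/
def curve (S₀ S₁ : ℝ≥0 → E →L[ℝ] E) (ψ : E →L[ℝ] ℝ) (e : E) (t : ℝ≥0) (u : E) (s : ℝ) : E :=
  S₀ ((t : ℝ) - s).toNNReal (subRankOne ψ e (S₁ s.toNNReal u))

theorem continuous_curve (H : IsRankOneConjugate S₀ S₁ G₀ G₁ P ψ W e h c A B) (t : ℝ≥0) (u : E) :
    Continuous (curve S₀ S₁ ψ e t u) := by
  rw [continuous_iff_continuousAt]
  intro s
  refine H.gen₀.semigroup.tendsto_apply H.nonneg.1 H.bound₀ (τ₀ := ((t : ℝ) - s).toNNReal)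
    (x₀ := subRankOne ψ e (S₁ s.toNNReal u)) ?_ ?_
  · exact (continuous_real_toNNReal.comp (continuous_const.sub continuous_id)).tendsto s
  · exact (((subRankOne ψ e).continuous.comp
      (H.gen₁.semigroup.strongly_continuous u)).comp continuous_real_toNNReal).tendsto s

/-- With `d = z - s` and `u_s = S₁ s u`, the semigroup laws give `curve z - curve s = S₀ (t - z) (T
S₁ d u_s - S₀ d T u_s)` for `T = subRankOne ψ e`. After division by `d` the bracket tends to the
difference of `T` times the first generator and the second generator times `T`, which `conj`
evaluates. Only the right derivative is needed later. -/
theorem hasDerivWithinAt_curve (H : IsRankOneConjugate S₀ S₁ G₀ G₁ P ψ W e h c A B) {t : ℝ≥0}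
    {u v : E} (huv : G₁ u v) {s : ℝ} (hs0 : 0 ≤ s) (hst : s < t) :
    HasDerivWithinAt (curve S₀ S₁ ψ e t u)
      (S₀ ((t : ℝ) - s).toNNReal (ψ (S₁ s.toNNReal u) • h - ψ (S₁ s.toNNReal v) • e)) (Ici s) s := by
  rw [← hasDerivWithinAt_Ioi_iff_Ici, hasDerivWithinAt_iff_tendsto_slope' (by simp)]
  set us := S₁ s.toNNReal u with hus
  set vs := S₁ s.toNNReal v with hvs
  have hG : G₁ us vs := H.graph₁ _ _ _ huv
  have hd : Tendsto (fun z : ℝ => (z - s).toNNReal) (𝓝[>] s) (𝓝[>] 0) := by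
    refine tendsto_nhdsWithin_iff.2 ⟨?_, ?_⟩
    · refine (Continuous.tendsto' ?_ s 0 (by simp)).mono_left nhdsWithin_le_nhds
      exact continuous_real_toNNReal.comp (continuous_id.sub continuous_const)
    · filter_upwards [self_mem_nhdsWithin] with z hz
      exact Real.toNNReal_pos.2 (sub_pos.2 hz)
  have h1 := (((H.gen₁.generator us vs).1 hG).comp hd)
  have h2 := (((H.gen₀.generator _ _).1 (H.conj us vs hG)).comp hd)
  have h3 := (((subRankOne ψ e).continuous.tendsto vs).comp h1).sub h2
  have h4 : Tendsto (fun z : ℝ => ((t : ℝ) - z).toNNReal) (𝓝[>] s) (𝓝 ((t : ℝ) - s).toNNReal) :=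
    (Continuous.tendsto (continuous_real_toNNReal.comp (continuous_const.sub continuous_id))
      s).mono_left nhdsWithin_le_nhds
  have h5 := H.gen₀.semigroup.tendsto_apply H.nonneg.1 H.bound₀ h4 h3
  have e1 : subRankOne ψ e vs - (vs - ψ us • h) = ψ us • h - ψ vs • e := by
    simp only [subRankOne_apply]; abel
  rw [e1] at h5
  refine h5.congr' ?_
  filter_upwards [Ioc_mem_nhdsGT hst] with z hz
  have hz1 : 0 < z - s := sub_pos.2 hz.1
  have ez : z.toNNReal = (z - s).toNNReal + s.toNNReal := by
    rw [← Real.toNNReal_add hz1.le hs0, sub_add_cancel]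
  have et : ((t : ℝ) - s).toNNReal = ((t : ℝ) - z).toNNReal + (z - s).toNNReal := by
    rw [← Real.toNNReal_add (sub_nonneg.2 hz.2) hz1.le, sub_add_sub_cancel]
  have eu : S₁ z.toNNReal u = S₁ (z - s).toNNReal us := by
    rw [ez, H.gen₁.semigroup.add_apply]
  simp only [slope, vsub_eq_sub, curve, Function.comp_apply]
  rw [eu, et, H.gen₀.semigroup.add_apply, ← hus, ← map_sub, ← map_smul]
  congr 1
  rw [Real.coe_toNNReal _ hz1.le, map_smul, ← smul_sub, map_sub, subRankOne_apply ψ e us]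
  congr 1
  abel

/-- The bound in `control` contains `-W v`, which is not controlled by `‖u‖`, but `W v` is the
derivative of `W` along the orbit. Adding `α A W (S₁ s u)` to the curve cancels this term, and the
positivity of `W` at time `t` allows it to be dropped at the end. -/
theorem dual_curve_le (H : IsRankOneConjugate S₀ S₁ G₀ G₁ P ψ W e h c A B) {t : ℝ≥0}
    {u v : E} (huv : G₁ u v) (hu : u ∈ P) (F : E →L[ℝ] ℝ) {α : ℝ} (hα : 0 ≤ α)
    (hh : ∀ τ ≤ t, |F (S₀ τ h)| ≤ α) (he : ∀ τ ≤ t, |F (S₀ τ e)| ≤ α) :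
    F (curve S₀ S₁ ψ e t u t - curve S₀ S₁ ψ e t u 0) ≤
      α * (A * (1 + B * Real.exp (c * t) * t) * ‖W‖) * ‖u‖ := by
  obtain ⟨hc, hA, hB⟩ := H.nonneg
  have hWle : ∀ s : ℝ≥0, s ≤ t → W (S₁ s u) ≤ ‖W‖ * (Real.exp (c * t) * ‖u‖) := by
    intro s hs
    refine (le_abs_self _).trans ((W.le_opNorm _).trans ?_)
    gcongr
    refine ((S₁ s).le_opNorm _).trans ?_
    gcongr
    refine (H.bound₁ s).trans (Real.exp_le_exp.2 ?_)
    gcongr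
  have hWd : ∀ s : ℝ, 0 ≤ s → HasDerivWithinAt (fun s : ℝ => W (S₁ s.toNNReal u))
      (W (S₁ s.toNNReal v)) (Ici s) s := by
    intro s hs0
    rw [← hasDerivWithinAt_Ioi_iff_Ici, hasDerivWithinAt_iff_tendsto_slope' (by simp)]
    have hG := H.graph₁ s.toNNReal _ _ huv
    have hd : Tendsto (fun z : ℝ => (z - s).toNNReal) (𝓝[>] s) (𝓝[>] 0) := by
      refine tendsto_nhdsWithin_iff.2 ⟨?_, ?_⟩
      · refine (Continuous.tendsto' ?_ s 0 (by simp)).mono_left nhdsWithin_le_nhds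
        exact continuous_real_toNNReal.comp (continuous_id.sub continuous_const)
      · filter_upwards [self_mem_nhdsWithin] with z hz
        exact Real.toNNReal_pos.2 (sub_pos.2 hz)
    refine ((W.continuous.tendsto _).comp (((H.gen₁.generator _ _).1 hG).comp hd)).congr' ?_
    filter_upwards [self_mem_nhdsWithin] with z hz
    have hz1 : 0 < z - s := sub_pos.2 hz
    have ez : z.toNNReal = (z - s).toNNReal + s.toNNReal := by
      rw [← Real.toNNReal_add hz1.le hs0, sub_add_cancel]
    simp only [slope, vsub_eq_sub, Function.comp_apply]
    rw [ez, H.gen₁.semigroup.add_apply, map_smul, map_sub, Real.coe_toNNReal _ hz1.le]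
  -- `D` dominates `α A B W (S₁ s u)` for all `s ≤ t`; it is the slope of the linear majorant.
  set D := α * A * B * (‖W‖ * (Real.exp (c * t) * ‖u‖)) with hD
  have key := image_le_of_deriv_right_le_deriv_boundary (a := 0) (b := (t : ℝ))
    (f := fun s => F (curve S₀ S₁ ψ e t u s) + α * A * W (S₁ s.toNNReal u))
    (f' := fun s => F (S₀ ((t : ℝ) - s).toNNReal (ψ (S₁ s.toNNReal u) • h -
      ψ (S₁ s.toNNReal v) • e)) + α * A * W (S₁ s.toNNReal v))
    (B := fun s => (F (curve S₀ S₁ ψ e t u 0) + α * A * W (S₁ (0 : ℝ).toNNReal u)) + D * s)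
    (B' := fun _ => D) ?_ ?_ (by simp) ?_ ?_ ?_ (right_mem_Icc.2 t.2)
  · have hW0 : 0 ≤ α * A * W (S₁ t u) := by
      have := H.W_nonneg _ (H.pos₁ t u hu)
      positivity
    have hW1 : W u ≤ ‖W‖ * ‖u‖ := (le_abs_self _).trans (W.le_opNorm _)
    have e0 : S₁ 0 u = u := by rw [H.gen₁.semigroup.map_zero]; rfl
    simp only [Real.toNNReal_coe, Real.toNNReal_zero, e0] at key
    rw [map_sub]
    have h1 : α * A * W u ≤ α * A * (‖W‖ * ‖u‖) := by gcongr
    have h2 : α * (A * (1 + B * Real.exp (c * t) * t) * ‖W‖) * ‖u‖ =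
        α * A * (‖W‖ * ‖u‖) + D * t := by rw [hD]; ring
    linarith
  · refine ((F.continuous.comp (H.continuous_curve t u)).add
      (continuous_const.mul (W.continuous.comp ?_))).continuousOn
    exact (H.gen₁.semigroup.strongly_continuous u).comp continuous_real_toNNReal
  · intro s hs
    exact (F.hasFDerivAt.comp_hasDerivWithinAt s (H.hasDerivWithinAt_curve huv hs.1 hs.2)).add
      ((hWd s hs.1).const_mul _)
  · fun_prop
  · intro s hs
    have := ((hasDerivAt_id s).const_mul D).const_add
      (F (curve S₀ S₁ ψ e t u 0) + α * A * W (S₁ (0 : ℝ).toNNReal u))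
    simpa using this.hasDerivWithinAt
  · intro s hs
    have hle : s.toNNReal ≤ t := Real.toNNReal_le_iff_le_coe.2 hs.2.le
    have hle' : ((t : ℝ) - s).toNNReal ≤ t := Real.toNNReal_le_iff_le_coe.2 (by linarith [hs.1])
    have h1 := H.control _ _ (H.graph₁ s.toNNReal _ _ huv) (H.pos₁ _ u hu)
    have h2 := hWle _ hle
    have h3 : F (S₀ ((t : ℝ) - s).toNNReal (ψ (S₁ s.toNNReal u) • h - ψ (S₁ s.toNNReal v) • e)) ≤
        α * (|ψ (S₁ s.toNNReal u)| + |ψ (S₁ s.toNNReal v)|) := by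
      rw [map_sub, map_smul, map_smul, map_sub, map_smul, map_smul]
      refine (le_abs_self _).trans ((abs_sub _ _).trans ?_)
      rw [smul_eq_mul, smul_eq_mul, abs_mul, abs_mul, mul_add, mul_comm α, mul_comm α]
      gcongr
      · exact hh _ hle'
      · exact he _ hle'
    have h4 : α * (|ψ (S₁ s.toNNReal u)| + |ψ (S₁ s.toNNReal v)|) ≤
        α * (A * (B * W (S₁ s.toNNReal u) - W (S₁ s.toNNReal v))) := by gcongr
    have h5 : α * A * B * W (S₁ s.toNNReal u) ≤ D := by rw [hD]; gcongr
    nlinarith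

/-- The integral of the derivative of the curve is a bounded combination of vectors `S₀ τ h` and `S₀
τ e` with `τ ≤ t`. These orbits are compact, and so is their closed convex hull. It suffices to
treat positive vectors in the domain. -/
theorem isCompactOperator [CompleteSpace E]
    (H : IsRankOneConjugate S₀ S₁ G₀ G₁ P ψ W e h c A B) (t : ℝ≥0) :
    IsCompactOperator (subRankOne ψ e * S₁ t - S₀ t * subRankOne ψ e : E →L[ℝ] E) := by
  obtain ⟨hc, hA, hB⟩ := H.nonneg
  -- The constant of `dual_curve_le` for `‖u‖ ≤ 2`, with `1` added to make it positive.
  set N := A * (1 + B * Real.exp (c * t) * t) * ‖W‖ * 2 + 1 with hN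
  have hNpos : 0 < N := by positivity
  set Kset : Set E := (((fun τ => N • S₀ τ h) '' Icc 0 t) ∪ ((fun τ => -(N • S₀ τ h)) '' Icc 0 t)) ∪
    (((fun τ => N • S₀ τ e) '' Icc 0 t) ∪ ((fun τ => -(N • S₀ τ e)) '' Icc 0 t)) with hK
  have hKc : IsCompact Kset := by
    have hcont : ∀ x : E, Continuous fun τ => N • S₀ τ x := fun x =>
      (H.gen₀.semigroup.strongly_continuous x).const_smul N
    exact ((isCompact_Icc.image (hcont h)).union (isCompact_Icc.image (hcont h).neg)).union
      ((isCompact_Icc.image (hcont e)).union (isCompact_Icc.image (hcont e).neg))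
  set K := closedConvexHull ℝ Kset
  have hcompact : IsCompact K := by
    rw [show K = closure (convexHull ℝ Kset) from closedConvexHull_eq_closure_convexHull]
    exact hKc.totallyBounded.convexHull.closure.isCompact_of_isClosed isClosed_closure
  set T : E →L[ℝ] E := subRankOne ψ e * S₁ t - S₀ t * subRankOne ψ e with hT
  have hcurve : ∀ u, T u = curve S₀ S₁ ψ e t u t - curve S₀ S₁ ψ e t u 0 := by
    intro u
    have e0 : ∀ f, S₀ 0 f = f := fun f => by rw [H.gen₀.semigroup.map_zero]; rfl
    have e1 : ∀ f, S₁ 0 f = f := fun f => by rw [H.gen₁.semigroup.map_zero]; rfl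
    simp only [curve, sub_self, sub_zero, Real.toNNReal_zero, Real.toNNReal_coe, e0, e1]
    rfl
  have hdom : ∀ u v, G₁ u v → u ∈ P → ‖u‖ ≤ 2 → T u ∈ K := by
    intro u v huv hu hnorm
    by_contra hnot
    -- A separating functional satisfies `|F| ≤ r / N` on both orbits, because `Kset` contains their
    -- multiples by `±N`. Then `dual_curve_le` gives `F (T u) ≤ r`, against the separation.
    obtain ⟨F, r, hF, hr⟩ := geometric_hahn_banach_closed_point convex_closedConvexHull
      isClosed_closedConvexHull hnot
    have hsub : ∀ x ∈ Kset, F x < r := fun x hx => hF x (subset_closedConvexHull hx)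
    have habs : ∀ x : E, F (N • x) < r → F (-(N • x)) < r → |F x| ≤ r / N := by
      intro x h1 h2
      rw [map_neg, map_smul, smul_eq_mul] at h2
      rw [map_smul, smul_eq_mul] at h1
      have h3 : |N * F x| ≤ r := abs_le.2 ⟨by linarith, h1.le⟩
      rwa [abs_mul, abs_of_pos hNpos, mul_comm, ← le_div_iff₀ hNpos] at h3
    have hh : ∀ τ ≤ t, |F (S₀ τ h)| ≤ r / N := fun τ hτ => habs _
      (hsub _ (Or.inl (Or.inl ⟨τ, ⟨zero_le, hτ⟩, rfl⟩)))
      (hsub _ (Or.inl (Or.inr ⟨τ, ⟨zero_le, hτ⟩, rfl⟩)))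
    have he : ∀ τ ≤ t, |F (S₀ τ e)| ≤ r / N := fun τ hτ => habs _
      (hsub _ (Or.inr (Or.inl ⟨τ, ⟨zero_le, hτ⟩, rfl⟩)))
      (hsub _ (Or.inr (Or.inr ⟨τ, ⟨zero_le, hτ⟩, rfl⟩)))
    have hα : 0 ≤ r / N := (abs_nonneg _).trans (hh 0 zero_le)
    have := H.dual_curve_le huv hu F hα hh he
    rw [← hcurve] at this
    have h2 : r / N * (A * (1 + B * Real.exp (c * t) * t) * ‖W‖) * ‖u‖ ≤ r / N * N := by
      rw [mul_assoc]
      gcongr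
      calc A * (1 + B * Real.exp (c * t) * t) * ‖W‖ * ‖u‖
          ≤ A * (1 + B * Real.exp (c * t) * t) * ‖W‖ * 2 := by gcongr
        _ ≤ N := by rw [hN]; linarith
    rw [div_mul_cancel₀ _ hNpos.ne'] at h2
    linarith
  -- The radius `2` leaves room for the domain elements approximating `f`, whose norms need not stay
  -- below that of `f`.
  have hpos : ∀ f ∈ P, ‖f‖ < 2 → T f ∈ K := by
    intro f hf hnorm
    obtain ⟨x, hx, hlim⟩ := mem_closure_iff_seq_limit.1 (H.approx hf)
    refine hcompact.isClosed.mem_of_tendsto ((T.continuous.tendsto f).comp hlim) ?_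
    filter_upwards [hlim.norm (Iio_mem_nhds hnorm)] with n hn
    obtain ⟨hxP, v, hv⟩ := hx n
    exact hdom _ v hv hxP (le_of_lt hn)
  rw [isCompactOperator_iff_exists_mem_nhds_image_subset_compact]
  refine ⟨Metric.ball 0 1, Metric.ball_mem_nhds _ one_pos, (fun p : E × E => p.1 - p.2) '' K ×ˢ K,
    (hcompact.prod hcompact).image continuous_sub, ?_⟩
  rintro _ ⟨f, hf, rfl⟩
  have hf1 : ‖f‖ < 1 := by simpa using hf
  obtain ⟨f₁, h1, f₂, h2, rfl, hn1, hn2⟩ := H.decomp f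
  exact ⟨(T f₁, T f₂), ⟨hpos _ h1 (by linarith), hpos _ h2 (by linarith)⟩, (map_sub T f₁ f₂).symm⟩

end IsRankOneConjugate

end

section

/-! ### The weighted space and integral operators on it -/

instance : SFinite lebPos := by unfold lebPos; infer_instance

/-- The weight `1 + x ^ m`. -/
def wt (m x : ℝ) : ℝ := 1 + x ^ m

theorem wt_pos (m : ℝ) {x : ℝ} (hx : 0 < x) : 0 < wt m x := by
  have := Real.rpow_pos_of_pos hx m
  unfold wt; linarith

theorem one_le_wt (m : ℝ) {x : ℝ} (hx : 0 < x) : 1 ≤ wt m x := by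
  have := Real.rpow_pos_of_pos hx m
  unfold wt; linarith

@[fun_prop] theorem measurable_wt (m : ℝ) : Measurable (wt m) := by
  unfold wt; fun_prop

theorem ae_lebPos_pos : ∀ᵐ x ∂lebPos, 0 < x := ae_restrict_mem measurableSet_Ioi

theorem weightedMeasure_eq (m : ℝ) :
    weightedMeasure m = lebPos.withDensity (fun x => ENNReal.ofReal (wt m x)) := rfl

theorem ae_weightedMeasure_iff {m : ℝ} {p : ℝ → Prop} :
    (∀ᵐ x ∂weightedMeasure m, p x) ↔ ∀ᵐ x ∂lebPos, p x := by
  rw [weightedMeasure_eq, ae_withDensity_iff (by fun_prop)]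
  refine eventually_congr ?_
  filter_upwards [ae_lebPos_pos] with x hx
  exact imp_iff_right (by simpa using wt_pos m hx)

theorem integrable_weightedMeasure_iff {m : ℝ} {f : ℝ → ℝ} :
    Integrable f (weightedMeasure m) ↔ Integrable (fun x => wt m x * f x) lebPos := by
  rw [weightedMeasure_eq, integrable_withDensity_iff_integrable_smul' (by fun_prop)
    (Eventually.of_forall fun _ => ENNReal.ofReal_lt_top)]
  refine integrable_congr ?_
  filter_upwards [ae_lebPos_pos] with x hx
  rw [ENNReal.toReal_ofReal (wt_pos m hx).le, smul_eq_mul]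

theorem integral_weightedMeasure {m : ℝ} (f : ℝ → ℝ) :
    ∫ x, f x ∂weightedMeasure m = ∫ x, wt m x * f x ∂lebPos := by
  rw [weightedMeasure_eq, integral_withDensity_eq_integral_toReal_smul (by fun_prop)
    (Eventually.of_forall fun _ => ENNReal.ofReal_lt_top)]
  refine integral_congr_ae ?_
  filter_upwards [ae_lebPos_pos] with x hx
  rw [ENNReal.toReal_ofReal (wt_pos m hx).le, smul_eq_mul]

variable {m : ℝ}

theorem X_ext {u v : X m} (h : u =ᵐ[lebPos] v) : u = v :=
  Lp.ext (ae_weightedMeasure_iff.2 h)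

theorem X_add (u v : X m) : ⇑(u + v) =ᵐ[lebPos] fun x => u x + v x :=
  ae_weightedMeasure_iff.1 (Lp.coeFn_add u v)

theorem X_sub (u v : X m) : ⇑(u - v) =ᵐ[lebPos] fun x => u x - v x :=
  ae_weightedMeasure_iff.1 (Lp.coeFn_sub u v)

theorem X_smul (c : ℝ) (u : X m) : ⇑(c • u) =ᵐ[lebPos] fun x => c * u x :=
  ae_weightedMeasure_iff.1 (Lp.coeFn_smul c u)

theorem X_integrable (u : X m) : Integrable (fun x => wt m x * u x) lebPos :=
  integrable_weightedMeasure_iff.1 (L1.integrable_coeFn u)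

theorem X_norm (u : X m) : ‖u‖ = ∫ x, wt m x * |u x| ∂lebPos := by
  rw [L1.norm_eq_integral_norm, integral_weightedMeasure]
  rfl

theorem X_nonneg_iff {u : X m} : 0 ≤ u ↔ ∀ᵐ x ∂lebPos, 0 ≤ u x := by
  rw [← Lp.coeFn_nonneg, ← ae_weightedMeasure_iff (m := m)]
  rfl

theorem X_smul_nonneg {c : ℝ} (hc : 0 ≤ c) {u : X m} (hu : 0 ≤ u) : 0 ≤ c • u := by
  rw [X_nonneg_iff]
  filter_upwards [X_smul c u, X_nonneg_iff.1 hu] with x h1 h2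
  rw [h1]
  exact mul_nonneg hc h2

theorem X_aestronglyMeasurable (u : X m) : AEStronglyMeasurable u lebPos := by
  refine (L1.integrable_coeFn u).aestronglyMeasurable.mono_ac ?_
  rw [weightedMeasure_eq]
  refine withDensity_absolutelyContinuous' (by fun_prop) ?_
  filter_upwards [ae_lebPos_pos] with x hx
  simpa using wt_pos m hx

/-- The element of `X m` represented by `f`. -/
def toX {f : ℝ → ℝ} (hf : Integrable f (weightedMeasure m)) : X m := hf.toL1 f

theorem toX_ae {f : ℝ → ℝ} (hf : Integrable f (weightedMeasure m)) : toX hf =ᵐ[lebPos] f :=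
  ae_weightedMeasure_iff.1 hf.coeFn_toL1

/-- `γ` is dominated by `C` times the weight. -/
structure DualBound (m : ℝ) (γ : ℝ → ℝ) (C : ℝ) : Prop where
  meas : AEStronglyMeasurable γ lebPos
  nonneg : 0 ≤ C
  le : ∀ᵐ x ∂lebPos, |γ x| ≤ C * wt m x

namespace DualBound

variable {γ : ℝ → ℝ} {C : ℝ}

theorem integrable_mul (h : DualBound m γ C) {f : ℝ → ℝ}
    (hf : Integrable (fun x => wt m x * f x) lebPos) (hm : AEStronglyMeasurable f lebPos) :
    Integrable (fun x => γ x * f x) lebPos := by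
  refine (hf.const_mul C).mono (h.meas.mul hm) ?_
  filter_upwards [h.le, ae_lebPos_pos] with x hx hx0
  rw [Real.norm_eq_abs, Real.norm_eq_abs, abs_mul, abs_mul, abs_mul, abs_of_nonneg h.nonneg,
    abs_of_pos (wt_pos m hx0), ← mul_assoc]
  gcongr

theorem integrable (h : DualBound m γ C) (u : X m) : Integrable (fun x => γ x * u x) lebPos :=
  h.integrable_mul (X_integrable u) (X_aestronglyMeasurable u)

theorem integral_abs_le (h : DualBound m γ C) (u : X m) :
    ∫ x, |γ x| * |u x| ∂lebPos ≤ C * ‖u‖ := by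
  rw [X_norm, ← integral_const_mul]
  refine integral_mono_ae ?_ ?_ ?_
  · simpa [abs_mul] using (h.integrable u).abs
  · refine Integrable.const_mul ((X_integrable u).abs.congr ?_) C
    filter_upwards [ae_lebPos_pos] with x hx
    rw [abs_mul, abs_of_pos (wt_pos m hx)]
  · filter_upwards [h.le] with x hx
    rw [← mul_assoc]
    gcongr

theorem abs_pairing_le (h : DualBound m γ C) (u : X m) : |pairing γ u| ≤ C * ‖u‖ := by
  refine le_trans ?_ (h.integral_abs_le u)
  simpa only [pairing, abs_mul] using abs_integral_le_integral_abs (f := fun x => γ x * u x) (μ := lebPos)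

theorem pairing_nonneg (h : ∀ᵐ x ∂lebPos, 0 ≤ γ x) {u : X m} (hu : 0 ≤ u) :
    0 ≤ pairing γ u := by
  refine integral_nonneg_of_ae ?_
  filter_upwards [h, X_nonneg_iff.1 hu] with x h1 h2 using mul_nonneg h1 h2

/-- The functional `u ↦ ⟨γ, u⟩` on `X m`. -/
def clm (h : DualBound m γ C) : X m →L[ℝ] ℝ :=
  LinearMap.mkContinuous
    { toFun := fun u => pairing γ u
      map_add' := fun u v => by
        rw [pairing, pairing, pairing, ← integral_add (h.integrable u) (h.integrable v)]
        refine integral_congr_ae ?_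
        filter_upwards [X_add u v] with x hx
        rw [hx]; ring
      map_smul' := fun c u => by
        rw [pairing, pairing, RingHom.id_apply, smul_eq_mul, ← integral_const_mul]
        refine integral_congr_ae ?_
        filter_upwards [X_smul c u] with x hx
        rw [hx]; ring } C h.abs_pairing_le

end DualBound

theorem dualBound_wt (m : ℝ) : DualBound m (wt m) 1 where
  meas := (measurable_wt m).aestronglyMeasurable
  nonneg := zero_le_one
  le := by
    filter_upwards [ae_lebPos_pos] with x hx
    rw [abs_of_pos (wt_pos m hx), one_mul]

theorem norm_eq_pairing {u : X m} (hu : 0 ≤ u) : ‖u‖ = pairing (wt m) u := by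
  rw [X_norm]
  refine integral_congr_ae ?_
  filter_upwards [X_nonneg_iff.1 hu] with x hx
  rw [abs_of_nonneg hx]

theorem pairing_congr {γ f g : ℝ → ℝ} (h : f =ᵐ[lebPos] g) : pairing γ f = pairing γ g :=
  integral_congr_ae (h.mono fun x hx => by simp only [hx])

/-- `κ` is a nonnegative kernel with `∫ κ(x, y) (1 + x ^ m) dx ≤ θ y ≤ C (1 + y ^ m)`. -/
structure IsKernel (m : ℝ) (κ : ℝ → ℝ → ℝ) (θ : ℝ → ℝ) (C : ℝ) : Prop where
  meas : AEStronglyMeasurable (Function.uncurry κ) (lebPos.prod lebPos)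
  nonneg : ∀ x y, 0 < x → 0 < y → 0 ≤ κ x y
  lintegral_le : ∀ y, 0 < y → ∫⁻ x, ENNReal.ofReal (wt m x * κ x y) ∂lebPos ≤ ENNReal.ofReal (θ y)
  bound : DualBound m θ C

namespace IsKernel

variable {κ : ℝ → ℝ → ℝ} {θ : ℝ → ℝ} {C : ℝ}

theorem aestronglyMeasurable (h : IsKernel m κ θ C) (f : X m) :
    AEStronglyMeasurable (fun z : ℝ × ℝ => wt m z.1 * (κ z.1 z.2 * f z.2)) (lebPos.prod lebPos) :=
  ((measurable_wt m).aestronglyMeasurable.comp_fst).mul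
    (h.meas.mul (X_aestronglyMeasurable f).comp_snd)

/-- Tonelli: integrating over `x` before `y` produces the weighted column integrals of the kernel,
which `θ` dominates. -/
theorem lintegral_prod_le (h : IsKernel m κ θ C) (f : X m) :
    ∫⁻ z : ℝ × ℝ, ‖wt m z.1 * (κ z.1 z.2 * f z.2)‖ₑ ∂lebPos.prod lebPos ≤
      ENNReal.ofReal (∫ y, |θ y| * |f y| ∂lebPos) := by
  have h1 : ENNReal.ofReal (∫ y, |θ y| * |f y| ∂lebPos) = ∫⁻ y, ‖θ y * f y‖ₑ ∂lebPos := by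
    rw [← ofReal_integral_norm_eq_lintegral_enorm (h.bound.integrable f)]
    simp
  rw [h1, lintegral_prod_symm _ (h.aestronglyMeasurable f).enorm]
  refine lintegral_mono_ae ?_
  filter_upwards [ae_lebPos_pos] with y hy
  calc ∫⁻ x, ‖wt m x * (κ x y * f y)‖ₑ ∂lebPos
      = ∫⁻ x, ENNReal.ofReal (wt m x * κ x y) * ‖f y‖ₑ ∂lebPos := by
        refine lintegral_congr_ae ?_
        filter_upwards [ae_lebPos_pos] with x hx
        rw [← mul_assoc, enorm_mul, Real.enorm_of_nonneg
          (mul_nonneg (wt_pos m hx).le (h.nonneg x y hx hy))]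
    _ = (∫⁻ x, ENNReal.ofReal (wt m x * κ x y) ∂lebPos) * ‖f y‖ₑ :=
        lintegral_mul_const' _ _ enorm_ne_top
    _ ≤ ‖θ y * f y‖ₑ := by
        rw [enorm_mul]
        gcongr
        refine (h.lintegral_le y hy).trans ?_
        rw [Real.enorm_eq_ofReal_abs]
        exact ENNReal.ofReal_le_ofReal (le_abs_self _)

theorem integrable_prod (h : IsKernel m κ θ C) (f : X m) :
    Integrable (fun z : ℝ × ℝ => wt m z.1 * (κ z.1 z.2 * f z.2)) (lebPos.prod lebPos) :=
  ⟨h.aestronglyMeasurable f, (h.lintegral_prod_le f).trans_lt ENNReal.ofReal_lt_top⟩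

theorem ae_integrable (h : IsKernel m κ θ C) (f : X m) :
    ∀ᵐ x ∂lebPos, Integrable (fun y => κ x y * f y) lebPos := by
  filter_upwards [(h.integrable_prod f).prod_right_ae, ae_lebPos_pos] with x hx hx0
  refine (hx.const_mul (wt m x)⁻¹).congr (Eventually.of_forall fun y => ?_)
  exact inv_mul_cancel_left₀ (wt_pos m hx0).ne' _

theorem integrable_integral (h : IsKernel m κ θ C) (f : X m) :
    Integrable (fun x => ∫ y, κ x y * f y ∂lebPos) (weightedMeasure m) := by
  rw [integrable_weightedMeasure_iff]
  refine (h.integrable_prod f).integral_prod_left.congr (Eventually.of_forall fun x => ?_)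
  exact integral_const_mul (wt m x) fun y => κ x y * f y

theorem norm_integral_le (h : IsKernel m κ θ C) (f : X m) :
    ‖toX (h.integrable_integral f)‖ ≤ ∫ y, |θ y| * |f y| ∂lebPos := by
  have h0 : 0 ≤ ∫ y, |θ y| * |f y| ∂lebPos := integral_nonneg fun y => by positivity
  rw [← ENNReal.ofReal_le_ofReal_iff h0]
  refine le_trans ?_ (h.lintegral_prod_le f)
  rw [lintegral_prod _ (h.aestronglyMeasurable f).enorm, X_norm]
  have h1 : ∫ x, wt m x * |(toX (h.integrable_integral f) : ℝ → ℝ) x| ∂lebPos =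
      ∫ x, ‖∫ y, wt m x * (κ x y * f y) ∂lebPos‖ ∂lebPos := by
    refine integral_congr_ae ?_
    filter_upwards [toX_ae (h.integrable_integral f), ae_lebPos_pos] with x hx hx0
    rw [hx, integral_const_mul, norm_mul, Real.norm_of_nonneg (wt_pos m hx0).le, Real.norm_eq_abs]
  rw [h1, ofReal_integral_norm_eq_lintegral_enorm (h.integrable_prod f).integral_prod_left]
  exact lintegral_mono fun x => enorm_integral_le_lintegral_enorm _

/-- The integral operator with kernel `κ`. -/
def clm (h : IsKernel m κ θ C) : X m →L[ℝ] X m :=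
  LinearMap.mkContinuous
    { toFun := fun f => toX (h.integrable_integral f)
      map_add' := fun f g => X_ext <| by
        filter_upwards [toX_ae (h.integrable_integral (f + g)), toX_ae (h.integrable_integral f),
          toX_ae (h.integrable_integral g),
          X_add (toX (h.integrable_integral f)) (toX (h.integrable_integral g)),
          h.ae_integrable f, h.ae_integrable g] with x h1 h2 h3 h4 h5 h6
        rw [h1, h4, h2, h3, ← integral_add h5 h6]
        refine integral_congr_ae ?_
        filter_upwards [X_add f g] with y hy
        rw [hy]; ring
      map_smul' := fun c f => X_ext <| by
        filter_upwards [toX_ae (h.integrable_integral (c • f)), toX_ae (h.integrable_integral f),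
          X_smul c (toX (h.integrable_integral f))] with x h1 h2 h3
        rw [h1, RingHom.id_apply, h3, h2, ← integral_const_mul]
        refine integral_congr_ae ?_
        filter_upwards [X_smul c f] with y hy
        rw [hy]; ring } C
    fun f => (h.norm_integral_le f).trans (h.bound.integral_abs_le f)

theorem clm_ae (h : IsKernel m κ θ C) (f : X m) :
    h.clm f =ᵐ[lebPos] fun x => ∫ y, κ x y * f y ∂lebPos :=
  toX_ae (h.integrable_integral f)

theorem norm_clm_apply_le (h : IsKernel m κ θ C) (f : X m) :
    ‖h.clm f‖ ≤ ∫ y, |θ y| * |f y| ∂lebPos :=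
  h.norm_integral_le f

theorem clm_nonneg (h : IsKernel m κ θ C) {f : X m} (hf : 0 ≤ f) : 0 ≤ h.clm f := by
  rw [X_nonneg_iff]
  filter_upwards [h.clm_ae f, ae_lebPos_pos] with x hx hx0
  rw [hx]
  refine integral_nonneg_of_ae ?_
  filter_upwards [X_nonneg_iff.1 hf, ae_lebPos_pos] with y hy hy0
  exact mul_nonneg (h.nonneg x y hx0 hy0) hy

end IsKernel

/-- The norm of a positive operator is determined on the positive cone. -/
theorem opNorm_le_of_nonneg {T : X m →L[ℝ] X m} (hT : ∀ f, 0 ≤ f → 0 ≤ T f) {C : ℝ} (hC : 0 ≤ C)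
    (h : ∀ f, 0 ≤ f → ‖T f‖ ≤ C * ‖f‖) : ‖T‖ ≤ C := by
  refine ContinuousLinearMap.opNorm_le_bound _ hC fun f => ?_
  have hmono : ∀ f g : X m, f ≤ g → T f ≤ T g := fun f g hfg => by
    have := hT (g - f) (sub_nonneg.2 hfg)
    rwa [map_sub, sub_nonneg] at this
  have h1 : |T f| ≤ T |f| := by
    refine abs_le'.2 ⟨hmono _ _ (le_abs_self f), ?_⟩
    rw [← map_neg]
    exact hmono _ _ (neg_le_abs f)
  calc ‖T f‖ ≤ ‖T |f|‖ := norm_le_norm_of_abs_le_abs (h1.trans (le_abs_self _))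
    _ ≤ C * ‖|f|‖ := h _ (abs_nonneg f)
    _ = C * ‖f‖ := by rw [norm_abs_eq_norm]

theorem exists_nonneg_sub (f : X m) :
    ∃ f₁ ∈ Ici (0 : X m), ∃ f₂ ∈ Ici (0 : X m), f = f₁ - f₂ ∧ ‖f₁‖ ≤ ‖f‖ ∧ ‖f₂‖ ≤ ‖f‖ := by
  refine ⟨f⁺, posPart_nonneg f, f⁻, negPart_nonneg f, (posPart_sub_negPart f).symm, ?_, ?_⟩
  · refine norm_le_norm_of_abs_le_abs ?_
    rw [abs_of_nonneg (posPart_nonneg f), ← posPart_add_negPart f]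
    exact le_add_of_nonneg_right (negPart_nonneg f)
  · refine norm_le_norm_of_abs_le_abs ?_
    rw [abs_of_nonneg (negPart_nonneg f), ← posPart_add_negPart f]
    exact le_add_of_nonneg_left (posPart_nonneg f)

end

section

/-! ### The transport equation -/

/-- Assumptions on the transport coefficient and the fragmentation rate. -/
structure IsTransport (r a : ℝ → ℝ) (r₀ a₀ p : ℝ) : Prop where
  continuousOn : ContinuousOn r (Ioi 0)
  bound : ∀ x, 0 < x → 0 < r x ∧ r x ≤ r₀ * (1 + x)
  zero : ∃ δ > 0, IntegrableOn (fun s => 1 / r s) (Ioo 0 δ)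
  pos : 0 < p
  measurable : Measurable a
  rate : ∀ x, 0 < x → 0 ≤ a x ∧ a x ≤ a₀ * (1 + x ^ p)

/-- `exp (-ν R(x) - Q(x))`. -/
def decay (r a : ℝ → ℝ) (ν x : ℝ) : ℝ := Real.exp (-ν * bigR r x - bigQ r a x)

theorem decay_pos (r a : ℝ → ℝ) (ν x : ℝ) : 0 < decay r a ν x := Real.exp_pos _

theorem eFun_eq (r a : ℝ → ℝ) (ν x : ℝ) : eFun r a ν x = decay r a ν x / r x := rfl

namespace IsTransport

variable {r a : ℝ → ℝ} {r₀ a₀ p : ℝ}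

theorem r₀_pos (h : IsTransport r a r₀ a₀ p) : 0 < r₀ := by
  have := h.bound 1 one_pos
  linarith [this.1, this.2]

theorem a₀_nonneg (h : IsTransport r a r₀ a₀ p) : 0 ≤ a₀ := by
  have := h.rate 1 one_pos
  rw [Real.one_rpow] at this
  linarith [this.1, this.2]

theorem continuousOn_inv (h : IsTransport r a r₀ a₀ p) : ContinuousOn (fun s => 1 / r s) (Ioi 0) :=
  continuousOn_const.div h.continuousOn fun x hx => (h.bound x hx).1.ne'

theorem intervalIntegrable_inv (h : IsTransport r a r₀ a₀ p) {x : ℝ} (hx : 0 ≤ x) :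
    IntervalIntegrable (fun s => 1 / r s) volume 0 x := by
  obtain ⟨δ, hδ, hi⟩ := h.zero
  have h1 : IntervalIntegrable (fun s => 1 / r s) volume 0 (δ / 2) := by
    rw [intervalIntegrable_iff_integrableOn_Ioc_of_le (by positivity)]
    exact hi.mono_set fun s hs => ⟨hs.1, by linarith [hs.2]⟩
  have h2 : IntervalIntegrable (fun s => 1 / r s) volume (δ / 2) (max x (δ / 2)) := by
    refine (h.continuousOn_inv.mono ?_).intervalIntegrable
    rw [uIcc_of_le (le_max_right _ _)]
    exact fun s hs => lt_of_lt_of_le (by positivity) hs.1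
  refine (h1.trans h2).mono_set ?_
  rw [uIcc_of_le hx, uIcc_of_le (hx.trans (le_max_left _ _))]
  exact Icc_subset_Icc_right (le_max_left _ _)

theorem aestronglyMeasurable_inv (h : IsTransport r a r₀ a₀ p) :
    AEStronglyMeasurable (fun s => 1 / r s) lebPos :=
  h.continuousOn_inv.aestronglyMeasurable measurableSet_Ioi

theorem rate_le (h : IsTransport r a r₀ a₀ p) {s x : ℝ} (hs : 0 < s) (hsx : s ≤ x) :
    a s ≤ a₀ * (1 + x ^ p) := by
  refine (h.rate s hs).2.trans ?_
  have := h.a₀_nonneg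
  have := h.pos
  gcongr

theorem intervalIntegrable_rate (h : IsTransport r a r₀ a₀ p) {x : ℝ} (hx : 0 ≤ x) :
    IntervalIntegrable (fun s => a s / r s) volume 0 x := by
  have h1 := h.intervalIntegrable_inv hx
  rw [intervalIntegrable_iff_integrableOn_Ioc_of_le hx] at h1 ⊢
  refine (h1.const_mul (a₀ * (1 + x ^ p))).mono ?_ ?_
  · simp_rw [div_eq_mul_one_div (a _)]
    exact h.measurable.aestronglyMeasurable.mul h1.aestronglyMeasurable
  · refine (ae_restrict_mem measurableSet_Ioc).mono fun s hs => ?_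
    have hr := (h.bound s hs.1).1
    have ha := h.rate s hs.1
    have hle := h.rate_le hs.1 hs.2
    rw [div_eq_mul_one_div, norm_mul, norm_mul, Real.norm_of_nonneg ha.1,
      Real.norm_of_nonneg (ha.1.trans hle)]
    gcongr

theorem isPrimitive_bigR (h : IsTransport r a r₀ a₀ p) :
    IsPrimitive (bigR r) (fun s => 1 / r s) where
  intervalIntegrable _ hx := h.intervalIntegrable_inv hx
  eq_integral x hx := by
    rw [intervalIntegral.integral_of_le hx, integral_Ioc_eq_integral_Ioo]
    simp [bigR]

theorem isPrimitive_bigQ (h : IsTransport r a r₀ a₀ p) :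
    IsPrimitive (bigQ r a) (fun s => a s / r s) where
  intervalIntegrable _ hx := h.intervalIntegrable_rate hx
  eq_integral x hx := by
    rw [intervalIntegral.integral_of_le hx, integral_Ioc_eq_integral_Ioo]
    simp [bigQ]

theorem isPrimitive_exponent (h : IsTransport r a r₀ a₀ p) (c d : ℝ) :
    IsPrimitive (fun x => c * bigR r x + d * bigQ r a x) (fun s => c * (1 / r s) + d * (a s / r s)) where
  intervalIntegrable x hx := ((h.intervalIntegrable_inv hx).const_mul c).add
    ((h.intervalIntegrable_rate hx).const_mul d)
  eq_integral x hx := by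
    rw [intervalIntegral.integral_add ((h.intervalIntegrable_inv hx).const_mul c)
      ((h.intervalIntegrable_rate hx).const_mul d), intervalIntegral.integral_const_mul,
      intervalIntegral.integral_const_mul, h.isPrimitive_bigR.eq_integral x hx,
      h.isPrimitive_bigQ.eq_integral x hx]
    ring

theorem isPrimitive_decay (h : IsTransport r a r₀ a₀ p) (ν : ℝ) :
    IsPrimitive (decay r a ν) (fun x => -((ν + a x) / r x) * decay r a ν x) := by
  have h1 := (h.isPrimitive_exponent (-ν) (-1)).exp
  have e1 : (fun x => Real.exp (-ν * bigR r x + -1 * bigQ r a x)) = decay r a ν := by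
    funext x
    rw [decay]; ring_nf
  rw [e1] at h1
  convert h1 using 1
  funext x
  rw [← congrFun e1 x]
  ring

theorem isPrimitive_decay_inv (h : IsTransport r a r₀ a₀ p) (ν : ℝ) :
    IsPrimitive (fun x => (decay r a ν x)⁻¹) (fun x => (ν + a x) / r x * (decay r a ν x)⁻¹) := by
  have h1 := (h.isPrimitive_exponent ν 1).exp
  have e1 : (fun x => Real.exp (ν * bigR r x + 1 * bigQ r a x)) = fun x => (decay r a ν x)⁻¹ := by
    funext x
    rw [decay, ← Real.exp_neg]; ring_nf
  rw [e1] at h1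
  convert h1 using 1
  funext x
  rw [← congrFun e1 x]
  ring

theorem continuousOn_decay (h : IsTransport r a r₀ a₀ p) (ν : ℝ) :
    ContinuousOn (decay r a ν) (Ici 0) := (h.isPrimitive_decay ν).continuousOn

@[simp] theorem decay_zero (r a : ℝ → ℝ) (ν : ℝ) : decay r a ν 0 = 1 := by
  simp [decay, bigR, bigQ]

theorem eFun_nonneg (h : IsTransport r a r₀ a₀ p) (ν : ℝ) {x : ℝ} (hx : 0 < x) :
    0 ≤ eFun r a ν x :=
  div_nonneg (decay_pos _ _ _ _).le (h.bound x hx).1.le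

theorem aestronglyMeasurable_decay (h : IsTransport r a r₀ a₀ p) (ν : ℝ) :
    AEStronglyMeasurable (decay r a ν) lebPos :=
  ((h.continuousOn_decay ν).mono Ioi_subset_Ici_self).aestronglyMeasurable measurableSet_Ioi

theorem aestronglyMeasurable_eFun (h : IsTransport r a r₀ a₀ p) (ν : ℝ) :
    AEStronglyMeasurable (eFun r a ν) lebPos := by
  refine ((h.aestronglyMeasurable_decay ν).mul h.aestronglyMeasurable_inv).congr
    (Eventually.of_forall fun x => ?_)
  simp only [Pi.mul_apply, eFun_eq]
  ring

/-- `(1 + x ^ m)' = m x ^ (m - 1)`. -/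
theorem _root_.GrowthFrag.isPrimitive_wt {m : ℝ} (hm : 1 < m) :
    IsPrimitive (wt m) (fun x => m * x ^ (m - 1)) := by
  refine IsPrimitive.of_hasDerivAt (fun x _ => ?_) ?_
  · exact (Real.hasDerivAt_rpow_const (Or.inr hm.le)).const_add 1
  · exact (continuous_const.mul (Real.continuous_rpow_const (by linarith))).continuousOn

theorem _root_.GrowthFrag.rpow_sub_one_mul_le {m : ℝ} (hm : 1 < m) {x : ℝ} (hx : 0 < x) :
    x ^ (m - 1) * (1 + x) ≤ 2 * wt m x := by
  have e : x ^ (m - 1) * x = x ^ m := by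
    rw [← Real.rpow_add_one hx.ne', sub_add_cancel]
  have h1 : x ^ (m - 1) ≤ 1 + x ^ m := by
    rcases le_total x 1 with h | h
    · have := Real.rpow_le_one hx.le h (show 0 ≤ m - 1 by linarith)
      have := Real.rpow_pos_of_pos hx m
      linarith
    · have := Real.rpow_le_rpow_of_exponent_le h (show m - 1 ≤ m by linarith)
      linarith
  rw [mul_add, mul_one, e, wt]
  have := Real.rpow_pos_of_pos hx m
  linarith

/-- The rate at which transport can increase the weight; it is the source of the threshold `2 m r₀`
for the spectral parameter. -/
theorem wt_deriv_mul_le (h : IsTransport r a r₀ a₀ p) {m : ℝ} (hm : 1 < m) {x : ℝ} (hx : 0 < x) :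
    m * x ^ (m - 1) * r x ≤ 2 * m * r₀ * wt m x := by
  have h1 := rpow_sub_one_mul_le hm hx
  have h2 := (h.bound x hx).2
  have h3 := h.r₀_pos
  calc m * x ^ (m - 1) * r x ≤ m * x ^ (m - 1) * (r₀ * (1 + x)) := by
        have := Real.rpow_pos_of_pos hx (m - 1)
        gcongr
    _ = m * r₀ * (x ^ (m - 1) * (1 + x)) := by ring
    _ ≤ m * r₀ * (2 * wt m x) := by gcongr
    _ = _ := by ring

/-- The derivative of `wt m * decay` is `(m x^(m-1) r - (ν + a) wt) e_ν`, hence at most `-wt (ν - 2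
m r₀ + a) e_ν` by `wt_deriv_mul_le`. Integrating and dropping the nonnegative value at `N` gives the
bound. Keeping `a` inside the integral makes it serve the loss term as well. -/
theorem setLIntegral_Ioc_le (h : IsTransport r a r₀ a₀ p) {m ν : ℝ} (hm : 1 < m)
    (hν : 2 * m * r₀ ≤ ν) {y N : ℝ} (hy : 0 ≤ y) (hyN : y ≤ N) :
    ∫⁻ x in Ioc y N, ENNReal.ofReal (wt m x * ((ν - 2 * m * r₀ + a x) * eFun r a ν x)) ≤
      ENNReal.ofReal (wt m y * decay r a ν y) := by
  have hN : 0 ≤ N := hy.trans hyN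
  set d : ℝ → ℝ := fun x => m * x ^ (m - 1) * decay r a ν x +
    wt m x * (-((ν + a x) / r x) * decay r a ν x) with hd
  have hprim : IsPrimitive (fun x => wt m x * decay r a ν x) d :=
    (isPrimitive_wt hm).mul (h.isPrimitive_decay ν)
  have hsubset : uIcc 0 N ⊆ Ici 0 := by
    rw [uIcc_of_le hN]; exact Icc_subset_Ici_self
  have hsub2 : uIcc y N ⊆ uIcc 0 N := by
    rw [uIcc_of_le hN, uIcc_of_le hyN]; exact Icc_subset_Icc_left hy
  have hcont : ContinuousOn (fun x => wt m x * decay r a ν x) (uIcc 0 N) :=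
    hprim.continuousOn.mono hsubset
  set F : ℝ → ℝ := fun x => wt m x * ((ν - 2 * m * r₀ + a x) * eFun r a ν x) with hF
  have hFi : IntervalIntegrable F volume 0 N := by
    have h1 := ((h.intervalIntegrable_inv hN).mul_continuousOn hcont).const_mul (ν - 2 * m * r₀)
    have h2 := (h.intervalIntegrable_rate hN).mul_continuousOn hcont
    refine (h1.add h2).congr fun x _ => ?_
    simp only [hF, eFun_eq]
    ring
  have hdi := hprim.intervalIntegrable N hN
  have hF0 : ∀ x, 0 < x → 0 ≤ F x := fun x hx =>
    mul_nonneg (wt_pos m hx).le (mul_nonneg (by linarith [(h.rate x hx).1]) (h.eFun_nonneg ν hx))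
  have hle : ∫ x in y..N, F x ≤ wt m y * decay r a ν y := by
    have h1 := hprim.sub_eq hy hN
    have h2 : ∫ x in y..N, F x ≤ ∫ x in y..N, -d x := by
      refine intervalIntegral.integral_mono_on_of_le_Ioo hyN (hFi.mono_set hsub2)
        (hdi.mono_set hsub2).neg fun x hx => ?_
      have hx0 : 0 < x := hy.trans_lt hx.1
      have hr := (h.bound x hx0).1
      have h3 := mul_le_mul_of_nonneg_right (h.wt_deriv_mul_le hm hx0) (h.eFun_nonneg ν hx0)
      have e1 : decay r a ν x = r x * eFun r a ν x := by
        rw [eFun_eq]; field_simp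
      have e2 : (ν + a x) / r x * decay r a ν x = (ν + a x) * eFun r a ν x := by
        rw [eFun_eq]; ring
      simp only [hd, hF]
      rw [neg_mul, e2, e1]
      nlinarith
    rw [intervalIntegral.integral_neg, ← h1] at h2
    have h3 : 0 ≤ wt m N * decay r a ν N := by
      have : 0 ≤ wt m N := by
        have := Real.rpow_nonneg hN m
        unfold wt; linarith
      exact mul_nonneg this (decay_pos _ _ _ _).le
    linarith
  have hFi' : IntegrableOn F (Ioc y N) :=
    (intervalIntegrable_iff_integrableOn_Ioc_of_le hyN).1 (hFi.mono_set hsub2)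
  rw [← ofReal_integral_eq_lintegral_ofReal hFi', ← intervalIntegral.integral_of_le hyN]
  · exact ENNReal.ofReal_le_ofReal hle
  · exact (ae_restrict_mem measurableSet_Ioc).mono fun x hx => hF0 x (hy.trans_lt hx.1)

theorem setLIntegral_Ioi_le (h : IsTransport r a r₀ a₀ p) {m ν : ℝ} (hm : 1 < m)
    (hν : 2 * m * r₀ ≤ ν) {y : ℝ} (hy : 0 ≤ y) :
    ∫⁻ x in Ioi y, ENNReal.ofReal (wt m x * ((ν - 2 * m * r₀ + a x) * eFun r a ν x)) ≤
      ENNReal.ofReal (wt m y * decay r a ν y) := by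
  have hU : ⋃ n : ℕ, Ioc y n = Ioi y := by
    ext x
    simp only [mem_iUnion, mem_Ioc, mem_Ioi]
    refine ⟨fun ⟨n, hn⟩ => hn.1, fun hx => ?_⟩
    obtain ⟨n, hn⟩ := exists_nat_ge x
    exact ⟨n, hx, hn⟩
  have hdir : Directed (· ⊆ ·) fun n : ℕ => Ioc y (n : ℝ) := by
    refine Monotone.directed_le fun i j hij => ?_
    exact Ioc_subset_Ioc_right (by exact_mod_cast hij)
  rw [← hU, setLIntegral_iUnion_of_directed _ hdir]
  refine iSup_le fun n => ?_
  rcases le_total y n with hn | hn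
  · exact h.setLIntegral_Ioc_le hm hν hy hn
  · rw [Ioc_eq_empty (not_lt.2 hn)]
    simp

end IsTransport

end

/-! ### The resolvent of transport with zero boundary value -/

section

variable {m : ℝ}

theorem dualBound_const (m c : ℝ) : DualBound m (fun _ => c) |c| where
  meas := aestronglyMeasurable_const
  nonneg := abs_nonneg c
  le := by
    filter_upwards [ae_lebPos_pos] with x hx
    exact le_mul_of_one_le_right (abs_nonneg c) (one_le_wt m hx)

theorem X_integrable_lebPos (u : X m) : Integrable u lebPos := by
  simpa using (dualBound_const m 1).integrable u

theorem X_intervalIntegrable (u : X m) {x : ℝ} (hx : 0 ≤ x) : IntervalIntegrable u volume 0 x := by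
  rw [intervalIntegrable_iff_integrableOn_Ioc_of_le hx]
  exact (show IntegrableOn u (Ioi 0) volume from X_integrable_lebPos u).mono_set Ioc_subset_Ioi_self

theorem lebPos_restrict_Ioi {y : ℝ} (hy : 0 ≤ y) :
    lebPos.restrict (Ioi y) = volume.restrict (Ioi y) := by
  rw [lebPos, Measure.restrict_restrict measurableSet_Ioi,
    inter_eq_left.2 (Ioi_subset_Ioi hy)]

theorem lebPos_restrict_Iio {x : ℝ} :
    lebPos.restrict (Iio x) = volume.restrict (Ioo 0 x) := by
  rw [lebPos, Measure.restrict_restrict measurableSet_Iio, inter_comm, Ioi_inter_Iio]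

/-- The domain of `Z_{β,m}` in terms of primitives. -/
theorem memDomZ_iff {r a β : ℝ → ℝ} {u g : X m} :
    MemDomZ r a β m u g ↔ Integrable (fun x => a x * u x) (weightedMeasure m) ∧
      ∃ G : ℝ → ℝ, IsPrimitive G g ∧ G 0 = pairing β u ∧ (fun x => r x * u x) =ᵐ[lebPos] G := by
  -- The weight is at least `1`, so `g` is integrable up to `0` and `r u` has an absolutely
  -- continuous representative on `[0, ∞)`.
  have hg : ∀ x, 0 ≤ x → IntervalIntegrable g volume 0 x := fun x hx => X_intervalIntegrable g hx
  have hlim : ∀ {G : ℝ → ℝ}, IsPrimitive G g → Tendsto G (𝓝[>] 0) (𝓝 (G 0)) := fun hG =>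
    (hG.continuousOn 0 self_mem_Ici).mono_left (nhdsWithin_mono _ Ioi_subset_Ici_self)
  constructor
  · rintro ⟨h1, h2, w, hw, hwae, hw0⟩
    obtain ⟨G, hG, hae⟩ := h1.exists_isPrimitive hg
    have heq : EqOn w G (Ioi 0) := Measure.eqOn_open_of_ae_eq (μ := volume)
      (hwae.trans hae) isOpen_Ioi hw (hG.continuousOn.mono Ioi_subset_Ici_self)
    refine ⟨h2, G, hG, tendsto_nhds_unique (hlim hG) (hw0.congr' ?_), hae⟩
    filter_upwards [self_mem_nhdsWithin] with x hx using heq hx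
  · rintro ⟨h2, G, hG, h0, hae⟩
    exact ⟨hG.hasDistribDeriv.congr hae.symm EventuallyEq.rfl, h2, G,
      hG.continuousOn.mono Ioi_subset_Ici_self, hae.symm, h0 ▸ hlim hG⟩

namespace IsTransport

variable {r a : ℝ → ℝ} {r₀ a₀ p ν : ℝ}

/-- The kernel of `ρ R(ν, Z₀)`. -/
def kernel (r a ρ : ℝ → ℝ) (ν x y : ℝ) : ℝ :=
  if y < x then ρ x * eFun r a ν x * (decay r a ν y)⁻¹ else 0

theorem setLIntegral_mul_eFun_le (h : IsTransport r a r₀ a₀ p) (hm : 1 < m)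
    (hν : 2 * m * r₀ < ν) {ρ : ℝ → ℝ} {K : ℝ} (hK : 0 ≤ K)
    (hρ : ∀ x, 0 < x → 0 ≤ ρ x ∧ ρ x ≤ K * (ν - 2 * m * r₀ + a x)) {y : ℝ} (hy : 0 ≤ y) :
    ∫⁻ x in Ioi y, ENNReal.ofReal (wt m x * (ρ x * eFun r a ν x)) ≤
      ENNReal.ofReal (K * (wt m y * decay r a ν y)) := by
  rw [ENNReal.ofReal_mul hK]
  refine le_trans ?_ (mul_le_mul_right (h.setLIntegral_Ioi_le hm hν.le hy) _)
  rw [← lintegral_const_mul' _ _ ENNReal.ofReal_ne_top]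
  refine setLIntegral_mono_ae' measurableSet_Ioi (Eventually.of_forall fun x hx => ?_)
  have hx0 : 0 < x := hy.trans_lt hx
  rw [← ENNReal.ofReal_mul hK]
  refine ENNReal.ofReal_le_ofReal ?_
  have h1 := wt_pos m hx0
  have h2 := h.eFun_nonneg ν hx0
  calc wt m x * (ρ x * eFun r a ν x)
      ≤ wt m x * (K * (ν - 2 * m * r₀ + a x) * eFun r a ν x) := by
        gcongr
        exact (hρ x hx0).2
    _ = _ := by ring

/-- Used with `ρ = 1` for the resolvent and with `ρ = a` for the loss term: multiplication by `a` is
unbounded, but its product with the resolvent is bounded by one. -/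
theorem isKernel (h : IsTransport r a r₀ a₀ p) (hm : 1 < m) (hν : 2 * m * r₀ < ν)
    {ρ : ℝ → ℝ} (hρm : Measurable ρ) {K : ℝ} (hK : 0 ≤ K)
    (hρ : ∀ x, 0 < x → 0 ≤ ρ x ∧ ρ x ≤ K * (ν - 2 * m * r₀ + a x)) :
    IsKernel m (kernel r a ρ ν) (fun y => K * wt m y) K where
  meas := by
    have h1 : AEStronglyMeasurable (fun z : ℝ × ℝ => ρ z.1 * eFun r a ν z.1 * (decay r a ν z.2)⁻¹)
        (lebPos.prod lebPos) :=
      (hρm.aestronglyMeasurable.mul (h.aestronglyMeasurable_eFun ν)).comp_fst.mul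
        (h.aestronglyMeasurable_decay ν).aemeasurable.inv.aestronglyMeasurable.comp_snd
    exact (h1.indicator (measurableSet_lt measurable_snd measurable_fst)).congr
      (Eventually.of_forall fun z => by simp [indicator, Function.uncurry, kernel])
  nonneg x y hx _ := by
    unfold kernel
    split_ifs
    · have := (hρ x hx).1
      have := h.eFun_nonneg ν hx
      have := (decay_pos r a ν y).le
      positivity
    · exact le_rfl
  lintegral_le y hy := by
    have hd := decay_pos r a ν y
    calc ∫⁻ x, ENNReal.ofReal (wt m x * kernel r a ρ ν x y) ∂lebPos
        = ∫⁻ x, (Ioi y).indicator (fun x => ENNReal.ofReal (decay r a ν y)⁻¹ *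
            ENNReal.ofReal (wt m x * (ρ x * eFun r a ν x))) x ∂lebPos := by
          refine lintegral_congr fun x => ?_
          by_cases hx : y < x
          · rw [indicator_of_mem (show x ∈ Ioi y from hx), kernel, if_pos hx,
              ← ENNReal.ofReal_mul (inv_nonneg.2 hd.le)]
            congr 1
            ring
          · rw [indicator_of_notMem (show x ∉ Ioi y from hx), kernel, if_neg hx]
            simp
      _ = ENNReal.ofReal (decay r a ν y)⁻¹ *
            ∫⁻ x in Ioi y, ENNReal.ofReal (wt m x * (ρ x * eFun r a ν x)) := by
          rw [lintegral_indicator measurableSet_Ioi, lebPos_restrict_Ioi hy.le,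
            lintegral_const_mul' _ _ ENNReal.ofReal_ne_top]
      _ ≤ ENNReal.ofReal (decay r a ν y)⁻¹ * ENNReal.ofReal (K * (wt m y * decay r a ν y)) := by
          gcongr
          exact h.setLIntegral_mul_eFun_le hm hν hK hρ hy.le
      _ = ENNReal.ofReal (K * wt m y) := by
          rw [← ENNReal.ofReal_mul (inv_nonneg.2 hd.le)]
          congr 1
          field_simp
  bound :=
    { meas := ((measurable_wt m).const_mul K).aestronglyMeasurable
      nonneg := hK
      le := by
        filter_upwards [ae_lebPos_pos] with x hx
        rw [abs_of_nonneg (mul_nonneg hK (wt_pos m hx).le)] }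

theorem integrable_mul_eFun (h : IsTransport r a r₀ a₀ p) (hm : 1 < m) (hν : 2 * m * r₀ < ν)
    {ρ : ℝ → ℝ} (hρm : Measurable ρ) {K : ℝ} (hK : 0 ≤ K)
    (hρ : ∀ x, 0 < x → 0 ≤ ρ x ∧ ρ x ≤ K * (ν - 2 * m * r₀ + a x)) :
    Integrable (fun x => ρ x * eFun r a ν x) (weightedMeasure m) ∧
      ∫ x, wt m x * (ρ x * eFun r a ν x) ∂lebPos ≤ K := by
  have hle := h.setLIntegral_mul_eFun_le hm hν hK hρ le_rfl
  have hw0 : wt m 0 = 1 := by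
    rw [wt, Real.zero_rpow (by linarith), add_zero]
  rw [decay_zero, hw0, one_mul, mul_one] at hle
  have hnn : 0 ≤ᵐ[lebPos] fun x => wt m x * (ρ x * eFun r a ν x) := by
    filter_upwards [ae_lebPos_pos] with x hx
    exact mul_nonneg (wt_pos m hx).le (mul_nonneg (hρ x hx).1 (h.eFun_nonneg ν hx))
  have hmeas : AEStronglyMeasurable (fun x => wt m x * (ρ x * eFun r a ν x)) lebPos :=
    (measurable_wt m).aestronglyMeasurable.mul
      (hρm.aestronglyMeasurable.mul (h.aestronglyMeasurable_eFun ν))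
  have hint : Integrable (fun x => wt m x * (ρ x * eFun r a ν x)) lebPos := by
    refine ⟨hmeas, ?_⟩
    rw [hasFiniteIntegral_iff_ofReal hnn]
    exact hle.trans_lt ENNReal.ofReal_lt_top
  refine ⟨integrable_weightedMeasure_iff.2 hint, ?_⟩
  rw [← ENNReal.ofReal_le_ofReal_iff hK, ofReal_integral_eq_lintegral_ofReal hint hnn]
  exact hle

theorem one_bound (h : IsTransport r a r₀ a₀ p) (hν : 2 * m * r₀ < ν) : ∀ x : ℝ, 0 < x →
    0 ≤ (fun _ : ℝ => (1 : ℝ)) x ∧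
      (fun _ : ℝ => (1 : ℝ)) x ≤ (ν - 2 * m * r₀)⁻¹ * (ν - 2 * m * r₀ + a x) := fun x hx => by
  have h1 : 0 < ν - 2 * m * r₀ := sub_pos.2 hν
  refine ⟨zero_le_one, ?_⟩
  rw [← div_eq_inv_mul, le_div_iff₀ h1]
  linarith [(h.rate x hx).1]

theorem rate_bound (h : IsTransport r a r₀ a₀ p) (hν : 2 * m * r₀ < ν) : ∀ x : ℝ, 0 < x →
    0 ≤ a x ∧ a x ≤ 1 * (ν - 2 * m * r₀ + a x) := fun x hx =>
  ⟨(h.rate x hx).1, by linarith⟩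

/-- The resolvent of `Z₀`. -/
def res (h : IsTransport r a r₀ a₀ p) (hm : 1 < m) (hν : 2 * m * r₀ < ν) : X m →L[ℝ] X m :=
  (h.isKernel hm hν measurable_const (inv_nonneg.2 (sub_pos.2 hν).le) (h.one_bound hν)).clm

/-- The product of the fragmentation rate and the resolvent of `Z₀`. -/
def rateRes (h : IsTransport r a r₀ a₀ p) (hm : 1 < m) (hν : 2 * m * r₀ < ν) : X m →L[ℝ] X m :=
  (h.isKernel hm hν h.measurable zero_le_one (h.rate_bound hν)).clm

theorem integral_kernel (ρ : ℝ → ℝ) (f : ℝ → ℝ) {x : ℝ} (hx : 0 < x) :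
    ∫ y, kernel r a ρ ν x y * f y ∂lebPos =
      ρ x * eFun r a ν x * ∫ y in (0 : ℝ)..x, f y * (decay r a ν y)⁻¹ := by
  rw [intervalIntegral.integral_of_le hx.le, integral_Ioc_eq_integral_Ioo, ← lebPos_restrict_Iio,
    ← integral_indicator measurableSet_Iio, ← integral_const_mul]
  refine integral_congr_ae (Eventually.of_forall fun y => ?_)
  by_cases hy : y < x
  · simp only [kernel, if_pos hy, indicator_of_mem (show y ∈ Iio x from hy)]
    ring
  · simp only [kernel, if_neg hy, indicator_of_notMem (show y ∉ Iio x from hy)]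
    ring

theorem res_ae (h : IsTransport r a r₀ a₀ p) (hm : 1 < m) (hν : 2 * m * r₀ < ν) (f : X m) :
    h.res hm hν f =ᵐ[lebPos]
      fun x => eFun r a ν x * ∫ y in (0 : ℝ)..x, f y * (decay r a ν y)⁻¹ := by
  filter_upwards [IsKernel.clm_ae (h.isKernel hm hν measurable_const
    (inv_nonneg.2 (sub_pos.2 hν).le) (h.one_bound hν)) f, ae_lebPos_pos] with x hx hx0
  rw [res, hx, integral_kernel _ _ hx0, one_mul]

theorem rateRes_ae (h : IsTransport r a r₀ a₀ p) (hm : 1 < m) (hν : 2 * m * r₀ < ν) (f : X m) :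
    h.rateRes hm hν f =ᵐ[lebPos] fun x => a x * h.res hm hν f x := by
  filter_upwards [IsKernel.clm_ae (h.isKernel hm hν h.measurable zero_le_one
    (h.rate_bound hν)) f, h.res_ae hm hν f, ae_lebPos_pos] with x hx hx' hx0
  rw [rateRes, hx, integral_kernel _ _ hx0, hx', mul_assoc]

theorem res_nonneg (h : IsTransport r a r₀ a₀ p) (hm : 1 < m) (hν : 2 * m * r₀ < ν) {f : X m}
    (hf : 0 ≤ f) : 0 ≤ h.res hm hν f :=
  IsKernel.clm_nonneg _ hf

theorem integrable_eFun (h : IsTransport r a r₀ a₀ p) (hm : 1 < m) (hν : 2 * m * r₀ < ν) :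
    Integrable (eFun r a ν) (weightedMeasure m) := by
  simpa using (h.integrable_mul_eFun hm hν measurable_const (inv_nonneg.2 (sub_pos.2 hν).le)
    (h.one_bound hν)).1

theorem integrable_rate_mul_eFun (h : IsTransport r a r₀ a₀ p) (hm : 1 < m)
    (hν : 2 * m * r₀ < ν) : Integrable (fun x => a x * eFun r a ν x) (weightedMeasure m) :=
  (h.integrable_mul_eFun hm hν h.measurable zero_le_one (h.rate_bound hν)).1

/-- `e_ν` as an element of `X m`. -/
def eX (h : IsTransport r a r₀ a₀ p) (hm : 1 < m) (hν : 2 * m * r₀ < ν) : X m :=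
  toX (h.integrable_eFun hm hν)

/-- `a e_ν` as an element of `X m`. -/
def rateEX (h : IsTransport r a r₀ a₀ p) (hm : 1 < m) (hν : 2 * m * r₀ < ν) : X m :=
  toX (h.integrable_rate_mul_eFun hm hν)

theorem eX_ae (h : IsTransport r a r₀ a₀ p) (hm : 1 < m) (hν : 2 * m * r₀ < ν) :
    h.eX hm hν =ᵐ[lebPos] eFun r a ν := toX_ae _

theorem rateEX_ae (h : IsTransport r a r₀ a₀ p) (hm : 1 < m) (hν : 2 * m * r₀ < ν) :
    h.rateEX hm hν =ᵐ[lebPos] fun x => a x * eFun r a ν x := toX_ae _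

theorem eX_nonneg (h : IsTransport r a r₀ a₀ p) (hm : 1 < m) (hν : 2 * m * r₀ < ν) :
    0 ≤ h.eX hm hν := by
  rw [X_nonneg_iff]
  filter_upwards [h.eX_ae hm hν, ae_lebPos_pos] with x hx hx0
  rw [hx]
  exact h.eFun_nonneg ν hx0

theorem norm_eX_le (h : IsTransport r a r₀ a₀ p) (hm : 1 < m) (hν : 2 * m * r₀ < ν) :
    ‖h.eX hm hν‖ ≤ (ν - 2 * m * r₀)⁻¹ := by
  rw [norm_eq_pairing (h.eX_nonneg hm hν), pairing_congr (h.eX_ae hm hν)]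
  simpa [pairing] using (h.integrable_mul_eFun hm hν measurable_const
    (inv_nonneg.2 (sub_pos.2 hν).le) (h.one_bound hν)).2

theorem intervalIntegrable_mul_decay_inv (h : IsTransport r a r₀ a₀ p) (ν : ℝ) (f : X m) {x : ℝ}
    (hx : 0 ≤ x) : IntervalIntegrable (fun y => f y * (decay r a ν y)⁻¹) volume 0 x :=
  (X_intervalIntegrable f hx).mul_continuousOn
    ((h.isPrimitive_decay_inv ν).continuousOn.mono (by
      rw [uIcc_of_le hx]; exact Icc_subset_Ici_self))

/-- The solution of `w' = f - (ν + a) / r * w` with `w 0 = c`. -/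
theorem isPrimitive_solution (h : IsTransport r a r₀ a₀ p) (ν c : ℝ) (f : X m) :
    IsPrimitive (fun x => decay r a ν x * (c + ∫ y in (0 : ℝ)..x, f y * (decay r a ν y)⁻¹))
      (fun x => f x - (ν + a x) / r x *
        (decay r a ν x * (c + ∫ y in (0 : ℝ)..x, f y * (decay r a ν y)⁻¹))) := by
  have h1 := (h.isPrimitive_decay ν).mul (IsPrimitive.of_integral (c := c)
    (fun x hx => h.intervalIntegrable_mul_decay_inv ν f hx))
  convert h1 using 1
  funext x
  have := (decay_pos r a ν x).ne'
  field_simp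
  ring

/-- Uniqueness by the integrating factor: dividing by `decay` leaves a function with derivative `f /
decay`. -/
theorem eq_solution (h : IsTransport r a r₀ a₀ p) {ν : ℝ} {f : X m} {G g : ℝ → ℝ}
    (hG : IsPrimitive G g) (hg : g =ᵐ[lebPos] fun x => f x - (ν + a x) / r x * G x) {x : ℝ}
    (hx : 0 ≤ x) : G x = decay r a ν x * (G 0 + ∫ y in (0 : ℝ)..x, f y * (decay r a ν y)⁻¹) := by
  have h1 := (hG.mul (h.isPrimitive_decay_inv ν)).congr_ae
    (g := fun x => f x * (decay r a ν x)⁻¹) (by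
      filter_upwards [hg] with x hx
      rw [hx]; ring)
  have h2 := h1.eq_integral x hx
  have := (decay_pos r a ν x).ne'
  simp only [decay_zero, inv_one, mul_one] at h2
  rw [← h2]
  field_simp

end IsTransport

end

/-! ### The resolvent of transport with birth at the boundary -/

section

variable {m : ℝ}

/-- Transport with a birth rate `β` dominated by the weight, at a spectral parameter `ν`. -/
structure IsBirth (r a β : ℝ → ℝ) (r₀ a₀ p m C ν : ℝ) : Prop
    extends IsTransport r a r₀ a₀ p where
  one_lt : 1 < m
  birth_bound : DualBound m β C
  birth_nonneg : ∀ᵐ x ∂lebPos, 0 ≤ β x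
  lt : 2 * m * r₀ + C < ν

namespace IsBirth

variable {r a β : ℝ → ℝ} {r₀ a₀ p C ν : ℝ}

theorem lt' (h : IsBirth r a β r₀ a₀ p m C ν) : 2 * m * r₀ < ν := by
  linarith [h.lt, h.birth_bound.nonneg]

/-- `e_ν` as an element of `X m`. -/
def e (h : IsBirth r a β r₀ a₀ p m C ν) : X m := h.toIsTransport.eX h.one_lt h.lt'

/-- `a e_ν` as an element of `X m`. -/
def ae (h : IsBirth r a β r₀ a₀ p m C ν) : X m := h.toIsTransport.rateEX h.one_lt h.lt'

theorem e_ae (h : IsBirth r a β r₀ a₀ p m C ν) : h.e =ᵐ[lebPos] eFun r a ν :=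
  h.toIsTransport.eX_ae _ _

theorem ae_ae (h : IsBirth r a β r₀ a₀ p m C ν) : h.ae =ᵐ[lebPos] fun x => a x * eFun r a ν x :=
  h.toIsTransport.rateEX_ae _ _

theorem e_nonneg (h : IsBirth r a β r₀ a₀ p m C ν) : 0 ≤ h.e := h.toIsTransport.eX_nonneg _ _

/-- The functional `⟨β, ·⟩`. -/
def ψ (h : IsBirth r a β r₀ a₀ p m C ν) : X m →L[ℝ] ℝ := h.birth_bound.clm

theorem ψ_apply (h : IsBirth r a β r₀ a₀ p m C ν) (u : X m) : h.ψ u = pairing β u := rfl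

theorem ψ_e (h : IsBirth r a β r₀ a₀ p m C ν) : h.ψ h.e = pairing β (eFun r a ν) :=
  pairing_congr h.e_ae

theorem ψ_nonneg (h : IsBirth r a β r₀ a₀ p m C ν) {u : X m} (hu : 0 ≤ u) : 0 ≤ h.ψ u :=
  DualBound.pairing_nonneg h.birth_nonneg hu

/-- Here the full threshold enters: the value is at most `C / (ν - 2 m r₀)`, and `ν > 2 m r₀ + C`.
-/
theorem ψ_e_lt_one (h : IsBirth r a β r₀ a₀ p m C ν) : h.ψ h.e < 1 := by
  have h1 : 0 < ν - 2 * m * r₀ := sub_pos.2 h.lt'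
  have h2 := h.birth_bound.abs_pairing_le h.e
  have h3 : ‖h.e‖ ≤ (ν - 2 * m * r₀)⁻¹ := h.toIsTransport.norm_eX_le _ _
  calc h.ψ h.e ≤ C * ‖h.e‖ := (le_abs_self _).trans h2
    _ ≤ C * (ν - 2 * m * r₀)⁻¹ := by
      have := h.birth_bound.nonneg
      gcongr
    _ < 1 := by
      rw [← div_eq_mul_inv, div_lt_one h1]
      linarith [h.lt]

/-- The resolvent of `Z_β` at `ν`. -/
def res (h : IsBirth r a β r₀ a₀ p m C ν) : X m →L[ℝ] X m :=
  h.toIsTransport.res h.one_lt h.lt' +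
    ((1 - h.ψ h.e)⁻¹ • (h.ψ ∘L h.toIsTransport.res h.one_lt h.lt')).smulRight h.e

/-- The fragmentation rate times the resolvent of `Z_β` at `ν`. -/
def rateRes (h : IsBirth r a β r₀ a₀ p m C ν) : X m →L[ℝ] X m :=
  h.toIsTransport.rateRes h.one_lt h.lt' +
    ((1 - h.ψ h.e)⁻¹ • (h.ψ ∘L h.toIsTransport.res h.one_lt h.lt')).smulRight h.ae

theorem res_apply (h : IsBirth r a β r₀ a₀ p m C ν) (f : X m) :
    h.res f = h.toIsTransport.res h.one_lt h.lt' f +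
      ((1 - h.ψ h.e)⁻¹ * h.ψ (h.toIsTransport.res h.one_lt h.lt' f)) • h.e := rfl

theorem rateRes_apply (h : IsBirth r a β r₀ a₀ p m C ν) (f : X m) :
    h.rateRes f = h.toIsTransport.rateRes h.one_lt h.lt' f +
      ((1 - h.ψ h.e)⁻¹ * h.ψ (h.toIsTransport.res h.one_lt h.lt' f)) • h.ae := rfl

theorem coeff_nonneg (h : IsBirth r a β r₀ a₀ p m C ν) {f : X m} (hf : 0 ≤ f) :
    0 ≤ (1 - h.ψ h.e)⁻¹ * h.ψ (h.toIsTransport.res h.one_lt h.lt' f) :=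
  mul_nonneg (inv_nonneg.2 (sub_pos.2 h.ψ_e_lt_one).le)
    (h.ψ_nonneg (h.toIsTransport.res_nonneg _ _ hf))

/-- The multiple of `e` in `res` is the boundary value of `r` times the result, since `r e` is `1`
at `0`. This consistency is the boundary condition. -/
theorem ψ_res (h : IsBirth r a β r₀ a₀ p m C ν) (f : X m) :
    h.ψ (h.res f) = (1 - h.ψ h.e)⁻¹ * h.ψ (h.toIsTransport.res h.one_lt h.lt' f) := by
  have : 1 - h.ψ h.e ≠ 0 := (sub_pos.2 h.ψ_e_lt_one).ne'
  rw [res_apply, map_add, map_smul, smul_eq_mul]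
  field_simp
  ring

theorem res_ae (h : IsBirth r a β r₀ a₀ p m C ν) (f : X m) :
    h.res f =ᵐ[lebPos] fun x => (r x)⁻¹ * (decay r a ν x *
      (h.ψ (h.res f) + ∫ y in (0 : ℝ)..x, f y * (decay r a ν y)⁻¹)) := by
  rw [h.ψ_res, res_apply]
  filter_upwards [X_add (h.toIsTransport.res h.one_lt h.lt' f)
      (((1 - h.ψ h.e)⁻¹ * h.ψ (h.toIsTransport.res h.one_lt h.lt' f)) • h.e),
    X_smul ((1 - h.ψ h.e)⁻¹ * h.ψ (h.toIsTransport.res h.one_lt h.lt' f)) h.e, h.e_ae,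
    h.toIsTransport.res_ae h.one_lt h.lt' f] with x h1 h2 h3 h4
  rw [h1, h2, h3, h4, eFun_eq]
  ring

theorem rateRes_ae (h : IsBirth r a β r₀ a₀ p m C ν) (f : X m) :
    h.rateRes f =ᵐ[lebPos] fun x => a x * h.res f x := by
  rw [res_apply, rateRes_apply]
  filter_upwards [X_add (h.toIsTransport.res h.one_lt h.lt' f)
      (((1 - h.ψ h.e)⁻¹ * h.ψ (h.toIsTransport.res h.one_lt h.lt' f)) • h.e),
    X_add (h.toIsTransport.rateRes h.one_lt h.lt' f)
      (((1 - h.ψ h.e)⁻¹ * h.ψ (h.toIsTransport.res h.one_lt h.lt' f)) • h.ae),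
    X_smul ((1 - h.ψ h.e)⁻¹ * h.ψ (h.toIsTransport.res h.one_lt h.lt' f)) h.e, h.e_ae,
    X_smul ((1 - h.ψ h.e)⁻¹ * h.ψ (h.toIsTransport.res h.one_lt h.lt' f)) h.ae, h.ae_ae,
    h.toIsTransport.rateRes_ae h.one_lt h.lt' f] with x h1 h2 h3 h4 h5 h6 h7
  rw [h1, h2, h3, h4, h5, h6, h7]
  ring

theorem res_nonneg (h : IsBirth r a β r₀ a₀ p m C ν) {f : X m} (hf : 0 ≤ f) : 0 ≤ h.res f := by
  rw [res_apply]
  exact add_nonneg (h.toIsTransport.res_nonneg _ _ hf) (X_smul_nonneg (h.coeff_nonneg hf) h.e_nonneg)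

theorem rateRes_nonneg (h : IsBirth r a β r₀ a₀ p m C ν) {f : X m} (hf : 0 ≤ f) :
    0 ≤ h.rateRes f := by
  rw [X_nonneg_iff]
  filter_upwards [h.rateRes_ae f, X_nonneg_iff.1 (h.res_nonneg hf), ae_lebPos_pos] with x h1 h2 h3
  rw [h1]
  exact mul_nonneg (h.rate x h3).1 h2

theorem memDomZ_res (h : IsBirth r a β r₀ a₀ p m C ν) (f : X m) :
    MemDomZ r a β m (h.res f) (f - ν • h.res f - h.rateRes f) := by
  rw [memDomZ_iff]
  refine ⟨(L1.integrable_coeFn (h.rateRes f)).congr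
    (ae_weightedMeasure_iff.2 (h.rateRes_ae f)), _,
    (h.toIsTransport.isPrimitive_solution ν (h.ψ (h.res f)) f).congr_ae ?_, ?_, ?_⟩
  · filter_upwards [h.res_ae f, X_sub (f - ν • h.res f) (h.rateRes f), X_sub f (ν • h.res f),
      X_smul ν (h.res f), h.rateRes_ae f, ae_lebPos_pos] with x h1 h2 h3 h4 h5 h6
    rw [h2, h3, h4, h5, h1]
    have := (h.bound x h6).1.ne'
    field_simp
    ring
  · simp [ψ_apply]
  · filter_upwards [h.res_ae f, ae_lebPos_pos] with x h1 h6
    rw [h1, mul_inv_cancel_left₀ (h.bound x h6).1.ne']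

/-- An element of the domain solves the ordinary differential equation with initial value `ψ u`, so
it equals the zero-boundary solution plus `ψ u` times `e`. -/
theorem eq_res (h : IsBirth r a β r₀ a₀ p m C ν) {u g A : X m} (hd : MemDomZ r a β m u g)
    (hA : A =ᵐ[lebPos] fun x => a x * u x) : u = h.res (ν • u + g + A) := by
  obtain ⟨_, G, hG, h0, hr⟩ := memDomZ_iff.1 hd
  set f := ν • u + g + A with hf
  have hg : g =ᵐ[lebPos] fun x => f x - (ν + a x) / r x * G x := by
    filter_upwards [hr, hA, X_add (ν • u + g) A, X_add (ν • u) g, X_smul ν u, ae_lebPos_pos]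
      with x h1 h2 h3 h4 h5 h6
    rw [hf, h3, h4, h5, h2, ← h1]
    have := (h.bound x h6).1.ne'
    field_simp
    ring
  have hG' := fun x (hx : 0 ≤ x) => h.toIsTransport.eq_solution hG hg hx
  have hu : u = h.toIsTransport.res h.one_lt h.lt' f + h.ψ u • h.e := X_ext <| by
    filter_upwards [hr, X_add (h.toIsTransport.res h.one_lt h.lt' f) (h.ψ u • h.e),
      X_smul (h.ψ u) h.e, h.e_ae, h.toIsTransport.res_ae h.one_lt h.lt' f, ae_lebPos_pos]
      with x h1 h2 h3 h4 h5 h6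
    have hr0 := (h.bound x h6).1.ne'
    rw [h2, h3, h4, h5, ← mul_right_inj' hr0, h1, hG' x h6.le, h0, eFun_eq, ψ_apply]
    field_simp
    ring
  -- Applying `ψ` to this representation gives a scalar equation for `ψ u`, solvable because `ψ e <
  -- 1`.
  have hc : h.ψ u = (1 - h.ψ h.e)⁻¹ * h.ψ (h.toIsTransport.res h.one_lt h.lt' f) := by
    have hne : 1 - h.ψ h.e ≠ 0 := (sub_pos.2 h.ψ_e_lt_one).ne'
    have := congrArg h.ψ hu
    rw [map_add, map_smul, smul_eq_mul] at this
    rw [eq_inv_mul_iff_mul_eq₀ hne]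
    linarith
  rw [res_apply, ← hc]
  exact hu

end IsBirth

/-! ### Integration by parts on the domain -/

/-- A nonzero limit would make `1 / x` integrable at infinity. This removes the boundary term at
infinity in the integration by parts. -/
theorem not_integrable_of_tendsto {F : ℝ → ℝ} {L : ℝ} (hF : Tendsto F atTop (𝓝 L))
    (hi : Integrable (fun x => F x / (1 + x)) lebPos) : L = 0 := by
  by_contra hL
  have hpos : 0 < |L| := abs_pos.2 hL
  have hev : ∀ᶠ x in atTop, |L| / 2 < |F x| := hF.abs (Ioi_mem_nhds (show |L| / 2 < |L| by linarith))
  obtain ⟨N, hN⟩ := (hev.and (eventually_ge_atTop 1)).exists_forall_of_atTop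
  have hN1 : 1 ≤ N := (hN N le_rfl).2
  refine not_integrableOn_Ioi_inv (a := N) ?_
  have h1 : IntegrableOn (fun x => F x / (1 + x)) (Ioi N) :=
    IntegrableOn.mono_set hi (Ioi_subset_Ioi (by linarith))
  refine (h1.const_mul (4 / |L|)).mono ?_ ?_
  · exact measurable_inv.aestronglyMeasurable
  · refine (ae_restrict_mem measurableSet_Ioi).mono fun x hx => ?_
    have hx1 : 1 ≤ x := hN1.trans (le_of_lt hx)
    have hFx : |L| / 2 < |F x| := (hN x (le_of_lt hx)).1
    rw [norm_mul, norm_div, norm_div, norm_inv]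
    simp only [Real.norm_eq_abs, abs_abs]
    rw [abs_of_nonneg (by linarith : 0 ≤ x), abs_of_nonneg (by linarith : 0 ≤ 1 + x),
      abs_of_pos (by norm_num : (0 : ℝ) < 4)]
    rw [inv_le_iff_one_le_mul₀ (by linarith)]
    have h2 : 4 / |L| * (|F x| / (1 + x)) * x = (4 * |F x| * x) / (|L| * (1 + x)) := by
      field_simp
    rw [h2, one_le_div (by positivity)]
    nlinarith

/-- Integration by parts against a function of the dual space. -/
theorem MemDomZ.pairing_deriv {r a β γ γ' : ℝ → ℝ} {r₀ C C' : ℝ}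
    (hr : ∀ x, 0 < x → 0 < r x ∧ r x ≤ r₀ * (1 + x)) {u g : X m} (hd : MemDomZ r a β m u g)
    (hγ : IsPrimitive γ γ') (hb : DualBound m γ C)
    (hb' : DualBound m (fun x => γ' x * r x) C') :
    pairing γ g = -γ 0 * pairing β u - pairing (fun x => γ' x * r x) u := by
  obtain ⟨_, G, hG, h0, hG'⟩ := memDomZ_iff.1 hd
  have hprod := hγ.mul hG
  have h1 : Integrable (fun x => γ' x * r x * u x) lebPos := hb'.integrable u
  have h2 : Integrable (fun x => γ x * g x) lebPos := hb.integrable g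
  have e1 : (fun x => γ' x * r x * u x) =ᵐ[lebPos] fun x => γ' x * G x := by
    filter_upwards [hG'] with x hx
    rw [← hx]; ring
  have h3 : Integrable (fun x => γ' x * G x + γ x * g x) lebPos := (h1.congr e1).add h2
  have hlim : Tendsto (fun x => γ x * G x) atTop
      (𝓝 (γ 0 * G 0 + ∫ x, (γ' x * G x + γ x * g x) ∂lebPos)) := by
    have := (intervalIntegral_tendsto_integral_Ioi 0 h3 tendsto_id).const_add (γ 0 * G 0)
    refine this.congr' ?_
    filter_upwards [eventually_ge_atTop 0] with x hx using (hprod.eq_integral x hx).symm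
  -- The product `γ G = γ r u` has a limit at infinity, and divided by `1 + x` it is dominated by `C
  -- r₀ wt |u|`, since `r ≤ r₀ (1 + x)`.
  have hzero := not_integrable_of_tendsto hlim <| by
    refine ((X_integrable u).const_mul (C * r₀)).mono ?_ ?_
    · have hGm : AEStronglyMeasurable G lebPos :=
        (hG.continuousOn.mono Ioi_subset_Ici_self).aestronglyMeasurable measurableSet_Ioi
      exact ((hb.meas.mul hGm).aemeasurable.div (by fun_prop)).aestronglyMeasurable
    · filter_upwards [hb.le, hG', ae_lebPos_pos] with x hx1 hx2 hx3
      have hrx := hr x hx3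
      have hw := wt_pos m hx3
      rw [← hx2, norm_div, norm_mul, norm_mul, norm_mul, norm_mul, norm_mul (wt m x), Real.norm_of_nonneg hrx.1.le,
        Real.norm_of_nonneg hw.le, Real.norm_of_nonneg (by linarith : 0 ≤ 1 + x),
        div_le_iff₀ (by linarith)]
      have hr0 : 0 ≤ r₀ := by
        by_contra hneg
        nlinarith [hrx.1, hrx.2]
      rw [Real.norm_of_nonneg hb.nonneg, Real.norm_of_nonneg hr0, Real.norm_eq_abs]
      calc |γ x| * (r x * ‖u x‖) ≤ (C * wt m x) * (r₀ * (1 + x) * ‖u x‖) := by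
            have := hrx.1.le
            have : 0 ≤ C * wt m x := mul_nonneg hb.nonneg hw.le
            gcongr
            exact hrx.2
        _ = _ := by ring
  rw [integral_add (h1.congr e1) h2, ← integral_congr_ae e1, h0] at hzero
  simp only [pairing]
  simp only [pairing] at hzero
  linarith

end

section

/-! ### Moments of the fragmentation kernel and the gain operator -/

/-- Assumptions on the fragmentation kernel. -/
structure IsFragKernel (b : ℝ → ℝ → ℝ) (b₀ l m : ℝ) : Prop where
  l_nonneg : 0 ≤ l
  l_lt : l < m
  one_lt : 1 < m
  meas : Measurable (Function.uncurry b)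
  nonneg : ∀ x y, 0 < x → 0 < y → 0 ≤ b x y
  mass : ∀ y, 0 < y → moment b 1 y = ENNReal.ofReal y
  number : ∀ y, 0 < y → moment b 0 y ≤ ENNReal.ofReal (b₀ * (1 + y ^ l))
  liminf_pos : ∃ m₀ : ℝ, 1 < m₀ ∧ 0 < liminf (fun y => momentDefect b m₀ y / y ^ m₀) atTop

/-- The kernel of the gain operator. -/
def fragKernel (b : ℝ → ℝ → ℝ) (x y : ℝ) : ℝ := if x < y then b x y else 0

/-- For `s ≤ s₀` this is Bernoulli's inequality for the concave power `s / s₀` of `t^s₀`; for `s ≥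
s₀` it is monotonicity in the exponent. -/
theorem rpow_sub_one_le {s s₀ t : ℝ} (hs : 0 < s) (hs₀ : 0 < s₀) (ht : 0 < t) (ht1 : t ≤ 1) :
    t ^ s ≤ 1 - min 1 (s / s₀) + min 1 (s / s₀) * t ^ s₀ := by
  rcases le_total s s₀ with h | h
  · have h1 : s / s₀ ≤ 1 := (div_le_one hs₀).2 h
    rw [min_eq_right h1]
    have h2 := rpow_one_add_le_one_add_mul_self (s := t ^ s₀ - 1)
      (by linarith [Real.rpow_pos_of_pos ht s₀]) (div_nonneg hs.le hs₀.le) h1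
    rw [add_sub_cancel, ← Real.rpow_mul ht.le, mul_div_cancel₀ _ hs₀.ne'] at h2
    linarith
  · rw [min_eq_left ((one_le_div hs₀).2 h)]
    have := Real.rpow_le_rpow_of_exponent_ge ht ht1 h
    linarith

namespace IsFragKernel

variable {b : ℝ → ℝ → ℝ} {b₀ l m : ℝ}

theorem measurable_left (h : IsFragKernel b b₀ l m) (y : ℝ) : Measurable fun x => b x y :=
  h.meas.comp (measurable_id.prodMk measurable_const)

/-- Interpolation of moments between the first and the `m₀`-th. -/
theorem moment_le_interp (h : IsFragKernel b b₀ l m) {s s₀ : ℝ} (hs : 1 < s) (hs₀ : 1 < s₀) {y : ℝ}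
    (hy : 0 < y) {d : ℝ} (hd : 0 ≤ d) (hm₀ : moment b s₀ y ≤ ENNReal.ofReal (d * y ^ s₀)) :
    moment b s y ≤ ENNReal.ofReal
      ((1 - min 1 ((s - 1) / (s₀ - 1)) * (1 - d)) * y ^ s) := by
  set θ := min 1 ((s - 1) / (s₀ - 1)) with hθ
  have hs' : 0 < s - 1 := by linarith
  have hs₀' : 0 < s₀ - 1 := by linarith
  have hθ0 : 0 ≤ θ := le_min zero_le_one (by positivity)
  have hθ1 : θ ≤ 1 := min_le_left _ _
  have hA : 0 ≤ (1 - θ) * y ^ (s - 1) := mul_nonneg (by linarith) (by positivity)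
  have hB : 0 ≤ θ * y ^ (s - s₀) := by positivity
  have hpt : ∀ x ∈ Ioo 0 y, ENNReal.ofReal (x ^ s * b x y) ≤
      ENNReal.ofReal ((1 - θ) * y ^ (s - 1)) * ENNReal.ofReal (x ^ (1 : ℝ) * b x y) +
      ENNReal.ofReal (θ * y ^ (s - s₀)) * ENNReal.ofReal (x ^ s₀ * b x y) := by
    intro x hx
    have hb := h.nonneg x y hx.1 hy
    have hxs : 0 < x ^ s₀ := Real.rpow_pos_of_pos hx.1 _
    rw [← ENNReal.ofReal_mul hA, ← ENNReal.ofReal_mul hB, ← ENNReal.ofReal_add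
      (mul_nonneg hA (by rw [Real.rpow_one]; exact mul_nonneg hx.1.le hb))
      (mul_nonneg hB (mul_nonneg hxs.le hb))]
    refine ENNReal.ofReal_le_ofReal ?_
    -- The scalar inequality at `t = x / y` with exponents `s - 1` and `s₀ - 1` is integrated
    -- against `x b(x, y) dx`, which has mass `y`.
    have h1 := rpow_sub_one_le hs' hs₀' (div_pos hx.1 hy) ((div_le_one hy).2 hx.2.le)
    rw [← hθ, Real.div_rpow hx.1.le hy.le, Real.div_rpow hx.1.le hy.le] at h1
    have ex : ∀ q : ℝ, x ^ q = x ^ (q - 1) * x := fun q => by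
      rw [← Real.rpow_add_one hx.1.ne', sub_add_cancel]
    have ey : y ^ (s - s₀) = y ^ (s - 1) / y ^ (s₀ - 1) := by
      rw [← Real.rpow_sub hy]; ring_nf
    have hys : 0 < y ^ (s - 1) := Real.rpow_pos_of_pos hy _
    rw [div_le_iff₀ hys] at h1
    calc x ^ s * b x y = x ^ (s - 1) * (x * b x y) := by rw [ex s]; ring
      _ ≤ ((1 - θ + θ * (x ^ (s₀ - 1) / y ^ (s₀ - 1))) * y ^ (s - 1)) * (x * b x y) := by
        have := hx.1.le
        gcongr
      _ = _ := by rw [ex s₀, ey, Real.rpow_one]; ring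
  have hmeas : Measurable fun x => ENNReal.ofReal (x ^ (1 : ℝ) * b x y) := by
    have := h.measurable_left y
    fun_prop
  calc moment b s y ≤ ∫⁻ x in Ioo 0 y,
        (ENNReal.ofReal ((1 - θ) * y ^ (s - 1)) * ENNReal.ofReal (x ^ (1 : ℝ) * b x y) +
        ENNReal.ofReal (θ * y ^ (s - s₀)) * ENNReal.ofReal (x ^ s₀ * b x y)) :=
        setLIntegral_mono_ae' measurableSet_Ioo (Eventually.of_forall hpt)
    _ = ENNReal.ofReal ((1 - θ) * y ^ (s - 1)) * moment b 1 y +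
        ENNReal.ofReal (θ * y ^ (s - s₀)) * moment b s₀ y := by
        rw [lintegral_add_left (hmeas.const_mul _), lintegral_const_mul' _ _ ENNReal.ofReal_ne_top,
          lintegral_const_mul' _ _ ENNReal.ofReal_ne_top]
        rfl
    _ ≤ ENNReal.ofReal ((1 - θ) * y ^ (s - 1)) * ENNReal.ofReal y +
        ENNReal.ofReal (θ * y ^ (s - s₀)) * ENNReal.ofReal (d * y ^ s₀) := by
        rw [h.mass y hy]
        gcongr
    _ = _ := by
        rw [← ENNReal.ofReal_mul hA, ← ENNReal.ofReal_mul hB, ← ENNReal.ofReal_add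
          (mul_nonneg hA hy.le) (mul_nonneg hB (by positivity))]
        congr 1
        have e1 : y ^ (s - 1) * y = y ^ s := by
          rw [← Real.rpow_add_one hy.ne', sub_add_cancel]
        have e2 : y ^ (s - s₀) * y ^ s₀ = y ^ s := by
          rw [← Real.rpow_add hy, sub_add_cancel]
        calc _ = (1 - θ) * (y ^ (s - 1) * y) + θ * d * (y ^ (s - s₀) * y ^ s₀) := by ring
          _ = _ := by rw [e1, e2]; ring

theorem moment_le (h : IsFragKernel b b₀ l m) {s : ℝ} (hs : 1 < s) {y : ℝ} (hy : 0 < y) :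
    moment b s y ≤ ENNReal.ofReal (y ^ s) := by
  rw [moment]
  calc ∫⁻ x in Ioo 0 y, ENNReal.ofReal (x ^ s * b x y)
      ≤ ∫⁻ x in Ioo 0 y, ENNReal.ofReal (y ^ (s - 1)) * ENNReal.ofReal (x ^ (1 : ℝ) * b x y) := by
        refine setLIntegral_mono_ae' measurableSet_Ioo (Eventually.of_forall fun x hx => ?_)
        rw [← ENNReal.ofReal_mul (by positivity), Real.rpow_one]
        refine ENNReal.ofReal_le_ofReal ?_
        have ex : x ^ s = x ^ (s - 1) * x := by
          rw [← Real.rpow_add_one hx.1.ne', sub_add_cancel]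
        rw [ex, mul_assoc]
        have := mul_nonneg hx.1.le (h.nonneg x y hx.1 hy)
        have := Real.rpow_le_rpow hx.1.le hx.2.le (show 0 ≤ s - 1 by linarith)
        gcongr
    _ = ENNReal.ofReal (y ^ s) := by
        rw [lintegral_const_mul' _ _ ENNReal.ofReal_ne_top,
          show ∫⁻ x in Ioo 0 y, ENNReal.ofReal (x ^ (1 : ℝ) * b x y) = moment b 1 y from rfl,
          h.mass y hy, ← ENNReal.ofReal_mul (by positivity), ← Real.rpow_add_one hy.ne',
          sub_add_cancel]

theorem exists_moment_le (h : IsFragKernel b b₀ l m) : ∃ c : ℝ, 0 < c ∧ c ≤ 1 ∧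
    ∀ᶠ y in atTop, moment b m y ≤ ENNReal.ofReal ((1 - c) * y ^ m) := by
  obtain ⟨m₀, hm₀, hlim⟩ := h.liminf_pos
  have hev : ∀ᶠ y in atTop, ∃ d : ℝ, d = 1 - min (liminf (fun y => momentDefect b m₀ y / y ^ m₀) atTop / 2) 1 ∧
      moment b m₀ y ≤ ENNReal.ofReal (d * y ^ m₀) := by
    -- Reading eventual lower bounds off a real liminf requires the quotient to be bounded below; it
    -- is nonnegative because moments of order above one do not grow.
    have h1 := eventually_lt_of_lt_liminf (half_lt_self hlim)
      (isBoundedUnder_of_eventually_ge (a := 0) (by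
        filter_upwards [eventually_gt_atTop 0] with y hy
        refine div_nonneg (sub_nonneg.2 ?_) (Real.rpow_nonneg hy.le _)
        exact ENNReal.toReal_le_of_le_ofReal (Real.rpow_nonneg hy.le _) (h.moment_le hm₀ hy)))
    filter_upwards [h1, eventually_gt_atTop 0] with y hy hy0
    refine ⟨_, rfl, ?_⟩
    have hyp : 0 < y ^ m₀ := Real.rpow_pos_of_pos hy0 _
    rw [lt_div_iff₀ hyp, momentDefect] at hy
    -- `momentDefect` uses `toReal`, whose default value at `⊤` has to be excluded.
    have hfin : moment b m₀ y ≠ ⊤ :=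
      ((h.moment_le hm₀ hy0).trans_lt ENNReal.ofReal_lt_top).ne
    rw [← ENNReal.ofReal_toReal hfin]
    refine ENNReal.ofReal_le_ofReal ?_
    have := min_le_left (liminf (fun y => momentDefect b m₀ y / y ^ m₀) atTop / 2) 1
    nlinarith
  set c := min (liminf (fun y => momentDefect b m₀ y / y ^ m₀) atTop / 2) 1 with hc
  set θ := min 1 ((m - 1) / (m₀ - 1)) with hθ
  have hc0 : 0 < c := lt_min (by linarith) one_pos
  have hc1 : c ≤ 1 := min_le_right _ _
  have hθ0 : 0 < θ := lt_min one_pos (div_pos (by linarith [h.one_lt]) (by linarith))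
  have hθ1 : θ ≤ 1 := min_le_left _ _
  refine ⟨θ * c, by positivity, mul_le_one₀ hθ1 hc0.le hc1, ?_⟩
  filter_upwards [hev, eventually_gt_atTop 0] with y ⟨d, hd, hy⟩ hy0
  have := h.moment_le_interp h.one_lt hm₀ hy0 (d := d) (by rw [hd]; linarith) hy
  rwa [hd, sub_sub_cancel] at this

/-- Since `l < m`, the number of fragments is eventually at most half of the defect of the `m`-th
moment. This is why the constant is halved, which also makes it at most `1 / 2`. -/
theorem exists_moment_add_le (h : IsFragKernel b b₀ l m) : ∃ c y₀ C : ℝ, 0 < c ∧ c ≤ 1 / 2 ∧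
    0 < y₀ ∧ 1 ≤ C ∧ (∀ y, 0 < y → moment b 0 y + moment b m y ≤ ENNReal.ofReal (C * wt m y)) ∧
    ∀ y, y₀ < y → moment b 0 y + moment b m y ≤ ENNReal.ofReal ((1 - c) * wt m y) := by
  obtain ⟨c, hc0, hc1, hev⟩ := h.exists_moment_le
  have hnum : ∀ y, 0 < y → moment b 0 y ≤ ENNReal.ofReal (|b₀| * (1 + y ^ l)) := fun y hy => by
    refine (h.number y hy).trans (ENNReal.ofReal_le_ofReal ?_)
    have := Real.rpow_nonneg hy.le l
    gcongr
    exact le_abs_self _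
  have hsmall : ∀ᶠ y : ℝ in atTop, |b₀| * (1 + y ^ l) ≤ c / 2 * y ^ m := by
    have h1 : Tendsto (fun y : ℝ => |b₀| * (2 * y ^ (-(m - l)))) atTop (𝓝 0) := by
      simpa using ((tendsto_rpow_neg_atTop (sub_pos.2 h.l_lt)).const_mul 2).const_mul |b₀|
    filter_upwards [h1 (Iio_mem_nhds (show 0 < c / 2 by positivity)), eventually_ge_atTop 1]
      with y hy hy1
    have hy0 : 0 < y := by linarith
    have e1 : y ^ (-(m - l)) * y ^ m = y ^ l := by
      rw [← Real.rpow_add hy0]; ring_nf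
    have h2 : 1 ≤ y ^ l := Real.one_le_rpow hy1 h.l_nonneg
    have h3 : |b₀| * (2 * y ^ (-(m - l))) < c / 2 := hy
    have h4 : 0 < y ^ m := Real.rpow_pos_of_pos hy0 m
    calc |b₀| * (1 + y ^ l) ≤ |b₀| * (2 * y ^ l) := by gcongr; linarith
      _ = |b₀| * (2 * y ^ (-(m - l))) * y ^ m := by rw [← e1]; ring
      _ ≤ c / 2 * y ^ m := by gcongr
  obtain ⟨y₁, hy₁⟩ := (hev.and hsmall).exists_forall_of_atTop
  refine ⟨c / 2, max y₁ 1, 2 * |b₀| + 1, by positivity, by linarith, by positivity,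
    by linarith [abs_nonneg b₀], fun y hy => ?_, fun y hy => ?_⟩
  · have hyl := Real.rpow_nonneg hy.le l
    have hym := Real.rpow_nonneg hy.le m
    refine (add_le_add (hnum y hy) (h.moment_le h.one_lt hy)).trans ?_
    rw [← ENNReal.ofReal_add (by positivity) hym]
    refine ENNReal.ofReal_le_ofReal ?_
    have h1 : y ^ l ≤ 1 + y ^ m := by
      rcases le_total y 1 with h' | h'
      · have := Real.rpow_le_one hy.le h' h.l_nonneg
        linarith
      · have := Real.rpow_le_rpow_of_exponent_le h' h.l_lt.le
        linarith
    have h2 : 1 + y ^ l ≤ 2 * (1 + y ^ m) := by linarith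
    have := mul_le_mul_of_nonneg_left h2 (abs_nonneg b₀)
    unfold wt
    nlinarith
  · have hy1 : y₁ ≤ y := (le_max_left _ _).trans hy.le
    have hy0 : 0 < y := lt_of_lt_of_le one_pos ((le_max_right _ _).trans hy.le)
    have hyl := Real.rpow_nonneg hy0.le l
    have hym := Real.rpow_nonneg hy0.le m
    obtain ⟨h1, h2⟩ := hy₁ y hy1
    refine (add_le_add (hnum y hy0) h1).trans ?_
    rw [← ENNReal.ofReal_add (by positivity) (mul_nonneg (by linarith) hym)]
    refine ENNReal.ofReal_le_ofReal ?_
    unfold wt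
    nlinarith

/-- The column integral of the weighted kernel is the sum of the moments of orders `0` and `m`. It
is strictly below the weight only for large `y`; on `(0, y₀]`, where `a` is bounded, a crude bound
is enough. -/
theorem exists_isKernel (h : IsFragKernel b b₀ l m) : ∃ c y₀ C : ℝ, 0 < c ∧ c ≤ 1 / 2 ∧ 0 < y₀ ∧
    IsKernel m (fragKernel b) (fun y => if y ≤ y₀ then C * wt m y else (1 - c) * wt m y) C := by
  obtain ⟨c, y₀, C, hc, hc', hy₀, hC, h1, h2⟩ := h.exists_moment_add_le
  refine ⟨c, y₀, C, hc, hc', hy₀, ?_, ?_, ?_, ?_, by linarith, ?_⟩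
  · refine Measurable.aestronglyMeasurable ?_
    exact Measurable.ite (measurableSet_lt measurable_fst measurable_snd) h.meas measurable_const
  · intro x y hx hy
    unfold fragKernel
    split_ifs
    · exact h.nonneg x y hx hy
    · exact le_rfl
  · intro y hy
    have e1 : ∫⁻ x, ENNReal.ofReal (wt m x * fragKernel b x y) ∂lebPos =
        moment b 0 y + moment b m y := by
      have hmeas : Measurable fun x => ENNReal.ofReal (x ^ (0 : ℝ) * b x y) := by
        have := h.measurable_left y
        fun_prop
      rw [moment, moment, ← lintegral_add_left hmeas, ← lebPos_restrict_Iio,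
        ← lintegral_indicator measurableSet_Iio]
      refine lintegral_congr_ae ?_
      filter_upwards [ae_lebPos_pos] with x hx
      by_cases hxy : x < y
      · have hb := h.nonneg x y hx hy
        rw [indicator_of_mem (show x ∈ Iio y from hxy), fragKernel, if_pos hxy,
          ← ENNReal.ofReal_add (by positivity) (by positivity), wt, Real.rpow_zero]
        ring_nf
      · rw [indicator_of_notMem (show x ∉ Iio y from hxy), fragKernel, if_neg hxy]
        simp
    rw [e1]
    split_ifs with hyy
    · exact h1 y hy
    · exact h2 y (not_le.1 hyy)
  · exact (Measurable.ite measurableSet_Iic (by fun_prop) (by fun_prop)).aestronglyMeasurable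
  · filter_upwards [ae_lebPos_pos] with y hy
    have := wt_pos m hy
    split_ifs
    · rw [abs_of_nonneg (by positivity)]
    · rw [abs_of_nonneg (mul_nonneg (by linarith) this.le)]
      gcongr
      linarith

end IsFragKernel

theorem gain_ae {m C : ℝ} {a : ℝ → ℝ} {b : ℝ → ℝ → ℝ} {θ : ℝ → ℝ}
    (hk : IsKernel m (fragKernel b) θ C) {A : X m} {u : ℝ → ℝ}
    (hA : A =ᵐ[lebPos] fun x => a x * u x) : hk.clm A =ᵐ[lebPos] gain a b u := by
  filter_upwards [hk.clm_ae A, ae_lebPos_pos] with x hx hx0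
  rw [hx, gain, ← lebPos_restrict_Ioi hx0.le, ← integral_indicator measurableSet_Ioi]
  refine integral_congr_ae ?_
  filter_upwards [hA] with y hy
  by_cases hxy : x < y
  · rw [indicator_of_mem (show y ∈ Ioi x from hxy), fragKernel, if_pos hxy, hy]
    ring
  · rw [indicator_of_notMem (show y ∉ Ioi x from hxy), fragKernel, if_neg hxy, zero_mul]

end

section

variable {m : ℝ}

/-! ### The resolvent of the growth-fragmentation operator -/

section Neumann

variable {T : X m →L[ℝ] X m}

theorem inverse_one_sub_nonneg (hT : ∀ f, 0 ≤ f → 0 ≤ T f) (h1 : ‖T‖ < 1) {f : X m} (hf : 0 ≤ f) :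
    0 ≤ Ring.inverse (1 - T) f := by
  have hs : HasSum (fun n : ℕ => T ^ n) (Ring.inverse (1 - T)) := by
    rw [NormedRing.inverse_one_sub T h1]
    exact (summable_geometric_of_norm_lt_one h1).hasSum
  have hs' : HasSum (fun n : ℕ => (T ^ n) f) (Ring.inverse (1 - T) f) :=
    hs.mapL (ContinuousLinearMap.apply ℝ (X m) f)
  refine hs'.nonneg fun n => ?_
  induction n with
  | zero => simpa using hf
  | succ n ih =>
    rw [pow_succ']
    exact hT _ ih

theorem isUnit_one_sub_clm (h1 : ‖T‖ < 1) : IsUnit (1 - T) :=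
  isUnit_one_sub_of_norm_lt_one h1

theorem one_sub_apply_inverse (h1 : ‖T‖ < 1) (f : X m) :
    Ring.inverse (1 - T) f - T (Ring.inverse (1 - T) f) = f :=
  DFunLike.congr_fun (Ring.mul_inverse_cancel _ (isUnit_one_sub_clm h1)) f

theorem inverse_apply_one_sub (h1 : ‖T‖ < 1) (f : X m) : Ring.inverse (1 - T) (f - T f) = f :=
  DFunLike.congr_fun (Ring.inverse_mul_cancel _ (isUnit_one_sub_clm h1)) f

end Neumann

/-- The growth-fragmentation model; `θ` dominates the weighted moments of the kernel, and the gain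
is dominated by `1 - c` times the loss, up to a bounded term. -/
structure IsGrowthFrag (r a β : ℝ → ℝ) (b : ℝ → ℝ → ℝ) (θ : ℝ → ℝ) (r₀ a₀ p m C Cθ c D : ℝ) : Prop
    extends IsTransport r a r₀ a₀ p where
  one_lt : 1 < m
  birth_bound : DualBound m β C
  birth_nonneg : ∀ᵐ x ∂lebPos, 0 ≤ β x
  kernel : IsKernel m (fragKernel b) θ Cθ
  c_pos : 0 < c
  c_le : c ≤ 1 / 2
  D_nonneg : 0 ≤ D
  rate_mul_le : ∀ x, 0 < x → |θ x| * a x ≤ (1 - c) * (wt m x * a x) + D * wt m x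

/-- The constants are chosen before `β`, so the model with birth and the one without share them. -/
theorem IsTransport.exists_isGrowthFrag {r a : ℝ → ℝ} {b : ℝ → ℝ → ℝ} {r₀ a₀ p b₀ l : ℝ}
    (h : IsTransport r a r₀ a₀ p) (hb : IsFragKernel b b₀ l m) :
    ∃ θ Cθ c D, ∀ β C, DualBound m β C → (∀ᵐ x ∂lebPos, 0 ≤ β x) →
      IsGrowthFrag r a β b θ r₀ a₀ p m C Cθ c D := by
  obtain ⟨c, y₀, C, hc, hc', hy₀, hk⟩ := hb.exists_isKernel
  have hC := hk.bound.nonneg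
  have ha₀ := h.a₀_nonneg
  -- The bounded error `D` is the maximal loss rate on `(0, y₀]` times the crude moment constant.
  refine ⟨_, C, c, a₀ * (1 + y₀ ^ p) * C, fun β Cβ hβ hβ0 => ⟨h, hb.one_lt, hβ, hβ0, hk, hc, hc',
    by positivity, fun x hx => ?_⟩⟩
  have hw := wt_pos m hx
  have ha := (h.rate x hx).1
  split_ifs with hxy
  · rw [abs_of_nonneg (by positivity)]
    have h1 : 0 ≤ (1 - c) * (wt m x * a x) := mul_nonneg (by linarith) (by positivity)
    have h2 : C * wt m x * a x ≤ C * wt m x * (a₀ * (1 + y₀ ^ p)) := by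
      gcongr
      exact h.rate_le hx hxy
    linarith
  · rw [abs_of_nonneg (mul_nonneg (by linarith) hw.le)]
    have : 0 ≤ a₀ * (1 + y₀ ^ p) * C * wt m x := by positivity
    linarith

namespace IsGrowthFrag

variable {r a β : ℝ → ℝ} {b : ℝ → ℝ → ℝ} {θ : ℝ → ℝ} {r₀ a₀ p C Cθ c D ν : ℝ}

theorem isBirth (h : IsGrowthFrag r a β b θ r₀ a₀ p m C Cθ c D) (hν : 2 * m * r₀ + C < ν) :
    IsBirth r a β r₀ a₀ p m C ν :=
  ⟨h.toIsTransport, h.one_lt, h.birth_bound, h.birth_nonneg, hν⟩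

/-- The gain operator as a function of `a u`. -/
def gainOp (h : IsGrowthFrag r a β b θ r₀ a₀ p m C Cθ c D) : X m →L[ℝ] X m := h.kernel.clm

/-- The weighted mass as a functional. -/
def mass (m : ℝ) : X m →L[ℝ] ℝ := (dualBound_wt m).clm

theorem mass_eq_norm {u : X m} (hu : 0 ≤ u) : mass m u = ‖u‖ := (norm_eq_pairing hu).symm

theorem gainOp_nonneg (h : IsGrowthFrag r a β b θ r₀ a₀ p m C Cθ c D) {f : X m} (hf : 0 ≤ f) :
    0 ≤ h.gainOp f := h.kernel.clm_nonneg hf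

/-- Naming `A = a u` as an element of the space expresses the gain by a bounded operator applied to
`A`, although it is unbounded in `u`. -/
theorem graphK_iff (h : IsGrowthFrag r a β b θ r₀ a₀ p m C Cθ c D) {u v : X m} :
    GraphK r a b β m u v ↔ ∃ g A : X m, MemDomZ r a β m u g ∧ (A =ᵐ[lebPos] fun x => a x * u x) ∧
      v = -g - A + h.gainOp A := by
  have key : ∀ {g A : X m}, (A =ᵐ[lebPos] fun x => a x * u x) →
      (⇑(-g - A + h.gainOp A) =ᵐ[lebPos] fun x => -g x - a x * u x + gain a b u x) := by
    intro g A hA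
    have e1 : -g - A + h.gainOp A = h.gainOp A - (g + A) := by abel
    rw [e1]
    filter_upwards [X_sub (h.gainOp A) (g + A), X_add g A, hA, gain_ae h.kernel hA]
      with x h1 h2 h3 h4
    rw [h1, h2, h3, gainOp, h4]
    ring
  constructor
  · rintro ⟨g, hd, hv⟩
    have hA := toX_ae hd.integrable_mul
    exact ⟨g, _, hd, hA, X_ext (hv.trans (key hA).symm)⟩
  · rintro ⟨g, A, hd, hA, rfl⟩
    exact ⟨g, hd, key hA⟩

theorem rate_nonneg (h : IsGrowthFrag r a β b θ r₀ a₀ p m C Cθ c D) {u A : X m} (hu : 0 ≤ u)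
    (hA : A =ᵐ[lebPos] fun x => a x * u x) : 0 ≤ A := by
  rw [X_nonneg_iff]
  filter_upwards [hA, X_nonneg_iff.1 hu, ae_lebPos_pos] with x h1 h2 h3
  rw [h1]
  exact mul_nonneg (h.rate x h3).1 h2

theorem norm_gainOp_le (h : IsGrowthFrag r a β b θ r₀ a₀ p m C Cθ c D) {u A : X m} (hu : 0 ≤ u)
    (hA : A =ᵐ[lebPos] fun x => a x * u x) : ‖h.gainOp A‖ ≤ (1 - c) * ‖A‖ + D * ‖u‖ := by
  refine (h.kernel.norm_clm_apply_le A).trans ?_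
  have i1 : Integrable (fun x => wt m x * |A x|) lebPos := by
    refine (X_integrable A).abs.congr ?_
    filter_upwards [ae_lebPos_pos] with x hx
    rw [abs_mul, abs_of_pos (wt_pos m hx)]
  have i2 : Integrable (fun x => wt m x * |u x|) lebPos := by
    refine (X_integrable u).abs.congr ?_
    filter_upwards [ae_lebPos_pos] with x hx
    rw [abs_mul, abs_of_pos (wt_pos m hx)]
  rw [X_norm A, X_norm u, ← integral_const_mul, ← integral_const_mul,
    ← integral_add (i1.const_mul _) (i2.const_mul _)]
  refine integral_mono_ae ?_ ((i1.const_mul _).add (i2.const_mul _)) ?_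
  · simpa [abs_mul] using (h.kernel.bound.integrable A).abs
  · filter_upwards [hA, X_nonneg_iff.1 hu, ae_lebPos_pos] with x h1 h2 h3
    have ha := (h.rate x h3).1
    have h4 := mul_le_mul_of_nonneg_right (h.rate_mul_le x h3) h2
    rw [h1, abs_of_nonneg (mul_nonneg ha h2), abs_of_nonneg h2]
    linarith

theorem dualBound_wt_deriv (h : IsGrowthFrag r a β b θ r₀ a₀ p m C Cθ c D) :
    DualBound m (fun x => m * x ^ (m - 1) * r x) (2 * m * r₀) where
  meas := by
    have h1 : AEStronglyMeasurable r lebPos :=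
      h.continuousOn.aestronglyMeasurable measurableSet_Ioi
    have h2 : Measurable fun x : ℝ => m * x ^ (m - 1) := by fun_prop
    exact h2.aestronglyMeasurable.mul h1
  nonneg := by
    have := h.r₀_pos
    have := h.one_lt
    positivity
  le := by
    filter_upwards [ae_lebPos_pos] with x hx
    have := h.one_lt
    have := (h.bound x hx).1
    rw [abs_of_nonneg (by positivity)]
    exact h.wt_deriv_mul_le h.one_lt hx

/-- Integration by parts against the weight: the boundary contributes `⟨β, u⟩` because the weight is
`1` at `0`, and transport contributes at most `2 m r₀ ‖u‖`. -/
theorem neg_mass_deriv_le (h : IsGrowthFrag r a β b θ r₀ a₀ p m C Cθ c D) {u g : X m}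
    (hd : MemDomZ r a β m u g) : -mass m g ≤ (2 * m * r₀ + C) * ‖u‖ := by
  have h1 := hd.pairing_deriv h.bound (isPrimitive_wt h.one_lt) (dualBound_wt m)
    h.dualBound_wt_deriv
  have h2 := (abs_le.1 (h.birth_bound.abs_pairing_le u)).2
  have h3 := (abs_le.1 (h.dualBound_wt_deriv.abs_pairing_le u)).2
  have h4 : wt m 0 = 1 := by
    rw [wt, Real.zero_rpow (by linarith [h.one_lt]), add_zero]
  rw [h4] at h1
  change -pairing (wt m) g ≤ _
  rw [h1]
  linarith

theorem mass_le (h : IsGrowthFrag r a β b θ r₀ a₀ p m C Cθ c D) {u g A : X m} (hu : 0 ≤ u)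
    (hd : MemDomZ r a β m u g) (hA : A =ᵐ[lebPos] fun x => a x * u x) :
    mass m (-g - A + h.gainOp A) ≤ (2 * m * r₀ + C + D) * ‖u‖ - c * ‖A‖ := by
  have hA0 := h.rate_nonneg hu hA
  rw [map_add, map_sub, map_neg, mass_eq_norm hA0, mass_eq_norm (h.gainOp_nonneg hA0)]
  have h1 := h.norm_gainOp_le hu hA
  have h2 := h.neg_mass_deriv_le hd
  linarith

/-- The growth bound of the growth-fragmentation semigroups. -/
def growthBound (m r₀ C D : ℝ) : ℝ := 2 * m * r₀ + C + D

theorem growthBound_nonneg (h : IsGrowthFrag r a β b θ r₀ a₀ p m C Cθ c D) :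
    0 ≤ growthBound m r₀ C D := by
  have := h.dualBound_wt_deriv.nonneg
  have := h.birth_bound.nonneg
  have := h.D_nonneg
  unfold growthBound
  positivity

theorem lt_of_growthBound (h : IsGrowthFrag r a β b θ r₀ a₀ p m C Cθ c D)
    (hν : 2 * growthBound m r₀ C D + 1 < ν) :
    2 * m * r₀ + C < ν ∧ 2 * D ≤ ν - (2 * m * r₀ + C) := by
  have h1 := h.dualBound_wt_deriv.nonneg
  have h2 := h.birth_bound.nonneg
  have h3 := h.D_nonneg
  rw [growthBound] at hν
  constructor <;> linarith

section Resolvent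

variable (h : IsGrowthFrag r a β b θ r₀ a₀ p m C Cθ c D)
  (hν : 2 * growthBound m r₀ C D + 1 < ν)

/-- The gain operator applied to the resolvent of the loss part. -/
def gainRes : X m →L[ℝ] X m := h.gainOp * (h.isBirth (h.lt_of_growthBound hν).1).rateRes

theorem gainRes_nonneg {f : X m} (hf : 0 ≤ f) : 0 ≤ h.gainRes hν f :=
  h.gainOp_nonneg (IsBirth.rateRes_nonneg _ hf)

/-- For `f ≥ 0` and `u = R(ν, Z_β) f`, the mass balance gives `‖a u‖ + (ν - 2 m r₀ - C) ‖u‖ ≤ ‖f‖`,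
while the gain is at most `(1 - c) ‖a u‖ + D ‖u‖`. A positive operator need only be estimated on the
positive cone. -/
theorem norm_gainRes_le : ‖h.gainRes hν‖ ≤ 1 - c := by
  have hν' := h.lt_of_growthBound hν
  have hB := h.isBirth hν'.1
  refine opNorm_le_of_nonneg (fun f hf => h.gainRes_nonneg hν hf) (by linarith [h.c_le])
    fun f hf => ?_
  have h1 := h.neg_mass_deriv_le (hB.memDomZ_res f)
  have hu := hB.res_nonneg hf
  have h2 := h.norm_gainOp_le hu (hB.rateRes_ae f)
  rw [map_sub, map_sub, map_smul, smul_eq_mul, mass_eq_norm hf, mass_eq_norm hu,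
    mass_eq_norm (hB.rateRes_nonneg hf)] at h1
  refine h2.trans ?_
  -- Both `c ≤ 1 / 2` and `2 D ≤ ν - (2 m r₀ + C)` are used here; the latter explains the factor two
  -- in the spectral threshold.
  have h3 : D ≤ (1 - c) * (ν - (2 * m * r₀ + C)) := by
    nlinarith [hν'.2, h.c_le, h.D_nonneg]
  calc (1 - c) * ‖hB.rateRes f‖ + D * ‖hB.res f‖
      ≤ (1 - c) * ‖hB.rateRes f‖ + (1 - c) * (ν - (2 * m * r₀ + C)) * ‖hB.res f‖ := by gcongr
    _ = (1 - c) * (‖hB.rateRes f‖ + (ν - (2 * m * r₀ + C)) * ‖hB.res f‖) := by ring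
    _ ≤ (1 - c) * ‖f‖ := by
      refine mul_le_mul_of_nonneg_left ?_ (by linarith [h.c_le])
      linarith

theorem norm_gainRes_lt : ‖h.gainRes hν‖ < 1 :=
  (h.norm_gainRes_le hν).trans_lt (by linarith [h.c_pos])

/-- The resolvent of the growth-fragmentation operator. -/
def resolvent : X m →L[ℝ] X m :=
  (h.isBirth (h.lt_of_growthBound hν).1).res * Ring.inverse (1 - h.gainRes hν)

theorem resolvent_nonneg {f : X m} (hf : 0 ≤ f) : 0 ≤ h.resolvent hν f :=
  IsBirth.res_nonneg _ (inverse_one_sub_nonneg (fun _ hf => h.gainRes_nonneg hν hf)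
    (h.norm_gainRes_lt hν) hf)

/-- With `u = R(ν, Z_β) F`, the equation `ν u - v = f` becomes `F - gainRes F = f`, which the
Neumann series inverts. -/
theorem graphK_iff_eq_resolvent {u v : X m} :
    GraphK r a b β m u v ↔ u = h.resolvent hν (ν • u - v) := by
  have hB := h.isBirth (h.lt_of_growthBound hν).1
  have h1 := h.norm_gainRes_lt hν
  rw [h.graphK_iff]
  constructor
  · rintro ⟨g, A, hd, hA, rfl⟩
    have hu := hB.eq_res hd hA
    set F := ν • u + g + A with hF
    have hAF : A = hB.rateRes F := X_ext (hA.trans (by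
      rw [hu]; exact (hB.rateRes_ae F).symm))
    have e1 : ν • u - (-g - A + h.gainOp A) = F - h.gainRes hν F := by
      have : h.gainRes hν F = h.gainOp A := by rw [hAF]; rfl
      rw [this, hF]
      abel
    rw [e1]
    change u = hB.res (Ring.inverse (1 - h.gainRes hν) (F - h.gainRes hν F))
    rw [inverse_apply_one_sub h1, ← hu]
  · intro hu
    set F := Ring.inverse (1 - h.gainRes hν) (ν • u - v) with hF
    have hF' : F - h.gainRes hν F = ν • u - v := one_sub_apply_inverse h1 _
    have hu' : u = hB.res F := hu
    have hd := hB.memDomZ_res F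
    have hA := hB.rateRes_ae F
    rw [← hu'] at hd hA
    refine ⟨_, _, hd, hA, ?_⟩
    have e1 : h.gainOp (hB.rateRes F) = F - (ν • u - v) := by
      rw [← hF']
      change h.gainRes hν F = _
      abel
    rw [e1]
    abel

/-- For `f ≥ 0` the total mass of `v = ν u - f` is at most `growthBound * ‖u‖`, and mass equals norm
on the positive cone. -/
theorem norm_resolvent_le : ‖h.resolvent hν‖ ≤ (ν - growthBound m r₀ C D)⁻¹ := by
  have h0 : 0 < ν - growthBound m r₀ C D := by linarith [h.growthBound_nonneg]
  refine opNorm_le_of_nonneg (fun f hf => h.resolvent_nonneg hν hf) (by positivity) fun f hf => ?_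
  have hu := h.resolvent_nonneg hν hf
  set u := h.resolvent hν f with hu'
  obtain ⟨g, A, hd, hA, hv⟩ := h.graphK_iff.1 ((h.graphK_iff_eq_resolvent hν (u := u)
    (v := ν • u - f)).2 (by rw [sub_sub_cancel]))
  have h1 := h.mass_le hu hd hA
  rw [← hv, map_sub, map_smul, smul_eq_mul, mass_eq_norm hf, mass_eq_norm hu] at h1
  have h2 : 0 ≤ c * ‖A‖ := mul_nonneg h.c_pos.le (norm_nonneg _)
  rw [inv_mul_eq_div, le_div_iff₀ h0, growthBound]
  linarith

end Resolvent

end IsGrowthFrag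

end

section

variable {m : ℝ}

/-! ### Density of the domain -/

theorem mem_of_tendsto_ae {M : Submodule ℝ (X m)} (hM : IsClosed (M : Set (X m))) {u : ℕ → X m}
    (hu : ∀ n, u n ∈ M) {f : X m} {B : ℝ → ℝ} (hB : Integrable (fun x => wt m x * B x) lebPos)
    (hle : ∀ n, ∀ᵐ x ∂lebPos, |u n x - f x| ≤ B x)
    (hlim : ∀ᵐ x ∂lebPos, Tendsto (fun n => u n x) atTop (𝓝 (f x))) : f ∈ M := by
  refine hM.mem_of_tendsto (f := u) (b := atTop) ?_ (Eventually.of_forall hu)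
  rw [tendsto_iff_norm_sub_tendsto_zero]
  have h0 : ∀ n, ‖u n - f‖ = ∫ x, wt m x * |u n x - f x| ∂lebPos := fun n => by
    rw [X_norm]
    refine integral_congr_ae ?_
    filter_upwards [X_sub (u n) f] with x hx
    rw [hx]
  simp_rw [h0]
  have h1 : Tendsto (fun n => ∫ x, wt m x * |u n x - f x| ∂lebPos) atTop
      (𝓝 (∫ x, (0 : ℝ) ∂lebPos)) := by
    refine tendsto_integral_of_dominated_convergence _ (fun n => ?_) hB (fun n => ?_) ?_
    · exact (measurable_wt m).aestronglyMeasurable.mul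
        ((X_aestronglyMeasurable (u n)).sub (X_aestronglyMeasurable f)).norm
    · filter_upwards [hle n, ae_lebPos_pos] with x hx hx0
      have := wt_pos m hx0
      rw [Real.norm_eq_abs, abs_of_nonneg (by positivity)]
      gcongr
    · filter_upwards [hlim] with x hx
      have := ((tendsto_sub_nhds_zero_iff.2 hx).abs).const_mul (wt m x)
      simpa using this
  simpa using h1

/-- `e φ` belongs to `M`. -/
def MulMem (M : Submodule ℝ (X m)) (e φ : ℝ → ℝ) : Prop :=
  ∃ u ∈ M, u =ᵐ[lebPos] fun x => e x * φ x

namespace MulMem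

variable {M : Submodule ℝ (X m)} {e φ ψ : ℝ → ℝ}

theorem congr (h : MulMem M e φ) (hφ : φ =ᵐ[lebPos] ψ) : MulMem M e ψ := by
  obtain ⟨u, hu, hu'⟩ := h
  exact ⟨u, hu, hu'.trans (hφ.mono fun x hx => by simp only [hx])⟩

theorem add (h : MulMem M e φ) (h' : MulMem M e ψ) : MulMem M e fun x => φ x + ψ x := by
  obtain ⟨u, hu, hu'⟩ := h
  obtain ⟨v, hv, hv'⟩ := h'
  refine ⟨u + v, M.add_mem hu hv, ?_⟩
  filter_upwards [X_add u v, hu', hv'] with x h1 h2 h3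
  rw [h1, h2, h3, mul_add]

theorem const_mul (h : MulMem M e φ) (c : ℝ) : MulMem M e fun x => c * φ x := by
  obtain ⟨u, hu, hu'⟩ := h
  refine ⟨c • u, M.smul_mem c hu, ?_⟩
  filter_upwards [X_smul c u, hu'] with x h1 h2
  rw [h1, h2]
  ring

theorem of_tendsto (hM : IsClosed (M : Set (X m))) {φs : ℕ → ℝ → ℝ} (h : ∀ n, MulMem M e (φs n))
    {B : ℝ → ℝ} (hB : Integrable (fun x => wt m x * B x) lebPos)
    (hle : ∀ n, ∀ᵐ x ∂lebPos, |e x * φs n x| ≤ B x)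
    (hlim : ∀ᵐ x ∂lebPos, Tendsto (fun n => φs n x) atTop (𝓝 (φ x))) : MulMem M e φ := by
  choose u hu hu' using h
  have hlim' : ∀ᵐ x ∂lebPos, Tendsto (fun n => u n x) atTop (𝓝 (e x * φ x)) := by
    filter_upwards [hlim, ae_all_iff.2 hu'] with x h1 h2
    simp_rw [h2]
    exact h1.const_mul _
  have hle' : ∀ᵐ x ∂lebPos, |e x * φ x| ≤ B x := by
    filter_upwards [hlim, ae_all_iff.2 hle] with x h1 h2
    exact le_of_tendsto (h1.const_mul (e x)).abs (Eventually.of_forall h2)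
  have hf : Integrable (fun x => e x * φ x) (weightedMeasure m) := by
    rw [integrable_weightedMeasure_iff]
    refine hB.mono ((measurable_wt m).aestronglyMeasurable.mul
      (aestronglyMeasurable_of_tendsto_ae atTop (fun n => X_aestronglyMeasurable (u n)) hlim')) ?_
    filter_upwards [hle', ae_lebPos_pos] with x h1 h2
    have h3 := wt_pos m h2
    have h4 : 0 ≤ B x := (abs_nonneg _).trans h1
    rw [Real.norm_eq_abs, Real.norm_eq_abs, abs_mul, abs_of_pos h3,
      abs_of_nonneg (mul_nonneg h3.le h4)]
    gcongr
  refine ⟨toX hf, mem_of_tendsto_ae (B := fun x => 2 * B x) hM hu ?_ (fun n => ?_) ?_, toX_ae hf⟩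
  · refine (hB.const_mul 2).congr (Eventually.of_forall fun x => ?_)
    simp only
    ring
  · filter_upwards [hu' n, toX_ae hf, hle n, hle'] with x h1 h2 h3 h4
    rw [h1, h2]
    exact (abs_sub _ _).trans (by linarith)
  · filter_upwards [hlim', toX_ae hf] with x h1 h2
    rwa [h2]

end MulMem

variable {M : Submodule ℝ (X m)} {e : ℝ → ℝ}

/-- A π-λ argument from the half-lines; countable disjoint unions are limits dominated by `|e|`. -/
theorem MulMem.indicator (hM : IsClosed (M : Set (X m)))
    (he : Integrable (fun x => wt m x * |e x|) lebPos)
    (h : ∀ c, 0 ≤ c → MulMem M e ((Ioi c).indicator 1)) {s : Set ℝ} (hs : MeasurableSet s) :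
    MulMem M e (s.indicator 1) := by
  have huniv : MulMem M e (fun _ => 1) := by
    refine (h 0 le_rfl).congr ?_
    filter_upwards [ae_lebPos_pos] with x hx
    rw [indicator_of_mem (show x ∈ Ioi 0 from hx), Pi.one_apply]
  have hzero : MulMem M e (fun _ => 0) := by simpa using huniv.const_mul 0
  refine MeasurableSpace.induction_on_inter (C := fun s _ => MulMem M e (s.indicator 1))
    (BorelSpace.measurable_eq.trans (borel_eq_generateFrom_Ioi ℝ)) isPiSystem_Ioi ?_ ?_ ?_ ?_ s hs
  · simpa using hzero
  · rintro _ ⟨c, rfl⟩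
    rcases le_total 0 c with hc | hc
    · exact h c hc
    · refine huniv.congr ?_
      filter_upwards [ae_lebPos_pos] with x hx
      rw [indicator_of_mem (show x ∈ Ioi c from hc.trans_lt hx), Pi.one_apply]
  · intro t _ ht
    refine (huniv.add (ht.const_mul (-1))).congr (Eventually.of_forall fun x => ?_)
    by_cases hx : x ∈ t
    · simp [hx]
    · simp [hx]
  · intro f hf _ ht
    have hsum : ∀ n : ℕ, MulMem M e fun x => ∑ i ∈ Finset.range n, (f i).indicator 1 x := by
      intro n
      induction n with
      | zero => simpa using hzero
      | succ n ih =>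
        simp_rw [Finset.sum_range_succ]
        exact ih.add (ht n)
    have heq : ∀ n : ℕ, ∀ x, ∑ i ∈ Finset.range n, (f i).indicator (1 : ℝ → ℝ) x =
        (⋃ i ∈ Finset.range n, f i).indicator 1 x := fun n x => by
      rw [Finset.indicator_biUnion_apply]
      exact fun i _ j _ hij => hf hij
    refine MulMem.of_tendsto hM hsum he (fun n => Eventually.of_forall fun x => ?_)
      (Eventually.of_forall fun x => ?_)
    · rw [heq, abs_mul]
      refine mul_le_of_le_one_right (abs_nonneg _) ?_
      by_cases hx : x ∈ ⋃ i ∈ Finset.range n, f i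
      · rw [indicator_of_mem hx]; simp
      · rw [indicator_of_notMem hx]; simp
    · refine tendsto_const_nhds.congr' ?_
      by_cases hx : x ∈ ⋃ i, f i
      · obtain ⟨i, hi⟩ := mem_iUnion.1 hx
        filter_upwards [eventually_gt_atTop i] with n hn
        rw [heq, indicator_of_mem hx, indicator_of_mem]
        exact mem_biUnion (Finset.mem_coe.2 (Finset.mem_range.2 hn)) hi
      · refine Eventually.of_forall fun n => ?_
        simp only
        rw [heq, indicator_of_notMem hx, indicator_of_notMem]
        exact fun h => hx (iUnion₂_subset_iUnion _ _ h)

/-- A closed subspace containing `e 1_{(c, ∞)}` for all `c ≥ 0` is everything. -/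
theorem eq_top_of_mulMem_indicator_Ioi (hM : IsClosed (M : Set (X m)))
    (he : Integrable (fun x => wt m x * |e x|) lebPos) (hem : AEStronglyMeasurable e lebPos)
    (hpos : ∀ x, 0 < x → e x ≠ 0) (h : ∀ c, 0 ≤ c → MulMem M e ((Ioi c).indicator 1)) : M = ⊤ := by
  refine Submodule.eq_top_iff'.2 fun f => ?_
  have hs : ∀ s : SimpleFunc ℝ ℝ, MulMem M e s := fun s => by
    refine SimpleFunc.induction (motive := fun s => MulMem M e s) (fun c s hs => ?_)
      (fun f g _ hf hg => hf.add hg) s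
    refine ((MulMem.indicator hM he h hs).const_mul c).congr (Eventually.of_forall fun x => ?_)
    by_cases hx : x ∈ s
    · simp [hx]
    · simp [hx]
  -- As `e` has no zeros, `f = e q` with `q = f / e`. Simple approximations of `q` bounded by `2
  -- |q|` give dominated convergence to `f`.
  have hq : AEStronglyMeasurable (fun x => f x / e x) lebPos :=
    (X_aestronglyMeasurable f).div₀ hem
  set q := hq.mk with hq'
  have hqm : Measurable q := hq.stronglyMeasurable_mk.measurable
  have hfe : f =ᵐ[lebPos] fun x => e x * q x := by
    filter_upwards [hq.ae_eq_mk, ae_lebPos_pos] with x h1 h2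
    have h3 : q x = f x / e x := h1.symm
    rw [h3, mul_div_cancel₀ _ (hpos x h2)]
  obtain ⟨u, hu, hu'⟩ : MulMem M e q := by
    refine MulMem.of_tendsto hM (φs := fun n => SimpleFunc.approxOn q hqm univ 0 (mem_univ _) n)
      (fun n => hs _) (B := fun x => 2 * |f x|) ?_ (fun n => ?_) (Eventually.of_forall fun x =>
        SimpleFunc.tendsto_approxOn hqm (mem_univ _) (by simp))
    · refine ((X_integrable f).abs.const_mul 2).congr ?_
      filter_upwards [ae_lebPos_pos] with x hx
      rw [abs_mul, abs_of_pos (wt_pos m hx)]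
      ring
    · filter_upwards [hfe] with x hx
      have h1 := SimpleFunc.norm_approxOn_zero_le hqm (mem_univ (0 : ℝ)) x n
      rw [Real.norm_eq_abs, Real.norm_eq_abs] at h1
      rw [hx, abs_mul, abs_mul]
      calc _ ≤ |e x| * (|q x| + |q x|) := by gcongr
        _ = _ := by ring
  rwa [X_ext (hfe.trans hu'.symm)]

namespace IsTransport

variable {r a : ℝ → ℝ} {r₀ a₀ p ν : ℝ}

theorem integral_indicator_Ioc {c : ℝ} (hc : 0 ≤ c) {δ : ℝ} (hδ : 0 < δ) {x : ℝ} (hx : 0 ≤ x) :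
    ∫ y in (0 : ℝ)..x, (Ioc c (c + δ)).indicator (fun _ => δ⁻¹) y =
      max 0 (min 1 (δ⁻¹ * (x - c))) := by
  rw [intervalIntegral.integral_of_le hx, setIntegral_indicator measurableSet_Ioc,
    Ioc_inter_Ioc, sup_eq_right.2 hc, setIntegral_const, smul_eq_mul, Measure.real,
    Real.volume_Ioc, ENNReal.toReal_ofReal']
  have h1 : δ⁻¹ * δ = 1 := inv_mul_cancel₀ hδ.ne'
  have h2 : 0 < δ⁻¹ := inv_pos.2 hδ
  rcases le_total x (c + δ) with h | h
  · rw [inf_eq_left.2 h, min_eq_right (by nlinarith)]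
    rcases le_total x c with h' | h'
    · rw [max_eq_right (by linarith), max_eq_left (by nlinarith), zero_mul]
    · rw [max_eq_left (by linarith), max_eq_right (by nlinarith), mul_comm]
  · rw [inf_eq_right.2 h, min_eq_left (by nlinarith), max_eq_left (by linarith),
      max_eq_right zero_le_one, add_sub_cancel_left, mul_comm, h1]

/-- The resolvent applied to `δ⁻¹ decay` on `(c, c + δ]` equals `e_ν` times a ramp rising from `0`
to `1` on that interval; let `δ → 0`. -/
theorem mulMem_closure_range_res (h : IsTransport r a r₀ a₀ p) (hm : 1 < m)
    (hν : 2 * m * r₀ < ν) {c : ℝ} (hc : 0 ≤ c) :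
    MulMem (LinearMap.range (h.res hm hν).toLinearMap).topologicalClosure (eFun r a ν)
      ((Ioi c).indicator 1) := by
  set φs : ℕ → ℝ → ℝ := fun n x => max 0 (min 1 (((1 : ℝ) / (n + 1))⁻¹ * (x - c))) with hφs
  have hφ1 : ∀ n x, |φs n x| ≤ 1 := fun n x => by
    rw [abs_of_nonneg (le_max_left _ _)]
    exact max_le zero_le_one (min_le_left _ _)
  have he := integrable_weightedMeasure_iff.1 (h.integrable_eFun hm hν)
  refine MulMem.of_tendsto (Submodule.isClosed_topologicalClosure _) (φs := φs) (fun n => ?_)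
    (B := fun x => |eFun r a ν x|) ?_ (fun n => Eventually.of_forall fun x => ?_)
    (Eventually.of_forall fun x => ?_)
  · have hδ : (0 : ℝ) < 1 / (n + 1) := by positivity
    set g : ℝ → ℝ := (Ioc c (c + 1 / ((n : ℝ) + 1))).indicator
      fun y => (1 / ((n : ℝ) + 1))⁻¹ * decay r a ν y with hg
    have hgi : Integrable g (weightedMeasure m) := by
      rw [integrable_weightedMeasure_iff]
      have h1 : ContinuousOn (fun y => wt m y * ((1 / ((n : ℝ) + 1))⁻¹ * decay r a ν y))
          (Icc c (c + 1 / ((n : ℝ) + 1))) := by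
        refine ContinuousOn.mul ?_ (continuousOn_const.mul
          ((h.continuousOn_decay ν).mono fun x hx => hc.trans hx.1))
        exact (isPrimitive_wt hm).continuousOn.mono fun x hx => hc.trans hx.1
      have h2 : Integrable ((Ioc c (c + 1 / ((n : ℝ) + 1))).indicator
          fun y => wt m y * ((1 / ((n : ℝ) + 1))⁻¹ * decay r a ν y)) volume :=
        (integrable_indicator_iff measurableSet_Ioc).2
          (h1.integrableOn_Icc.mono_set Ioc_subset_Icc_self)
      refine (h2.restrict (s := Ioi 0)).congr (Eventually.of_forall fun x => ?_)
      rw [hg]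
      by_cases hx : x ∈ Ioc c (c + 1 / ((n : ℝ) + 1))
      · simp only [indicator_of_mem hx]
      · simp only [indicator_of_notMem hx, mul_zero]
    refine ⟨h.res hm hν (toX hgi), Submodule.le_topologicalClosure _ ⟨_, rfl⟩, ?_⟩
    filter_upwards [h.res_ae hm hν (toX hgi), ae_lebPos_pos] with x hx hx0
    rw [hx, hφs]
    beta_reduce
    rw [← integral_indicator_Ioc hc hδ hx0.le]
    congr 1
    refine intervalIntegral.integral_congr_ae ?_
    have h3 : ∀ᵐ y, y ∈ Ioi (0 : ℝ) → toX hgi y = g y :=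
      (ae_restrict_iff' measurableSet_Ioi).1 (toX_ae hgi)
    filter_upwards [h3] with y hy hyx
    rw [uIoc_of_le hx0.le] at hyx
    rw [hy hyx.1, hg]
    by_cases hy' : y ∈ Ioc c (c + 1 / ((n : ℝ) + 1))
    · simp only [indicator_of_mem hy', mul_assoc, mul_inv_cancel₀ (decay_pos r a ν y).ne', mul_one]
    · simp only [indicator_of_notMem hy', zero_mul]
  · refine he.abs.congr ?_
    filter_upwards [ae_lebPos_pos] with x hx
    rw [abs_mul, abs_of_pos (wt_pos m hx)]
  · rw [abs_mul]
    exact mul_le_of_le_one_right (abs_nonneg _) (hφ1 n x)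
  · refine tendsto_const_nhds.congr' ?_
    rcases le_or_gt x c with hx | hx
    · refine Eventually.of_forall fun n => ?_
      rw [indicator_of_notMem (show x ∉ Ioi c from not_lt.2 hx), hφs]
      have : ((1 : ℝ) / (n + 1))⁻¹ * (x - c) ≤ 0 :=
        mul_nonpos_of_nonneg_of_nonpos (by positivity) (by linarith)
      exact (max_eq_left ((min_le_right _ _).trans this)).symm
    · obtain ⟨N, hN⟩ := exists_nat_gt (x - c)⁻¹
      filter_upwards [eventually_ge_atTop N] with n hn
      rw [indicator_of_mem (show x ∈ Ioi c from hx), hφs, Pi.one_apply]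
      have h1 : 0 < x - c := by linarith
      have h2 : (x - c)⁻¹ < n + 1 := by
        have : (N : ℝ) ≤ n := by exact_mod_cast hn
        linarith
      have h3 : 1 ≤ ((1 : ℝ) / (n + 1))⁻¹ * (x - c) := by
        rw [one_div, inv_inv]
        rw [inv_lt_iff_one_lt_mul₀ h1] at h2
        linarith
      simp only
      rw [min_eq_left h3, max_eq_right zero_le_one]

theorem denseRange_res (h : IsTransport r a r₀ a₀ p) (hm : 1 < m) (hν : 2 * m * r₀ < ν) :
    DenseRange (h.res hm hν) := by
  have h1 := eq_top_of_mulMem_indicator_Ioi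
    (Submodule.isClosed_topologicalClosure (LinearMap.range (h.res hm hν).toLinearMap)) (e := eFun r a ν)
    (by
      refine (integrable_weightedMeasure_iff.1 (h.integrable_eFun hm hν)).abs.congr ?_
      filter_upwards [ae_lebPos_pos] with x hx
      rw [abs_mul, abs_of_pos (wt_pos m hx)])
    (h.aestronglyMeasurable_eFun ν)
    (fun x hx => (div_pos (decay_pos r a ν x) (h.bound x hx).1).ne')
    (fun c hc => h.mulMem_closure_range_res hm hν hc)
  rw [← Submodule.dense_iff_topologicalClosure_eq_top] at h1
  exact h1

end IsTransport

/-- The resolvent with birth is the one with zero boundary value followed by an operator with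
explicit right inverse `I - e ⊗ ψ`. -/
theorem IsBirth.denseRange_res {r a β : ℝ → ℝ} {r₀ a₀ p C ν : ℝ}
    (h : IsBirth r a β r₀ a₀ p m C ν) : DenseRange h.res := by
  have hne : 1 - h.ψ h.e ≠ 0 := (sub_pos.2 h.ψ_e_lt_one).ne'
  set L : X m →L[ℝ] X m := 1 + ((1 - h.ψ h.e)⁻¹ • h.ψ).smulRight h.e with hL
  have hsurj : Function.Surjective L := fun w => ⟨w - h.ψ w • h.e, by
    have : (1 - h.ψ h.e)⁻¹ * (h.ψ w - h.ψ w * h.ψ h.e) = h.ψ w := by field_simp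
    simp [hL, this]⟩
  exact (hsurj.denseRange.comp (h.toIsTransport.denseRange_res h.one_lt h.lt') L.continuous)

end

section

variable {m : ℝ}

/-! ### The growth-fragmentation semigroups and their conjugation -/

theorem IsPrimitive.sub_const_mul {F f G g : ℝ → ℝ} (hF : IsPrimitive F f) (hG : IsPrimitive G g)
    (c : ℝ) : IsPrimitive (fun x => F x - c * G x) (fun x => f x - c * g x) where
  intervalIntegrable x hx := (hF.intervalIntegrable x hx).sub ((hG.intervalIntegrable x hx).const_mul c)
  eq_integral x hx := by
    rw [intervalIntegral.integral_sub (hF.intervalIntegrable x hx)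
      ((hG.intervalIntegrable x hx).const_mul c), intervalIntegral.integral_const_mul,
      hF.eq_integral x hx, hG.eq_integral x hx]
    ring

theorem dualBound_zero {C : ℝ} (hC : 0 ≤ C) : DualBound m (fun _ => 0) C where
  meas := aestronglyMeasurable_const
  nonneg := hC
  le := by
    filter_upwards [ae_lebPos_pos] with x hx
    have := wt_pos m hx
    rw [abs_zero]
    positivity

namespace IsGrowthFrag

variable {r a β : ℝ → ℝ} {b : ℝ → ℝ → ℝ} {θ : ℝ → ℝ} {r₀ a₀ p C Cθ c D ν : ℝ}

/-- The resolvent, extended by zero to small spectral parameters. -/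
def resolvent₀ (h : IsGrowthFrag r a β b θ r₀ a₀ p m C Cθ c D) (ν : ℝ) : X m →L[ℝ] X m :=
  open Classical in if hν : 2 * growthBound m r₀ C D + 1 < ν then h.resolvent hν else 0

theorem resolvent₀_eq (h : IsGrowthFrag r a β b θ r₀ a₀ p m C Cθ c D)
    (hν : 2 * growthBound m r₀ C D + 1 < ν) : h.resolvent₀ ν = h.resolvent hν := dif_pos hν

theorem dense_domain (h : IsGrowthFrag r a β b θ r₀ a₀ p m C Cθ c D) :
    Dense {u | ∃ v, GraphK r a b β m u v} := by
  have hB := h.isBirth (lt_add_one _)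
  refine Dense.mono ?_ hB.denseRange_res
  rintro _ ⟨f, rfl⟩
  exact ⟨_, h.graphK_iff.2 ⟨_, _, hB.memDomZ_res f, hB.rateRes_ae f, rfl⟩⟩

theorem isResolvent (h : IsGrowthFrag r a β b θ r₀ a₀ p m C Cθ c D) :
    IsResolvent (GraphK r a b β m) h.resolvent₀ (2 * growthBound m r₀ C D + 1)
      (growthBound m r₀ C D) where
  nonneg := h.growthBound_nonneg
  lt := lt_add_one _
  graph_iff ν hν u v := by
    rw [h.resolvent₀_eq hν]
    exact h.graphK_iff_eq_resolvent hν
  norm_le ν hν := by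
    rw [h.resolvent₀_eq hν]
    exact h.norm_resolvent_le hν
  dense := h.dense_domain

theorem resolvent₀_mem (h : IsGrowthFrag r a β b θ r₀ a₀ p m C Cθ c D)
    (hν : 2 * growthBound m r₀ C D + 1 < ν) {f : X m} (hf : f ∈ Ici (0 : X m)) :
    h.resolvent₀ ν f ∈ Ici (0 : X m) := by
  rw [h.resolvent₀_eq hν]
  exact h.resolvent_nonneg hν hf

theorem exists_isGeneratedBy (h : IsGrowthFrag r a β b θ r₀ a₀ p m C Cθ c D) :
    ∃ S : ℝ≥0 → X m →L[ℝ] X m, IsGeneratedBy S (GraphK r a b β m) ∧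
      (∀ t, ‖S t‖ ≤ Real.exp (2 * growthBound m r₀ C D * t)) ∧
      (∀ t u v, GraphK r a b β m u v → GraphK r a b β m (S t u) (S t v)) ∧
      ∀ t, ∀ f ∈ Ici (0 : X m), S t f ∈ Ici (0 : X m) :=
  h.isResolvent.exists_isGeneratedBy isClosed_Ici (fun x hx y hy => show (0 : X m) ≤ x + y from add_nonneg hx hy)
    (fun _ hc _ hx => X_smul_nonneg hc hx) fun _ hν _ hf => h.resolvent₀_mem hν hf

/-- `ν J ν f` tends to `f`, lies in the domain, and stays nonnegative when `f` is. -/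
theorem Ici_subset_closure (h : IsGrowthFrag r a β b θ r₀ a₀ p m C Cθ c D) :
    Ici (0 : X m) ⊆ closure {u | u ∈ Ici (0 : X m) ∧ ∃ v, GraphK r a b β m u v} := by
  intro f hf
  refine mem_closure_of_tendsto (h.isResolvent.tendsto_smul_apply f) ?_
  filter_upwards [eventually_gt_atTop (2 * growthBound m r₀ C D + 1)] with ν hν
  have hν0 : 0 ≤ ν := by linarith [h.growthBound_nonneg]
  refine ⟨X_smul_nonneg hν0 (h.resolvent₀_mem hν hf), ?_⟩
  rw [← map_smul]
  exact ⟨_, h.isResolvent.graph_apply hν _⟩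

/-- Both `r u - ψ(u) decay` and `decay = r e` are primitives, and the former vanishes at `0`. As
`-∂(r e) - a e = ν e`, the correction to the image is `ψ(u)` times `ν e + 𝓑(a e)`. -/
theorem graphK_sub (h : IsGrowthFrag r a β b θ r₀ a₀ p m C Cθ c D)
    (h₀ : IsGrowthFrag r a (fun _ => 0) b θ r₀ a₀ p m C Cθ c D)
    (hB : IsBirth r a β r₀ a₀ p m C ν) {u v : X m} (huv : GraphK r a b β m u v) :
    GraphK r a b (fun _ => 0) m (u - hB.ψ u • hB.e)
      (v - hB.ψ u • (ν • hB.e + h.gainOp hB.ae)) := by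
  obtain ⟨g, A, hd, hA, rfl⟩ := h.graphK_iff.1 huv
  obtain ⟨hi, G, hG, hG0, hru⟩ := memDomZ_iff.1 hd
  have hA' : (A - hB.ψ u • hB.ae : X m) =ᵐ[lebPos] fun x => a x * (u - hB.ψ u • hB.e : X m) x := by
    filter_upwards [X_sub A (hB.ψ u • hB.ae), X_smul (hB.ψ u) hB.ae, hA, hB.ae_ae,
      X_sub u (hB.ψ u • hB.e), X_smul (hB.ψ u) hB.e, hB.e_ae] with x h1 h2 h3 h4 h5 h6 h7
    rw [h1, h2, h3, h4, h5, h6, h7]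
    ring
  refine h₀.graphK_iff.2 ⟨g + hB.ψ u • (ν • hB.e + hB.ae), A - hB.ψ u • hB.ae, ?_, hA', ?_⟩
  · refine memDomZ_iff.2 ⟨(L1.integrable_coeFn (A - hB.ψ u • hB.ae)).congr
      (ae_weightedMeasure_iff.2 hA'), fun x => G x - hB.ψ u * decay r a ν x, ?_, ?_, ?_⟩
    · refine (hG.sub_const_mul (h.isPrimitive_decay ν) (hB.ψ u)).congr_ae ?_
      filter_upwards [X_add g (hB.ψ u • (ν • hB.e + hB.ae)), X_smul (hB.ψ u) (ν • hB.e + hB.ae),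
        X_add (ν • hB.e) hB.ae, X_smul ν hB.e, hB.e_ae, hB.ae_ae] with x h1 h2 h3 h4 h5 h6
      rw [h1, h2, h3, h4, h5, h6, eFun_eq]
      ring
    · simp only [IsTransport.decay_zero, hG0, hB.ψ_apply, pairing, zero_mul, integral_zero]
      ring
    · filter_upwards [hru, X_sub u (hB.ψ u • hB.e), X_smul (hB.ψ u) hB.e, hB.e_ae, ae_lebPos_pos]
        with x h1 h2 h3 h4 h5
      have h6 := (h.bound x h5).1.ne'
      rw [h2, h3, h4, eFun_eq, ← h1]
      field_simp
  · have e1 : h₀.gainOp = h.gainOp := rfl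
    rw [e1, map_sub, map_smul, smul_add, smul_add]
    abel

/-- Integration by parts bounds the transport part of `⟨β, v⟩` by a multiple of the mass of `u`;
loss and gain add at most `2 C ‖a u‖` and a multiple of the mass. The dissipation in `mass_le` gives
`c ‖a u‖ ≤ growthBound * mass u - mass v`. -/
theorem exists_control (h : IsGrowthFrag r a β b θ r₀ a₀ p m C Cθ c D) {γ γ' : ℝ → ℝ} {C' : ℝ}
    (hγ : IsPrimitive γ γ') (hβγ : β =ᵐ[lebPos] γ)
    (hb' : DualBound m (fun x => γ' x * r x) C') :
    ∃ A B : ℝ, 0 ≤ A ∧ 0 ≤ B ∧ ∀ u v, GraphK r a b β m u v → u ∈ Ici (0 : X m) →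
      |h.birth_bound.clm u| + |h.birth_bound.clm v| ≤ A * (B * mass m u - mass m v) := by
  have hC := h.birth_bound.nonneg
  have hC' := hb'.nonneg
  have hD := h.D_nonneg
  have hc := h.c_pos
  -- `2 C / c` absorbs the term `2 C ‖a u‖`; the extra `1` keeps `A` positive, so that `K / A` makes
  -- sense even if `C = 0`.
  set A := 2 * C / c + 1 with hA_def
  set K := C + |γ 0| * C + C' + C * D with hK
  have hA0 : 0 < A := by positivity
  have hK0 : 0 ≤ K := by positivity
  refine ⟨A, growthBound m r₀ C D + K / A, hA0.le,
    add_nonneg h.growthBound_nonneg (by positivity), fun u v huv hu => ?_⟩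
  obtain ⟨g, L, hd, hL, rfl⟩ := h.graphK_iff.1 huv
  have hbγ : DualBound m γ C := ⟨h.birth_bound.meas.congr hβγ, hC, by
    filter_upwards [h.birth_bound.le, hβγ] with x h1 h2
    rwa [← h2]⟩
  have hpair : ∀ f : X m, pairing β f = pairing γ f := fun f =>
    integral_congr_ae (hβγ.mono fun x hx => by simp only [hx])
  have h1 := hd.pairing_deriv h.bound hγ hbγ hb'
  have h2 := h.birth_bound.abs_pairing_le u
  have h3 := h.birth_bound.abs_pairing_le L
  have h4 := h.birth_bound.abs_pairing_le (h.gainOp L)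
  have h5 := hb'.abs_pairing_le u
  have h6 := h.norm_gainOp_le hu hL
  have h7 := h.mass_le hu hd hL
  rw [← mass_eq_norm hu] at h7 h2 h5 h6
  have e1 : h.birth_bound.clm (-g - L + h.gainOp L) =
      γ 0 * pairing β u + pairing (fun x => γ' x * r x) u - pairing β L
        + pairing β (h.gainOp L) := by
    rw [map_add, map_sub, map_neg]
    change -pairing β g - pairing β L + pairing β (h.gainOp L) = _
    rw [hpair g, h1]
    ring
  have h8 : |h.birth_bound.clm (-g - L + h.gainOp L)| ≤ |γ 0| * (C * mass m u) + C' * mass m u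
      + C * ‖L‖ + C * (‖L‖ + D * mass m u) := by
    rw [e1]
    refine (abs_add_le _ _).trans (add_le_add ((abs_sub _ _).trans (add_le_add
      ((abs_add_le _ _).trans (add_le_add ?_ h5)) h3)) (h4.trans ?_))
    · rw [abs_mul]
      gcongr
    · gcongr
      have : 0 ≤ c * ‖L‖ := by positivity
      linarith
  have h9 : |h.birth_bound.clm u| ≤ C * mass m u := h2
  rw [← growthBound] at h7
  set Y := growthBound m r₀ C D * mass m u - mass m (-g - L + h.gainOp L) with hY
  have h10 : c * ‖L‖ ≤ Y := by linarith
  have h11 : 0 ≤ Y := le_trans (by positivity) h10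
  have h12 : 2 * C * ‖L‖ ≤ 2 * C / c * Y := by
    calc 2 * C * ‖L‖ = 2 * C / c * (c * ‖L‖) := by field_simp
      _ ≤ 2 * C / c * Y := by gcongr
  have h13 : A * ((growthBound m r₀ C D + K / A) * mass m u - mass m (-g - L + h.gainOp L)) =
      A * Y + K * mass m u := by
    rw [hY]
    field_simp
    ring
  rw [h13, hA_def, hK]
  linarith

/-- The semigroups and the constants `A`, `B` are fixed before `ν`; only `e` and its image depend on
the spectral parameter. -/
theorem isRankOneConjugate (h : IsGrowthFrag r a β b θ r₀ a₀ p m C Cθ c D)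
    (h₀ : IsGrowthFrag r a (fun _ => 0) b θ r₀ a₀ p m C Cθ c D)
    {γ γ' : ℝ → ℝ} {C' : ℝ} (hγ : IsPrimitive γ γ') (hβγ : β =ᵐ[lebPos] γ)
    (hb' : DualBound m (fun x => γ' x * r x) C') :
    ∃ S₀ S₁ : ℝ≥0 → X m →L[ℝ] X m, ∃ A B : ℝ, ∀ ν, ∀ hB : IsBirth r a β r₀ a₀ p m C ν,
      IsRankOneConjugate S₀ S₁ (GraphK r a b (fun _ => 0) m) (GraphK r a b β m) (Ici 0)
        hB.ψ (mass m) hB.e (ν • hB.e + h.gainOp hB.ae) (2 * growthBound m r₀ C D) A B := by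
  obtain ⟨S₀, hS₀, hn₀, -, -⟩ := h₀.exists_isGeneratedBy
  obtain ⟨S₁, hS₁, hn₁, hg₁, hp₁⟩ := h.exists_isGeneratedBy
  obtain ⟨A, B, hA, hB, hAB⟩ := h.exists_control hγ hβγ hb'
  exact ⟨S₀, S₁, A, B, fun ν hBirth =>
    { nonneg := ⟨mul_nonneg zero_le_two h.growthBound_nonneg, hA, hB⟩
      gen₀ := hS₀
      gen₁ := hS₁
      bound₀ := hn₀
      bound₁ := hn₁
      graph₁ := hg₁
      pos₁ := hp₁
      conj := fun _ _ huv => h.graphK_sub h₀ hBirth huv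
      W_nonneg := fun u hu => by
        rw [mass_eq_norm hu]
        exact norm_nonneg _
      control := hAB
      approx := h.Ici_subset_closure
      decomp := exists_nonneg_sub }⟩

end IsGrowthFrag

/-! ### Functions in the dual spaces -/

namespace MemDual

variable {k : ℝ} {β : ℝ → ℝ}

theorem aestronglyMeasurable (h : MemDual k β) : AEStronglyMeasurable β lebPos := by
  refine (h.1.mul (measurable_wt k).aestronglyMeasurable).congr ?_
  filter_upwards [ae_lebPos_pos] with x hx
  exact div_mul_cancel₀ _ (wt_pos k hx).ne'

theorem ae_le (h : MemDual k β) : ∀ᵐ x ∂lebPos, |β x| ≤ dualNorm k β * wt k x := by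
  have h1 := ae_le_eLpNormEssSup (f := fun x => β x / (1 + x ^ k)) (μ := lebPos)
  filter_upwards [h1, ae_lebPos_pos] with x hx hx0
  have hw := wt_pos k hx0
  rw [← eLpNorm_exponent_top] at hx
  have h2 := ENNReal.toReal_mono h.2.ne hx
  rw [toReal_enorm, Real.norm_eq_abs, abs_div, abs_of_pos (show 0 < 1 + x ^ k from hw),
    div_le_iff₀ (show 0 < 1 + x ^ k from hw)] at h2
  exact h2

theorem mono {m : ℝ} (h : MemDual k β) (hk : 0 ≤ k) (hkm : k ≤ m) : MemDual m β := by
  refine h.of_le_mul (c := 2)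
    (h.aestronglyMeasurable.div₀ (measurable_wt m).aestronglyMeasurable) ?_
  filter_upwards [ae_lebPos_pos] with x hx
  have h1 : 0 < 1 + x ^ k := wt_pos k hx
  have h2 : 0 < 1 + x ^ m := wt_pos m hx
  have h3 : 1 + x ^ k ≤ 2 * (1 + x ^ m) := by
    rcases le_total x 1 with h' | h'
    · have := Real.rpow_le_one hx.le h' hk
      have := Real.rpow_nonneg hx.le m
      linarith
    · have := Real.rpow_le_rpow_of_exponent_le h' hkm
      have := Real.rpow_nonneg hx.le k
      linarith
  rw [Real.norm_eq_abs, Real.norm_eq_abs, abs_div, abs_div, abs_of_pos h1, abs_of_pos h2,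
    div_le_iff₀ h2, mul_div_assoc', div_mul_eq_mul_div, le_div_iff₀ h1]
  have := mul_le_mul_of_nonneg_left h3 (abs_nonneg (β x))
  linarith

theorem dualBound (h : MemDual m β) : DualBound m β (dualNorm m β) :=
  ⟨h.aestronglyMeasurable, ENNReal.toReal_nonneg, h.ae_le⟩

theorem intervalIntegrable (h : MemDual k β) (hk : 0 ≤ k) {x : ℝ} (hx : 0 ≤ x) :
    IntervalIntegrable β volume 0 x := by
  rw [intervalIntegrable_iff_integrableOn_Ioc_of_le hx]
  have hle : volume.restrict (Ioc 0 x) ≤ lebPos := Measure.restrict_mono_set _ Ioc_subset_Ioi_self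
  refine (integrable_const (dualNorm k β * wt k x)).mono'
    (h.aestronglyMeasurable.mono_measure hle) ?_
  filter_upwards [ae_mono hle h.ae_le, ae_restrict_mem measurableSet_Ioc] with y h1 h2
  refine h1.trans (mul_le_mul_of_nonneg_left ?_ ENNReal.toReal_nonneg)
  unfold wt
  have := Real.rpow_le_rpow h2.1.le h2.2 hk
  linarith

/-- The weight of order `m - 1` times the linear growth of `r` is dominated by the weight of order
`m`; this is what integration by parts against `β` requires. -/
theorem dualBound_mul_rate {r a : ℝ → ℝ} {r₀ a₀ p : ℝ} (h : MemDual (m - 1) β)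
    (hr : IsTransport r a r₀ a₀ p) (hm : 1 < m) :
    DualBound m (fun x => β x * r x) (dualNorm (m - 1) β * (r₀ * 4)) where
  meas := h.aestronglyMeasurable.mul (hr.continuousOn.aestronglyMeasurable measurableSet_Ioi)
  nonneg := mul_nonneg ENNReal.toReal_nonneg (mul_nonneg hr.r₀_pos.le (by norm_num))
  le := by
    filter_upwards [h.ae_le, ae_lebPos_pos] with x h1 hx
    have hN : 0 ≤ dualNorm (m - 1) β := ENNReal.toReal_nonneg
    have h2 := (hr.bound x hx)
    have h3 := hr.r₀_pos
    have h4 := wt_pos (m - 1) hx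
    have h5 : wt (m - 1) x * (1 + x) ≤ 4 * wt m x := by
      have e1 := rpow_sub_one_mul_le hm hx
      have e2 : x ≤ 1 + x ^ m := by
        rcases le_total x 1 with h' | h'
        · have := Real.rpow_nonneg hx.le m
          linarith
        · have := Real.self_le_rpow_of_one_le h' hm.le
          linarith
      have := Real.rpow_nonneg hx.le m
      unfold wt at *
      nlinarith
    rw [abs_mul, abs_of_pos h2.1]
    calc |β x| * r x ≤ (dualNorm (m - 1) β * wt (m - 1) x) * (r₀ * (1 + x)) := by
          have := h2.1.le
          have := h2.2
          gcongr
      _ = dualNorm (m - 1) β * r₀ * (wt (m - 1) x * (1 + x)) := by ring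
      _ ≤ dualNorm (m - 1) β * r₀ * (4 * wt m x) := by gcongr
      _ = _ := by ring

end MemDual

/-! ### The rank-one operator -/

namespace IsBirth

variable {r a β : ℝ → ℝ} {r₀ a₀ p C ν : ℝ}

/-- The operator `E_ν`. -/
def rankOne (h : IsBirth r a β r₀ a₀ p m C ν) : X m →L[ℝ] X m :=
  ((1 - h.ψ h.e)⁻¹ • h.ψ).smulRight h.e

theorem isEOp (h : IsBirth r a β r₀ a₀ p m C ν) : IsEOp r a β m ν h.rankOne where
  integrable_eFun := h.toIsTransport.integrable_eFun h.one_lt h.lt'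
  pairing_lt_one := by
    rw [← h.ψ_e]
    exact h.ψ_e_lt_one
  apply_eq f := by
    change (((1 - h.ψ h.e)⁻¹ * h.ψ f) • h.e : X m) =ᵐ[lebPos] _
    filter_upwards [X_smul ((1 - h.ψ h.e)⁻¹ * h.ψ f) h.e, h.e_ae] with x h1 h2
    rw [h1, h2, h.ψ_e, h.ψ_apply]
    ring

/-- `I + E_ν` as an invertible operator. -/
def unit (h : IsBirth r a β r₀ a₀ p m C ν) : (X m →L[ℝ] X m)ˣ where
  val := 1 + h.rankOne
  inv := subRankOne h.ψ h.e
  val_inv := by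
    have hne : 1 - h.ψ h.e ≠ 0 := (sub_pos.2 h.ψ_e_lt_one).ne'
    ext1 f
    have : (1 - h.ψ h.e)⁻¹ * (h.ψ f - h.ψ f * h.ψ h.e) = h.ψ f := by field_simp
    simp [rankOne, this]
  inv_val := by
    have hne : 1 - h.ψ h.e ≠ 0 := (sub_pos.2 h.ψ_e_lt_one).ne'
    ext1 f
    have : h.ψ f + (1 - h.ψ h.e)⁻¹ * h.ψ f * h.ψ h.e = (1 - h.ψ h.e)⁻¹ * h.ψ f := by
      field_simp
      ring
    simp [rankOne, this]

/-- `T S₁ T⁻¹ - S₀ = (T S₁ - S₀ T) T⁻¹`, and a compact operator composed with a bounded one is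
compact. -/
theorem isCompactOperator {G₀ G₁ : X m → X m → Prop} {S₀ S₁ : ℝ≥0 → X m →L[ℝ] X m} {W : X m →L[ℝ] ℝ}
    {P : Set (X m)} {f : X m} {c A B : ℝ} (h : IsBirth r a β r₀ a₀ p m C ν)
    (H : IsRankOneConjugate S₀ S₁ G₀ G₁ P h.ψ W h.e f c A B) (t : ℝ≥0) :
    IsUnit (1 + h.rankOne) ∧ IsCompactOperator
      (Ring.inverse (1 + h.rankOne) * S₁ t * (1 + h.rankOne) - S₀ t : X m →L[ℝ] X m) := by
  refine ⟨h.unit.isUnit, ?_⟩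
  have h1 : Ring.inverse (1 + h.rankOne) = subRankOne h.ψ h.e := Ring.inverse_unit h.unit
  have h2 : subRankOne h.ψ h.e * (1 + h.rankOne) = 1 := h.unit.inv_val
  have h3 : Ring.inverse (1 + h.rankOne) * S₁ t * (1 + h.rankOne) - S₀ t =
      (subRankOne h.ψ h.e * S₁ t - S₀ t * subRankOne h.ψ h.e) * (1 + h.rankOne) := by
    rw [h1, sub_mul, mul_assoc (S₀ t), h2, mul_one]
  rw [h3]
  exact (H.isCompactOperator t).comp_clm (1 + h.rankOne)

end IsBirth

end

end GrowthFrag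

end

/-! ### Assembly of the main theorem -/

theorem mainTheorem4
    -- transport coefficient
    (r : ℝ → ℝ) (r₀ : ℝ) (hr_cont : ContinuousOn r (Ioi 0))
    (hr : ∀ x, 0 < x → 0 < r x ∧ r x ≤ r₀ * (1 + x))
    (hr_zero : ∃ δ > 0, IntegrableOn (fun s => 1 / r s) (Ioo 0 δ))
    -- fragmentation rate
    (a : ℝ → ℝ) (a₀ p : ℝ) (hp : 0 < p) (ha_meas : Measurable a)
    (ha : ∀ x, 0 < x → 0 ≤ a x ∧ a x ≤ a₀ * (1 + x ^ p))
    -- fragmentation kernel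
    (b : ℝ → ℝ → ℝ) (b₀ l : ℝ) (hl : 0 ≤ l) (hb_meas : Measurable (Function.uncurry b))
    (hb_nonneg : ∀ x y, 0 < x → 0 < y → 0 ≤ b x y)
    (hb_supp : ∀ x y, 0 < y → y < x → b x y = 0)
    (hb_mass : ∀ y, 0 < y → GrowthFrag.moment b 1 y = ENNReal.ofReal y)
    (hb_number : ∀ y, 0 < y → GrowthFrag.moment b 0 y ≤ ENNReal.ofReal (b₀ * (1 + y ^ l)))
    (hb_liminf : ∃ m₀ : ℝ, 1 < m₀ ∧
      0 < liminf (fun y => GrowthFrag.momentDefect b m₀ y / y ^ m₀) atTop)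
    -- the exponent of the weight
    (m : ℝ) (hm_small : l + p ≤ 1 → 1 < m) (hm_large : 1 < l + p → l + p ≤ m)
    -- boundary rate
    (β : ℝ → ℝ) (k : ℝ) (hk : 0 ≤ k) (hkm : k + p ≤ m)
    (hβ_nonneg : ∀ᵐ x ∂GrowthFrag.lebPos, 0 ≤ β x) (hβ : GrowthFrag.MemDual k β)
    (hβ_deriv : ∃ β' : ℝ → ℝ, GrowthFrag.HasDistribDeriv β β' ∧ GrowthFrag.MemDual (m - 1) β') :
    ∃ S₀ Sβ : ℝ≥0 → GrowthFrag.X m →L[ℝ] GrowthFrag.X m,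
      GrowthFrag.IsGeneratedBy S₀ (GrowthFrag.GraphK r a b (fun _ => 0) m) ∧
      GrowthFrag.IsGeneratedBy Sβ (GrowthFrag.GraphK r a b β m) ∧
      ∀ μ : ℝ, 2 * m * r₀ + GrowthFrag.dualNorm m β < μ →
        ∃ E : GrowthFrag.X m →L[ℝ] GrowthFrag.X m,
          GrowthFrag.IsEOp r a β m μ E ∧ IsUnit (1 + E) ∧
          ∀ t : ℝ≥0, IsCompactOperator
            (Ring.inverse (1 + E) * Sβ t * (1 + E) - S₀ t : GrowthFrag.X m →L[ℝ] GrowthFrag.X m) := by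
  have hm : 1 < m := (le_or_gt (l + p) 1).elim hm_small fun h => h.trans_le (hm_large h)
  have hlm : l < m := (le_or_gt (l + p) 1).elim (fun h => by linarith [hm_small h])
    fun h => by linarith [hm_large h]
  have hT : GrowthFrag.IsTransport r a r₀ a₀ p := ⟨hr_cont, hr, hr_zero, hp, ha_meas, ha⟩
  have hF : GrowthFrag.IsFragKernel b b₀ l m :=
    ⟨hl, hlm, hm, hb_meas, hb_nonneg, hb_mass, hb_number, hb_liminf⟩
  obtain ⟨θ, Cθ, c, D, hGF⟩ := hT.exists_isGrowthFrag hF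
  have hβm := (hβ.mono hk (show k ≤ m by linarith)).dualBound
  have h := hGF β _ hβm hβ_nonneg
  -- The zero birth rate is given the constant of `β`, so that both semigroups have the same growth
  -- bound.
  have h₀ := hGF (fun _ => 0) _ (GrowthFrag.dualBound_zero hβm.nonneg)
    (Eventually.of_forall fun _ => le_rfl)
  obtain ⟨β', hβ', hβ'm⟩ := hβ_deriv
  -- `β'` is bounded near `0`, so `β` has an absolutely continuous representative on `[0, ∞)`, whose
  -- value at `0` enters the integration by parts.
  obtain ⟨γ, hγ, hβγ⟩ := hβ'.exists_isPrimitive fun x hx =>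
    hβ'm.intervalIntegrable (by linarith) hx
  obtain ⟨S₀, Sβ, A, B, H⟩ := h.isRankOneConjugate h₀ hγ hβγ (hβ'm.dualBound_mul_rate hT hm)
  -- Generation does not involve the spectral parameter and is read off at an arbitrary admissible
  -- value.
  refine ⟨S₀, Sβ, (H _ (h.isBirth (lt_add_one _))).gen₀, (H _ (h.isBirth (lt_add_one _))).gen₁,
    fun μ hμ => ?_⟩
  have hB := h.isBirth hμ
  exact ⟨hB.rankOne, hB.isEOp, (hB.isCompactOperator (H μ hB) 0).1,
    fun t => (hB.isCompactOperator (H μ hB) t).2⟩
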